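/- **Globular sets.** An $n$-globular set $X$ consists of sets $X_k$ of $k$-cells ($0\le k\le n$) and maps $s,t\colon X_k\to X_{k-1}$ ($1\le k\le n$) with $st=ss$, $ts=tt$; write $|x|=k$ if $x\in X_k$. For $k\le n$, a $k$-globular set is regarded as an $n$-globular set with no cells above dimension $k$. Put $\langle\ell\rangle=\{1,\dots,\ell\}$. **Simple string diagrams.** A simple $k$-string diagram $D$ is a sequence of (not necessarily order preserving) maps $\langle\ell_k\rangle\xrightarrow{v^k}\cdots\xrightarrow{v^2}\langle\ell_1\rangle\xrightarrow{v^1}\langle\ell_0\rangle=\langle1\rangle$. Its source and its target are both its truncation $(v^1,\dots,v^{k-1})$. The globular set $\widehat D$ is obtained from one $0$-cell $x^0_1$ by attaching, successively for $m=1,\dots,k$ and $i=1,\dots,\ell_m$, an $m$-cell $x^m_i$ (together with a new target $t(x^m_i)$) along its source: $s(x^m_i)=x^{m-1}_{v^m(i)}$ if $i$ is the least element of its fibre under $v^m$, and otherwise $s(x^m_i)=t(x^m_p)$ with $p=\max\{j<i: v^m(j)=v^m(i)\}$. An $X$-labelling of $D$ is a map of globular sets $\widehat D\to X$. It is the same thing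 as a choice of cells $x^m_i\in X_m$ satisfying these equations. If $k\ge1$, there are two inclusions $\widehat{D'}\hookrightarrow\widehat D$, where $D'$ is the truncation of $D$. Both send $x^m_i$ to $x^m_i$, except that the target inclusion sends $x^{k-1}_i$ to $t(x^k_p)$, $p=\max (v^k)^{-1}(i)$, if $i$ is in the image of $v^k$. **The monad $T_n^{D^s}$.** Let $T_n^{D^s}(X)_k$, for $0\le k\le n$, be the set of pairs of a simple $k$-string diagram $D$ and an $X$-labelling of $D$; source and target are given by restriction along the source and target inclusions. The unit sends $x\in X_k$ to the diagram with exactly one dot in each dimension $0,\dots,k$, the top dot being labelled by $x$ (so that the others are labelled by its iterated sources). The multiplication replaces every dot by the diagram that labels it: if $D$ is labelled by the labelled $m$-diagrams $D^m_i$, then the level $m$ of the composite is $\coprod_{i=1}^{\ell_m(D)}\langle\ell_m(D^m_i)\rangle$, ordered first by $i$, with the maps $v^m(D^m_i)\colon\langle\ell_m(D^m_i)\rangle\to\langle\ell_{m-1}(D^m_i)\rangle=\langle\ell_{m-1}(D^{m-1}_{v^m(i)})\rangle$, and with the labels of the top dots of the $D^m_i$. This is a monad on the category of $n$-globular sets.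 An $n$-sesquicategory is an algebra over $T_n^{D^s}$, and a functor between $n$-sesquicategories is a morphism of algebras. **Generators $\mathcal O_n$.** For $1\le i,j\le n$ with $m=\min\{i,j\}$ and $M=\max\{i,j\}$, let $\circ_{i,j}$ be the simple $M$-string diagram with $\ell_m=2$ and $\ell_p=1$ for all other $p\le M$, where moreover $v^{i+1}=(1)$ if $i<j$, and $v^{j+1}=(2)$ if $j<i$. A labelling of it is determined by a pair of cells $x\in X_i$, $y\in X_j$ with $s^{i-m+1}(x)=t^{j-m+1}(y)$: if $i\le j$, then $x$ labels the second dot of dimension $m$; if $j\le i$, then $y$ labels the first dot of dimension $m$; if $i\neq j$, the cell of dimension $M$ labels the dot of dimension $M$. For $1\le i\le n$, let $u_i$ be the simple $i$-string diagram with $\ell_p=1$ for $p<i$ and $\ell_i=0$; a labelling of it is determined by a cell $x\in X_{i-1}$, which labels the dot of dimension $i-1$. **Operations and relations.** Consider, on an $n$-globular set $\mathcal C$ with sets of cells $\mathcal C_i$, binary operations $$\circ_{i,j}\colon\mathcal C_i\times_{\mathcal C_{m-1}}\mathcal C_j\to\mathcal C_M\qquad(1\le i,j\le n,\ m=\min\{i,j\},\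 M=\max\{i,j\}),$$ where the pullback is taken with respect to $s^{i-m+1}$ and $t^{j-m+1}$, and unary operations $u_i\colon\mathcal C_{i-1}\to\mathcal C_i$ ($1\le i\le n$). Suppressing the indices, consider the following laws, for all cells for which the two sides are defined: 1. $s(x\circ y)=s(x)\circ y$ and $t(x\circ y)=t(x)\circ y$ if $|x|>|y|$; 2. $s(x\circ y)=x\circ s(y)$ and $t(x\circ y)=x\circ t(y)$ if $|x|<|y|$; 3. $s(x\circ y)=s(y)$ and $t(x\circ y)=t(x)$ if $|x|=|y|$; 4. $s(u(x))=t(u(x))=x$; 5. $(x\circ y)\circ z=x\circ(y\circ z)$ if the two smallest of $|x|,|y|,|z|$ are equal; 6. $x\circ(y\circ z)=(x\circ y)\circ(x\circ z)$ if $|x|<|y|$ and $|x|<|z|$; 7. $(x\circ y)\circ z=(x\circ z)\circ(y\circ z)$ if $|z|<|x|$ and $|z|<|y|$; 8. $u(x)\circ y=y$ if $|x|<|y|$, and $u(x)\circ y=u(x\circ y)$ if $|x|\ge|y|$; 9. $x\circ u(y)=x$ if $|x|>|y|$, and $x\circ u(y)=u(x\circ y)$ if $|x|\le|y|$. Let $\mathcal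 E_n$ be the set of relations 5–9. **The monad presented by $(\mathcal O_n,\mathcal E_n)$.** Given an $n$-globular set $X$, consider formal trees built from cells of $X$ (the leaves) by the formal operations $x\circ_{i,j}y$ ($|x|=i$, $|y|=j$, of dimension $\max\{i,j\}$) and $u_i(x)$ ($|x|=i-1$, of dimension $i$), with sources and targets defined recursively by 1–4 and by those of $X$. Compatibility of trees and an equivalence relation $\sim$ on compatible trees are defined simultaneously, by induction. Leaves are compatible. The tree $x\circ_{i,j}y$ ($1\le i,j\le n$) is compatible if and only if $x$ and $y$ are compatible and $s^{i-m+1}(x)\sim t^{j-m+1}(y)$, $m=\min\{i,j\}$. The tree $u_i(x)$ ($1\le i\le n$) is compatible if and only if $x$ is. The relation $\sim$ is generated by identifying the two sides of each relation in $\mathcal E_n$ whenever both are compatible, and by closure under the formation of compatible trees. Then $\sim$ respects sources and targets, and the classes of compatible trees form an $n$-globular set $\widetilde{\mathrm{Tree}}{}_n^{\mathcal O,\mathcal E}(X)$. With relabelling of leaves as action on maps, with leaves as unit and with grafting of trees as multiplication, this is a monad $\widetilde{\mathrm{Tree}}{}_n^{\mathcal O,\mathcal E}$ on $n$-globular sets.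 **Theorem.** Let $n\ge0$. (a) There is an isomorphism of monads $\tilde\varphi\colon\widetilde{\mathrm{Tree}}{}_n^{\mathcal O,\mathcal E}\to T_n^{D^s}$ which, for cells $x,y$ of an $n$-globular set $X$ with $|x|=i$, $|y|=j$, sends the class of the tree $x\circ_{i,j}y$ (if it is compatible) to the diagram $\circ_{i,j}$ labelled by $x$ and $y$, and which, for a cell $x$ with $|x|=i-1<n$, sends the class of the tree $u_i(x)$ to the diagram $u_i$ labelled by $x$. (b) Consequently, an $n$-sesquicategory is an $n$-globular set equipped with operations $\circ_{i,j}$ and $u_i$ satisfying the laws 1–9. More precisely, for every $n$-globular set $\mathcal C$, sending a $T_n^{D^s}$-algebra structure $a\colon T_n^{D^s}(\mathcal C)\to\mathcal C$ to the operations $x\circ_{i,j}y=a(\circ_{i,j}\text{ labelled by }x,y)$ and $u_i(x)=a(u_i\text{ labelled by }x)$ is a bijection from the set of $T_n^{D^s}$-algebra structures on $\mathcal C$ onto the set of families of operations on $\mathcal C$ satisfying 1–9. Moreover, a map of $n$-globular sets between two $n$-sesquicategories is a functor of $n$-sesquicategories if and only if it preserves all the operations $\circ_{i,j}$ and $u_i$.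 -/

import Mathlib

open CategoryTheory

universe u v w

namespace Sesqui

/-! ### Globular sets -/

/-- An `n`-globular set: sets of `k`-cells for `0 ≤ k ≤ n`, with source and target maps satisfying
the globularity relations.  (The family of cells is indexed by all natural numbers, with no cells
above dimension `n`.) -/
structure GSet (n : ℕ) where
  cell : ℕ → Type u
  src : ∀ {k : ℕ}, cell (k + 1) → cell k
  tgt : ∀ {k : ℕ}, cell (k + 1) → cell k
  src_tgt : ∀ {k : ℕ} (x : cell (k + 2)), src (tgt x) = src (src x)
  tgt_src : ∀ {k : ℕ} (x : cell (k + 2)), tgt (src x) = tgt (tgt x)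
  dim_le : ∀ {k : ℕ}, cell k → k ≤ n

namespace GSet

/-- A map of globular sets.  The dimension bounds of the two sides may differ: a `k`-globular set
is regarded as an `n`-globular set, for `k ≤ n`, by extending it by the empty set. -/
@[ext]
structure Hom {m n : ℕ} (X : GSet.{u} m) (Y : GSet.{v} n) where
  app : ∀ k : ℕ, X.cell k → Y.cell k
  map_src : ∀ (k : ℕ) (x : X.cell (k + 1)), app k (X.src x) = Y.src (app (k + 1) x)
  map_tgt : ∀ (k : ℕ) (x : X.cell (k + 1)), app k (X.tgt x) = Y.tgt (app (k + 1) x)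

/-- The composite of two maps of globular sets. -/
def Hom.comp {l m n : ℕ} {X : GSet.{u} l} {Y : GSet.{v} m} {Z : GSet.{w} n}
    (f : Hom X Y) (g : Hom Y Z) : Hom X Z where
  app k x := g.app k (f.app k x)
  map_src k x := by rw [f.map_src, g.map_src]
  map_tgt k x := by rw [f.map_tgt, g.map_tgt]

instance (n : ℕ) : Category (GSet.{u} n) where
  Hom X Y := Hom X Y
  id X := ⟨fun _ x => x, fun _ _ => rfl, fun _ _ => rfl⟩
  comp f g := Hom.comp f g

theorem hom_ext {n : ℕ} {X Y : GSet.{u} n} {f g : X ⟶ Y}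
    (h : ∀ k x, Hom.app f k x = Hom.app g k x) : f = g :=
  Hom.ext (funext fun k => funext fun x => h k x)

@[simp] theorem id_app {n : ℕ} (X : GSet.{u} n) (k : ℕ) (x : X.cell k) :
    Hom.app (𝟙 X) k x = x := rfl

@[simp] theorem comp_app {n : ℕ} {X Y Z : GSet.{u} n} (f : X ⟶ Y) (g : Y ⟶ Z) (k : ℕ)
    (x : X.cell k) : Hom.app (f ≫ g) k x = Hom.app g k (Hom.app f k x) := rfl

/-- The type of all cells of a globular set, of any dimension. -/
def Cell {n : ℕ} (X : GSet.{u} n) : Type u := Σ k : ℕ, X.cell k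

/-- The dimension `|x|` of a cell. -/
def Cell.dim {n : ℕ} {X : GSet.{u} n} (x : X.Cell) : ℕ := x.1

/-- The source of a cell (a `0`-cell is sent to itself, so that this can be iterated). -/
def Cell.s {n : ℕ} {X : GSet.{u} n} : X.Cell → X.Cell
  | ⟨0, x⟩ => ⟨0, x⟩
  | ⟨k + 1, x⟩ => ⟨k, X.src x⟩

/-- The target of a cell (a `0`-cell is sent to itself, so that this can be iterated). -/
def Cell.t {n : ℕ} {X : GSet.{u} n} : X.Cell → X.Cell
  | ⟨0, x⟩ => ⟨0, x⟩
  | ⟨k + 1, x⟩ => ⟨k, X.tgt x⟩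

/-- The action of a map of globular sets on cells. -/
def Hom.onCell {m n : ℕ} {X : GSet.{u} m} {Y : GSet.{v} n} (f : Hom X Y) (x : X.Cell) : Y.Cell :=
  ⟨x.1, f.app x.1 x.2⟩

end GSet

/-! ### Labelled sequences of moves

A state is a list of labels.  A move `(q, a, b)` requires the label at position `q` to be `a`, and
replaces it by `b`. -/

/-- The state reached after performing a list of moves. -/
def run {A : Type u} : List A → List (ℕ × A × A) → List A
  | st, [] => st
  | st, mv :: L => run (st.set mv.1 mv.2.2) L

/-- Every move of the list finds the label it requires. -/
def Fits {A : Type u} : List A → List (ℕ × A × A) → Prop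
  | _, [] => True
  | st, mv :: L => st[mv.1]? = some mv.2.1 ∧ Fits (st.set mv.1 mv.2.2) L

section moves

variable {A : Type u} {B : Type v}

theorem run_append (st : List A) (L M : List (ℕ × A × A)) :
    run st (L ++ M) = run (run st L) M := by
  induction L generalizing st with
  | nil => rfl
  | cons mv L ih => exact ih _

theorem fits_append (st : List A) (L M : List (ℕ × A × A)) :
    Fits st (L ++ M) ↔ Fits st L ∧ Fits (run st L) M := by
  induction L generalizing st with
  | nil => simp [Fits, run]
  | cons mv L ih => simp [Fits, run, ih, and_assoc]

theorem run_length (st : List A) (L : List (ℕ × A × A)) : (run st L).length = st.length := by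
  induction L generalizing st with
  | nil => rfl
  | cons mv L ih => simp [run, ih]

theorem set_map_inv (g : A → B) {st : List A} {q : ℕ} {a b : A} (h : st[q]? = some a)
    (hg : g a = g b) : (st.set q b).map g = st.map g := by
  rw [List.map_set, ← hg]
  apply List.ext_getElem?
  intro i
  rw [List.getElem?_set]
  split_ifs with h1 h2
  · subst h1; simp [h]
  · subst h1; simp only [List.length_map, not_lt] at h2; simp [h2]
  · rfl

theorem run_map_inv (g : A → B) (st : List A) (L : List (ℕ × A × A)) (h : Fits st L)
    (hg : ∀ mv ∈ L, g mv.2.1 = g mv.2.2) : (run st L).map g = st.map g := by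
  induction L generalizing st with
  | nil => rfl
  | cons mv L ih =>
    rw [run, ih _ h.2 fun m hm => hg m (List.mem_cons_of_mem _ hm),
      set_map_inv g h.1 (hg mv List.mem_cons_self)]

theorem fits_get (g : A → B) (st : List A) (L : List (ℕ × A × A)) (h : Fits st L)
    (hg : ∀ mv ∈ L, g mv.2.1 = g mv.2.2) (mv : ℕ × A × A) (hm : mv ∈ L) :
    (st.map g)[mv.1]? = some (g mv.2.1) := by
  induction L generalizing st with
  | nil => cases hm
  | cons mv' L ih =>
    rcases List.mem_cons.1 hm with rfl | hm
    · simp [h.1]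
    · rw [← set_map_inv g h.1 (hg mv' List.mem_cons_self)]
      exact ih _ h.2 (fun m hm => hg m (List.mem_cons_of_mem _ hm)) hm

theorem flatten_take_sum (ws : List (List ℕ)) (q r : ℕ) (w : List ℕ) (h : ws[q]? = some w)
    (hr : r ≤ w.length) :
    (ws.flatten.take (((ws.map List.length).take q).sum + r)).sum =
      ((ws.map List.sum).take q).sum + (w.take r).sum := by
  induction ws generalizing q with
  | nil => simp at h
  | cons w' ws ih =>
    cases q with
    | zero =>
      simp only [List.getElem?_cons_zero, Option.some.injEq] at h
      subst h
      simp [List.take_append_of_le_length hr]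
    | succ q =>
      have := ih q (by simpa using h)
      simp only [List.flatten_cons, List.map_cons, List.take_succ_cons, List.sum_cons,
        Nat.add_assoc, List.take_length_add_append, List.sum_append, this]

/-- Renaming the labels of a move. -/
def mapMove (f : A → B) (mv : ℕ × A × A) : ℕ × B × B := (mv.1, f mv.2.1, f mv.2.2)

theorem run_map (f : A → B) (st : List A) (L : List (ℕ × A × A)) :
    run (st.map f) (L.map (mapMove f)) = (run st L).map f := by
  induction L generalizing st with
  | nil => rfl
  | cons mv L ih => simp [run, mapMove, ← ih, List.map_set]

theorem fits_map (f : A → B) (st : List A) (L : List (ℕ × A × A)) (h : Fits st L) :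
    Fits (st.map f) (L.map (mapMove f)) := by
  induction L generalizing st with
  | nil => trivial
  | cons mv L ih =>
    refine ⟨by simp [mapMove, h.1], ?_⟩
    have := ih _ h.2
    rwa [List.map_set] at this

/-- Shifting the position of a move. -/
def shiftMove (o : ℕ) (mv : ℕ × A × A) : ℕ × A × A := (o + mv.1, mv.2)

theorem run_shift (a st b : List A) (L : List (ℕ × A × A)) (h : Fits st L) :
    Fits (a ++ st ++ b) (L.map (shiftMove a.length)) ∧
      run (a ++ st ++ b) (L.map (shiftMove a.length)) = a ++ run st L ++ b := by
  induction L generalizing st with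
  | nil => simp [Fits, run]
  | cons mv L ih =>
    have hlt : mv.1 < st.length := by
      by_contra hc
      have := h.1
      rw [List.getElem?_eq_none (by omega)] at this
      cases this
    have e : (a ++ st ++ b).set (a.length + mv.1) mv.2.2 = a ++ st.set mv.1 mv.2.2 ++ b := by
      rw [List.append_assoc, List.set_append_right _ _ (by omega), List.append_assoc,
        List.set_append_left _ _ (by omega)]
      simp
    have := ih _ h.2
    refine ⟨⟨?_, ?_⟩, ?_⟩
    · simp only [shiftMove, List.append_assoc]
      rw [List.getElem?_append_right (by omega), List.getElem?_append_left (by omega)]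
      simpa using h.1
    · simp only [shiftMove]; rw [e]; exact this.1
    · simp only [List.map_cons, run, shiftMove]; rw [e]; exact this.2

/-- Replacing the labels of a list of labelled positions. -/
def relabel (L : List (ℕ × A)) (ys : List A) : List (ℕ × A) :=
  List.zipWith (fun p y => (p.1, y)) L ys

theorem relabel_fst (L : List (ℕ × A)) (ys : List A) (h : L.length = ys.length) :
    (relabel L ys).map Prod.fst = L.map Prod.fst := by
  induction L generalizing ys with
  | nil => simp [relabel]
  | cons p L ih =>
    cases ys with
    | nil => simp at h
    | cons y ys => simpa [relabel] using ih ys (by simpa using h)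

theorem relabel_snd (L : List (ℕ × A)) (ys : List A) (h : L.length = ys.length) :
    (relabel L ys).map Prod.snd = ys := by
  induction L generalizing ys with
  | nil => cases ys <;> simp_all [relabel]
  | cons p L ih =>
    cases ys with
    | nil => simp at h
    | cons y ys => simpa [relabel] using ih ys (by simpa using h)

theorem pair_ext {L M : List (ℕ × A)} (h1 : L.map Prod.fst = M.map Prod.fst)
    (h2 : L.map Prod.snd = M.map Prod.snd) : L = M := by
  induction L generalizing M with
  | nil => cases M <;> simp_all
  | cons p L ih =>
    cases M with
    | nil => simp at h1
    | cons q M =>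
      simp only [List.map_cons, List.cons.injEq] at h1 h2
      rw [ih h1.2 h2.2, Prod.ext h1.1 h2.1]

end moves

/-- The moves performed by a list of cells: each one replaces its source by its target. -/
def moves {n : ℕ} (X : GSet.{u} n) {m : ℕ} (L : List (ℕ × X.cell (m + 1))) :
    List (ℕ × X.cell m × X.cell m) :=
  L.map fun p => (p.1, X.src p.2, X.tgt p.2)


theorem moves_relabel {n : ℕ} (X : GSet.{u} n) {m : ℕ} (L : List (ℕ × X.cell (m + 1)))
    (ys : List (X.cell (m + 1))) (hs : ys.map X.src = (L.map Prod.snd).map X.src)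
    (ht : ys.map X.tgt = (L.map Prod.snd).map X.tgt) : moves X (relabel L ys) = moves X L := by
  induction L generalizing ys with
  | nil => simp [relabel, moves]
  | cons p L ih =>
    cases ys with
    | nil => simp at hs
    | cons y ys =>
      simp only [List.map_cons, List.cons.injEq] at hs ht
      have := ih ys hs.2 ht.2
      simp only [relabel, moves] at this
      simp [relabel, moves, hs.1, ht.1, this]

/-! ### Lists of labelled dots

A labelled `k`-diagram, given by the list of its labelled dots in each dimension: the entry at
index `i` of the list `lvl m` consists of the value of `v^m` at the `i`-th dot of level `m`, and of
the label of this dot.  Positions are counted from `0`. -/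

/-- Labelled simple `k`-string diagrams, as lists of labelled dots. -/
@[ext]
structure Lab {n : ℕ} (X : GSet.{u} n) (k : ℕ) where
  lvl : ∀ m : ℕ, List (ℕ × X.cell m)
  le : k ≤ n
  lvl_zero : ∃ x, lvl 0 = [(0, x)]
  lvl_top : ∀ m, k < m → lvl m = []
  fits : ∀ m, Fits ((lvl m).map Prod.snd) (moves X (lvl (m + 1)))

namespace Lab

variable {n : ℕ} {X : GSet.{u} n} {k : ℕ}

/-- The labels of the dots of dimension `m`. -/
def top (P : Lab X k) (m : ℕ) : List (X.cell m) := (P.lvl m).map Prod.snd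

/-- The labels of dimension `m` after passing all the dots of dimension `m + 1`. -/
def out (P : Lab X k) (m : ℕ) : List (X.cell m) := run (P.top m) (moves X (P.lvl (m + 1)))

theorem out_length (P : Lab X k) (m : ℕ) : (P.lvl m).length = (P.out m).length := by
  simp [out, top, run_length]

theorem out_inv {B : Type v} (P : Lab X k) (m : ℕ) (g : X.cell m → B)
    (hg : ∀ x : X.cell (m + 1), g (X.src x) = g (X.tgt x)) :
    (P.out m).map g = (P.top m).map g := by
  refine run_map_inv g _ _ (P.fits m) ?_
  intro mv hm
  obtain ⟨p, -, rfl⟩ := List.mem_map.1 hm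
  exact hg _

/-- The source: forget the dots of top dimension. -/
def src (P : Lab X (k + 1)) : Lab X k where
  lvl m := if m ≤ k then P.lvl m else []
  le := (Nat.le_succ k).trans P.le
  lvl_zero := by simpa using P.lvl_zero
  lvl_top m h := if_neg (by omega)
  fits m := by
    by_cases h : m + 1 ≤ k
    · simpa [h, (Nat.le_succ m).trans h] using P.fits m
    · simp only [if_neg h]; trivial

/-- The target: forget the dots of top dimension, after passing them. -/
def tgt (P : Lab X (k + 1)) : Lab X k where
  lvl m := if m < k then P.lvl m else if m = k then relabel (P.lvl m) (P.out m) else []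
  le := (Nat.le_succ k).trans P.le
  lvl_zero := by
    obtain ⟨x, hx⟩ := P.lvl_zero
    by_cases h : 0 < k
    · exact ⟨x, by simp [h, hx]⟩
    · have hl := P.out_length 0
      rw [hx] at hl
      obtain ⟨y, hy⟩ := List.length_eq_one_iff.1 hl.symm
      refine ⟨y, ?_⟩
      simp only [if_neg h, if_pos (show 0 = k by omega), hy, hx]; rfl
  lvl_top m h := by rw [if_neg (by omega), if_neg (by omega)]
  fits m := by
    by_cases h : m + 1 < k
    · simpa [h, (Nat.lt_succ_self m).trans h] using P.fits m
    · by_cases h2 : m + 1 = k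
      · subst h2
        simp only [if_pos (Nat.lt_succ_self m), lt_irrefl, if_false, if_true]
        rw [moves_relabel]
        · exact P.fits m
        · exact P.out_inv (m + 1) X.src fun x => (X.src_tgt x).symm
        · exact P.out_inv (m + 1) X.tgt fun x => X.tgt_src x
      · simp only [if_neg h, if_neg h2]; trivial

theorem src_lvl (P : Lab X (k + 1)) {m : ℕ} (h : m ≤ k) : P.src.lvl m = P.lvl m := if_pos h

theorem tgt_lvl (P : Lab X (k + 1)) {m : ℕ} (h : m < k) : P.tgt.lvl m = P.lvl m := if_pos h

theorem tgt_lvl_self (P : Lab X (k + 1)) : P.tgt.lvl k = relabel (P.lvl k) (P.out k) := by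
  simp [tgt]

theorem ext_le {P Q : Lab X k} (h : ∀ m ≤ k, P.lvl m = Q.lvl m) : P = Q := by
  apply Lab.ext
  funext m
  by_cases hm : m ≤ k
  · exact h m hm
  · rw [P.lvl_top m (by omega), Q.lvl_top m (by omega)]

theorem ext_tgt {P : Lab X (k + 1)} {Q : Lab X k} (h : ∀ m < k, P.lvl m = Q.lvl m)
    (h' : relabel (P.lvl k) (P.out k) = Q.lvl k) : P.tgt = Q := by
  apply ext_le
  intro m hm
  rcases hm.lt_or_eq with hm | rfl
  · rw [tgt_lvl _ hm, h m hm]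
  · rw [tgt_lvl_self, h']

/-- Labelled diagrams form a globular set. -/
abbrev obj (X : GSet.{u} n) : GSet.{u} n where
  cell k := Lab X k
  src := src
  tgt := tgt
  src_tgt P := by
    apply ext_le
    intro m hm
    rw [src_lvl _ hm, src_lvl _ hm, tgt_lvl _ (by omega), src_lvl _ (by omega)]
  tgt_src P := by
    rename_i k
    apply ext_tgt
    · intro m hm
      rw [tgt_lvl _ hm, src_lvl _ (by omega), tgt_lvl _ (by omega)]
    · rw [tgt_lvl_self, src_lvl _ (by omega), tgt_lvl _ (by omega)]
      congr 1
      simp only [out, top]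
      rw [src_lvl _ (by omega), tgt_lvl _ (by omega), src_lvl _ (by omega), tgt_lvl_self,
        moves_relabel]
      · exact P.out_inv (k + 1) X.src fun x => (X.src_tgt x).symm
      · exact P.out_inv (k + 1) X.tgt fun x => X.tgt_src x
  dim_le P := P.le

variable {Y : GSet.{u} n}

theorem moves_map (f : X ⟶ Y) {m : ℕ} (L : List (ℕ × X.cell (m + 1))) :
    moves Y (L.map (Prod.map id (f.app (m + 1)))) = (moves X L).map (mapMove (f.app m)) := by
  simp only [moves, List.map_map]
  apply List.map_congr_left
  intro p _
  simp [mapMove, f.map_src, f.map_tgt]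

/-- Renaming the labels. -/
def map (f : X ⟶ Y) (P : Lab X k) : Lab Y k where
  lvl m := (P.lvl m).map (Prod.map id (f.app m))
  le := P.le
  lvl_zero := by
    obtain ⟨x, hx⟩ := P.lvl_zero
    exact ⟨f.app 0 x, by simp [hx]⟩
  lvl_top m h := by simp [P.lvl_top m h]
  fits m := by
    rw [moves_map]
    convert fits_map (f.app m) _ _ (P.fits m) using 1
    simp

theorem map_out (f : X ⟶ Y) (P : Lab X k) (m : ℕ) :
    (P.map f).out m = (P.out m).map (f.app m) := by
  have h : (P.map f).top m = (P.top m).map (f.app m) := by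
    simp only [top, map, List.map_map]; rfl
  rw [out, out, ← run_map, ← moves_map, h]
  rfl

theorem relabel_map {A : Type u} {B : Type v} (f : A → B) (L : List (ℕ × A)) (ys : List A) :
    relabel (L.map (Prod.map id f)) (ys.map f) = (relabel L ys).map (Prod.map id f) := by
  simp [relabel, List.zipWith_map, List.map_zipWith]

theorem map_src (f : X ⟶ Y) (P : Lab X (k + 1)) : map f P.src = (map f P).src := by
  apply ext_le
  intro m hm
  simp only [map, src_lvl _ hm]

theorem map_tgt (f : X ⟶ Y) (P : Lab X (k + 1)) : map f P.tgt = (map f P).tgt := by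
  symm
  apply ext_tgt
  · intro m hm
    simp only [map, tgt_lvl _ hm]
  · rw [map_out]
    simp only [map, tgt_lvl_self, relabel_map]

/-- The endofunctor of labelled diagrams. -/
abbrev functor (n : ℕ) : GSet.{u} n ⥤ GSet.{u} n where
  obj X := obj X
  map f := ⟨fun _ P => map f P, fun _ P => map_src f P, fun _ P => map_tgt f P⟩
  map_id X := by
    apply GSet.hom_ext
    intro k P
    apply Lab.ext
    funext m
    exact List.map_id _
  map_comp f g := by
    apply GSet.hom_ext
    intro k P
    apply Lab.ext
    funext m
    simp [map]

/-! Multiplication: replace every dot by the diagram which labels it. -/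

/-- The number of dots of dimension `m` in the diagrams preceding position `q`. -/
def off {m : ℕ} (st : List (Lab X m)) (q : ℕ) : ℕ :=
  ((st.map fun E => (E.lvl m).length).take q).sum

/-- Replacing every dot of a level by the diagram which labels it; the dots at position `r` of the
diagram labelling the dot at position `q` of the level below are moved to position `o q + r`. -/
def expand (o : ℕ → ℕ) {m : ℕ} (L : List (ℕ × Lab X m)) : List (ℕ × X.cell m) :=
  L.flatMap fun p => (p.2.lvl m).map fun r => (o p.1 + r.1, r.2)

theorem expand_snd (o : ℕ → ℕ) {m : ℕ} (L : List (ℕ × Lab X m)) :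
    (expand o L).map Prod.snd = (L.map Prod.snd).flatMap fun E => E.top m := by
  simp only [expand, List.map_flatMap, List.flatMap_map, List.map_map]
  rfl

theorem tgt_top (P : Lab X (k + 1)) : P.tgt.top k = P.out k := by
  rw [top, tgt_lvl_self, relabel_snd _ _ (P.out_length k)]

theorem tgt_fst (P : Lab X (k + 1)) (m : ℕ) (h : m ≤ k) :
    (P.tgt.lvl m).map Prod.fst = (P.lvl m).map Prod.fst := by
  rcases h.lt_or_eq with h | rfl
  · rw [tgt_lvl _ h]
  · rw [tgt_lvl_self, relabel_fst _ _ (P.out_length m)]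

theorem src_top (P : Lab X (k + 1)) : P.src.top k = P.top k := by
  rw [top, src_lvl _ le_rfl]; rfl

theorem lvl_pos {P : Lab X k} {m : ℕ} {p : ℕ × X.cell m} (h : p ∈ P.lvl m) : m ≤ k := by
  by_contra hc
  rw [P.lvl_top m (by omega)] at h
  cases h

theorem moves_expand (o : ℕ → ℕ) {m : ℕ} (L : List (ℕ × Lab X (m + 1))) :
    moves X (expand o L) =
      L.flatMap fun p => (moves X (p.2.lvl (m + 1))).map (shiftMove (o p.1)) := by
  simp only [expand, moves, List.map_flatMap, List.map_map]
  rfl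

theorem off_eq {m : ℕ} (st : List (Lab X m)) (q : ℕ) :
    off st q = ((st.take q).flatMap fun E => E.top m).length := by
  simp [off, top, List.length_flatMap, List.map_take]

theorem fits_expand {m : ℕ} (o : ℕ → ℕ) (st : List (Lab X m)) (L : List (ℕ × Lab X (m + 1)))
    (ho : ∀ q, off st q = o q) (h : Fits st (moves (obj X) L)) :
    Fits (st.flatMap fun E => E.top m) (moves X (expand o L)) ∧
      run (st.flatMap fun E => E.top m) (moves X (expand o L)) =
        (run st (moves (obj X) L)).flatMap fun E => E.top m := by
  induction L generalizing st with
  | nil => exact ⟨trivial, rfl⟩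
  | cons p L ih =>
    obtain ⟨q, E⟩ := p
    have h1 : st[q]? = some E.src := h.1
    have h2 : Fits (st.set q E.tgt) (moves (obj X) L) := h.2
    obtain ⟨hq, hq'⟩ := List.getElem?_eq_some_iff.1 h1
    have hset : ∀ F : Lab X m, ((st.set q F).flatMap fun E => E.top m) =
        ((st.take q).flatMap fun E => E.top m) ++ F.top m ++
          (st.drop (q + 1)).flatMap fun E => E.top m := by
      intro F
      rw [List.set_eq_take_append_cons_drop, if_pos hq]
      simp
    have hst : (st.flatMap fun E => E.top m) =
        ((st.take q).flatMap fun E => E.top m) ++ E.top m ++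
          (st.drop (q + 1)).flatMap fun E => E.top m := by
      rw [← src_top, ← hset, ← hq', List.set_getElem_self]
    have hlen : (E.src.lvl m).length = (E.tgt.lvl m).length := by
      rw [src_lvl _ le_rfl, tgt_lvl_self, ← List.length_map (f := Prod.fst),
        ← List.length_map (f := Prod.fst) (as := relabel _ _), relabel_fst _ _ (E.out_length m)]
    have ho' : ∀ q', off (st.set q E.tgt) q' = o q' := by
      intro q'
      rw [← ho q', off, set_map_inv (fun E : Lab X m => (E.lvl m).length) h1 hlen, off]
    have hr := run_shift ((st.take q).flatMap fun E => E.top m) (E.top m)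
      ((st.drop (q + 1)).flatMap fun E => E.top m) (moves X (E.lvl (m + 1))) (E.fits m)
    rw [← hst, ← off_eq, ho q] at hr
    have e1 : moves X (expand o ((q, E) :: L)) =
        (moves X (E.lvl (m + 1))).map (shiftMove (o q)) ++ moves X (expand o L) := by
      simp [moves_expand]
    have e2 : run st (moves (obj X) ((q, E) :: L)) = run (st.set q E.tgt) (moves (obj X) L) := rfl
    have e3 : run (E.top m) (moves X (E.lvl (m + 1))) = E.tgt.top m := (tgt_top E).symm
    rw [e3, ← hset] at hr
    have := ih _ ho' h2
    rw [e1, e2, fits_append, run_append, hr.2]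
    exact ⟨⟨hr.1, this.1⟩, this.2⟩

/-- The composite of a diagram labelled by diagrams. -/
def join (P : Lab (obj X) k) : Lab X k where
  lvl
    | 0 => expand (fun _ => 0) (P.lvl 0)
    | m + 1 => expand (off (P.top m)) (P.lvl (m + 1))
  le := P.le
  lvl_zero := by
    obtain ⟨E, hE⟩ := P.lvl_zero
    obtain ⟨x, hx⟩ := E.lvl_zero
    exact ⟨x, by simp only [hE]; simp [expand, hx]⟩
  lvl_top m h := by
    cases m <;> simp [P.lvl_top _ h, expand]
  fits m := by
    have := (fits_expand (off (P.top m)) (P.top m) (P.lvl (m + 1)) (fun _ => rfl) (P.fits m)).1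
    cases m <;> · simp only [expand_snd]; exact this

/-- The offsets used at level `m` of a composite. -/
def offs (P : Lab (obj X) k) : ℕ → ℕ → ℕ
  | 0 => fun _ => 0
  | m + 1 => off (P.top m)

theorem join_lvl (P : Lab (obj X) k) (m : ℕ) : P.join.lvl m = expand (P.offs m) (P.lvl m) := by
  cases m <;> rfl

theorem join_top (P : Lab (obj X) k) (m : ℕ) :
    P.join.top m = (P.top m).flatMap fun E => E.top m := by
  rw [top, join_lvl, expand_snd]; rfl

theorem join_out (P : Lab (obj X) k) (m : ℕ) :
    P.join.out m = (P.out m).flatMap fun E => E.top m := by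
  rw [out, join_top, join_lvl]
  exact (fits_expand (off (P.top m)) (P.top m) (P.lvl (m + 1)) (fun _ => rfl) (P.fits m)).2

theorem relabel_append {A : Type u} (L M : List (ℕ × A)) (ys zs : List A)
    (h : L.length = ys.length) : relabel (L ++ M) (ys ++ zs) = relabel L ys ++ relabel M zs := by
  simp only [relabel]
  exact List.zipWith_append h

theorem relabel_expand (o : ℕ → ℕ) {m : ℕ} (L : List (ℕ × Lab X m)) (ys : List (Lab X m))
    (h : ys.map (fun E => (E.lvl m).map Prod.fst) =
      (L.map Prod.snd).map fun E => (E.lvl m).map Prod.fst) :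
    relabel (expand o L) (ys.flatMap fun E => E.top m) = expand o (relabel L ys) := by
  induction L generalizing ys with
  | nil => simp [expand, relabel]
  | cons p L ih =>
    cases ys with
    | nil => simp at h
    | cons E ys =>
      simp only [List.map_cons, List.cons.injEq] at h
      have hl : (p.2.lvl m).length = (E.lvl m).length := by
        simpa using (congrArg List.length h.1).symm
      have := ih ys h.2
      have e : relabel ((p.2.lvl m).map fun r => (o p.1 + r.1, r.2)) (E.top m) =
          (E.lvl m).map fun r => (o p.1 + r.1, r.2) := by
        apply pair_ext
        · rw [relabel_fst _ _ (by simp [top, hl])]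
          have := congrArg (List.map fun i => o p.1 + i) h.1
          simpa [Function.comp_def] using this.symm
        · rw [relabel_snd _ _ (by simp [top, hl])]
          simp [top]
      have e1 : expand o (p :: L) =
        ((p.2.lvl m).map fun r => (o p.1 + r.1, r.2)) ++ expand o L := by simp [expand]
      have e2 : expand o (relabel (p :: L) (E :: ys)) =
        ((E.lvl m).map fun r => (o p.1 + r.1, r.2)) ++ expand o (relabel L ys) := by
          simp [expand, relabel]
      rw [e1, e2, List.flatMap_cons, relabel_append _ _ _ _ (by simp [top, hl]), e, this]

theorem offs_congr {l : ℕ} {P : Lab (obj X) k} {Q : Lab (obj X) l} (m : ℕ)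
    (h : ∀ i < m, P.lvl i = Q.lvl i) : P.offs m = Q.offs m := by
  cases m with
  | zero => rfl
  | succ m => simp only [offs, top, h m (Nat.lt_succ_self m)]

theorem join_src (P : Lab (obj X) (k + 1)) : join P.src = (join P).src := by
  apply ext_le
  intro m hm
  rw [join_lvl, src_lvl _ hm, src_lvl _ hm, join_lvl]
  rw [offs_congr m fun i hi => src_lvl _ (by omega)]

theorem join_tgt (P : Lab (obj X) (k + 1)) : join P.tgt = (join P).tgt := by
  symm
  apply ext_tgt
  · intro m hm
    rw [join_lvl, join_lvl, tgt_lvl _ hm, offs_congr m fun i hi => tgt_lvl _ (by omega)]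
  · rw [join_lvl, join_lvl, join_out, tgt_lvl_self, offs_congr k fun i hi => tgt_lvl _ hi]
    apply relabel_expand
    apply P.out_inv
    intro E
    have h1 : (obj X).src E = Lab.src E := rfl
    have h2 : (obj X).tgt E = Lab.tgt E := rfl
    rw [h1, h2, tgt_fst _ _ le_rfl, src_lvl _ le_rfl]

theorem join_map (f : X ⟶ Y) (P : Lab (obj X) k) :
    join (map ((functor n).map f) P) = map f (join P) := by
  have ho : ∀ m, (map ((functor n).map f) P).offs m = P.offs m := by
    intro m
    cases m with
    | zero => rfl
    | succ m =>
      funext q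
      simp only [offs, off, top, map, List.map_map]
      simp [Function.comp_def]
  apply Lab.ext
  funext m
  rw [join_lvl, ho]
  simp only [map, join_lvl, expand, List.flatMap_map, List.map_flatMap]
  congr 1
  funext p
  simp

/-! Unit. -/

/-- The iterated sources of a cell, as lists of labelled dots. -/
def down (X : GSet.{u} n) : ∀ k : ℕ, X.cell k → ∀ m : ℕ, List (ℕ × X.cell m)
  | 0, x => Function.update (fun _ => []) 0 [(0, x)]
  | k + 1, x => Function.update (down X k (X.src x)) (k + 1) [(0, x)]

theorem down_self (x : X.cell k) : down X k x k = [(0, x)] := by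
  cases k <;> simp [down]

theorem down_succ (x : X.cell (k + 1)) {m : ℕ} (h : m ≤ k) :
    down X (k + 1) x m = down X k (X.src x) m := by
  rw [down, Function.update_of_ne (by omega)]

theorem down_top (x : X.cell k) {m : ℕ} (h : k < m) : down X k x m = [] := by
  induction k with
  | zero => rw [down, Function.update_of_ne (by omega)]
  | succ k ih => rw [down, Function.update_of_ne (by omega), ih _ (by omega)]

theorem down_tgt (x : X.cell (k + 1)) {m : ℕ} (h : m < k) :
    down X k (X.tgt x) m = down X k (X.src x) m := by
  cases k with
  | zero => omega
  | succ k => rw [down_succ _ (by omega), down_succ _ (by omega), X.src_tgt]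

/-- The diagram with one dot in each dimension up to `k`, labelled by a `k`-cell. -/
def pure (x : X.cell k) : Lab X k where
  lvl := down X k x
  le := X.dim_le x
  lvl_zero := by
    induction k with
    | zero => exact ⟨x, by simp [down]⟩
    | succ k ih => rw [down_succ _ (Nat.zero_le k)]; exact ih _
  lvl_top m h := down_top x h
  fits m := by
    induction k with
    | zero => rw [down_top x (show 0 < m + 1 by omega)]; trivial
    | succ k ih =>
      rcases lt_trichotomy m k with h | rfl | h
      · rw [down_succ _ (by omega), down_succ _ (by omega)]; exact ih _
      · rw [down_succ _ le_rfl, down_self, down_self]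
        exact ⟨rfl, trivial⟩
      · rw [down_top x (show k + 1 < m + 1 by omega)]; trivial

theorem pure_src (x : X.cell (k + 1)) : pure (X.src x) = (pure x).src := by
  apply ext_le
  intro m hm
  rw [src_lvl _ hm]
  exact (down_succ x hm).symm

theorem pure_tgt (x : X.cell (k + 1)) : pure (X.tgt x) = (pure x).tgt := by
  symm
  apply ext_tgt
  · intro m hm
    exact (down_succ x hm.le).trans (down_tgt x hm).symm
  · simp only [out, top, pure]
    rw [down_succ _ le_rfl, down_self, down_self, down_self]
    rfl

theorem pure_map (f : X ⟶ Y) (x : X.cell k) : pure (f.app k x) = map f (pure x) := by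
  apply ext_le
  intro m hm
  simp only [map, pure]
  induction k with
  | zero =>
    obtain rfl : m = 0 := by omega
    simp [down_self]
  | succ k ih =>
    rcases hm.lt_or_eq with h | rfl
    · rw [down_succ _ (by omega), down_succ _ (by omega), ← f.map_src, ih _ (by omega)]
    · simp [down_self]

theorem join_pure (E : Lab X k) : join (pure (X := obj X) E) = E := by
  apply ext_le
  intro m hm
  rw [join_lvl]
  change expand ((pure (X := obj X) E).offs m) (down (obj X) k E m) = E.lvl m
  induction k with
  | zero =>
    obtain rfl : m = 0 := by omega
    simp [down_self, expand, offs]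
  | succ k ih =>
    have ho : (pure (X := obj X) E).offs m = (pure (X := obj X) ((obj X).src E)).offs m := by
      apply offs_congr
      intro i hi
      exact down_succ _ (by omega)
    rcases hm.lt_or_eq with h | rfl
    · have h2 := ih E.src (by omega)
      rw [src_lvl _ (by omega)] at h2
      rw [ho, down_succ _ (by omega)]
      exact h2
    · rw [down_self]
      simp [expand, offs, off]

/-- The unit, as a map of globular sets. -/
def pureHom (X : GSet.{u} n) : X ⟶ obj X :=
  ⟨fun _ x => pure x, fun _ x => pure_src x, fun _ x => pure_tgt x⟩

/-- The multiplication, as a map of globular sets. -/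
def joinHom (X : GSet.{u} n) : obj (obj X) ⟶ obj X :=
  ⟨fun _ x => join x, fun _ x => join_src x, fun _ x => join_tgt x⟩

theorem flatMap_congr_mem {A : Type u} {B : Type v} (L : List A) (f : A → List B)
    (g : A → List B) (h : ∀ p ∈ L, f p = g p) : L.flatMap f = L.flatMap g := by
  induction L with
  | nil => rfl
  | cons p L ih =>
    rw [List.flatMap_cons, List.flatMap_cons, h p List.mem_cons_self,
      ih fun q hq => h q (List.mem_cons_of_mem _ hq)]

theorem fits_mem (P : Lab X k) {B : Type v} (m : ℕ) (g : X.cell m → B)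
    (hg : ∀ x : X.cell (m + 1), g (X.src x) = g (X.tgt x)) (p : ℕ × X.cell (m + 1))
    (hp : p ∈ P.lvl (m + 1)) : ((P.top m).map g)[p.1]? = some (g (X.src p.2)) := by
  refine fits_get g _ _ (P.fits m) ?_ (p.1, X.src p.2, X.tgt p.2) (List.mem_map_of_mem hp)
  intro mv hm
  obtain ⟨p, -, rfl⟩ := List.mem_map.1 hm
  exact hg _

theorem join_map_pure (P : Lab X k) : join (map (pureHom X) P) = P := by
  apply ext_le
  intro m hm
  rw [join_lvl]
  cases m with
  | zero =>
    obtain ⟨x, hx⟩ := P.lvl_zero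
    simp [map, hx, expand, offs, pureHom, pure, down_self]
  | succ m =>
    have key : ∀ p ∈ P.lvl (m + 1), (map (pureHom X) P).offs (m + 1) p.1 = p.1 := by
      intro p hp
      have h1 := fits_mem P m (fun _ => ()) (fun _ => rfl) p hp
      have h2 : p.1 < (P.top m).length := by
        have := (List.getElem?_eq_some_iff.1 h1).1
        simpa using this
      have h3 : ((map (pureHom X) P).top m).map (fun E : Lab X m => (E.lvl m).length) =
          List.replicate (P.top m).length 1 := by
        rw [List.eq_replicate_iff]
        refine ⟨by simp [top, map], ?_⟩
        intro b hb
        simp only [top, map, List.map_map, List.mem_map] at hb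
        obtain ⟨q, -, rfl⟩ := hb
        simp [pureHom, pure, down_self]
      simp only [offs, off]
      rw [h3, List.take_replicate]
      simp
      omega
    have e : expand ((map (pureHom X) P).offs (m + 1)) ((map (pureHom X) P).lvl (m + 1)) =
        (P.lvl (m + 1)).flatMap fun p => [p] := by
      simp only [expand, map, List.flatMap_map]
      apply flatMap_congr_mem
      intro p hp
      change ((pure p.2).lvl (m + 1)).map
        (fun r => ((map (pureHom X) P).offs (m + 1) p.1 + r.1, r.2)) = [p]
      rw [key p hp]
      simp [pure, down_self]
    rw [e]
    simp

theorem join_join (P : Lab (obj (obj X)) k) : join (join P) = join (map (joinHom X) P) := by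
  apply ext_le
  intro m hm
  rw [join_lvl, join_lvl, join_lvl]
  have key : ∀ p ∈ P.lvl m, ∀ r ∈ p.2.lvl m,
      (join P).offs m (P.offs m p.1 + r.1) =
        (map (joinHom X) P).offs m p.1 + p.2.offs m r.1 := by
    cases m with
    | zero => intros; rfl
    | succ m =>
      intro p hp r hr
      have hlen : ∀ E : Lab X (m + 1), (E.src.lvl m).length = (E.tgt.lvl m).length := by
        intro E
        rw [← List.length_map (f := Prod.fst), ← List.length_map (f := Prod.fst)
          (as := E.tgt.lvl m), tgt_fst _ _ le_rfl, src_lvl _ le_rfl]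
      let g : Lab (obj X) m → List ℕ := fun G => (G.top m).map fun E : Lab X m => (E.lvl m).length
      have hg : ∀ G : Lab (obj X) (m + 1), g G.src = g G.tgt := by
        intro G
        simp only [g]
        rw [src_top, tgt_top]
        exact (G.out_inv m (fun E : Lab X m => (E.lvl m).length) hlen).symm
      have h1 := fits_mem P m g hg p hp
      have h2 := fits_mem p.2 m (fun _ => ()) (fun _ => rfl) r hr
      have h3 : r.1 < (p.2.top m).length := by
        have := (List.getElem?_eq_some_iff.1 h2).1
        simpa using this
      have h4 : g ((obj (obj X)).src p.2) =
          (p.2.top m).map fun E : Lab X m => (E.lvl m).length := by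
        simp only [g]
        rw [src_top]
      rw [h4] at h1
      have h5 := flatten_take_sum _ _ r.1 _ h1 (by simpa using h3.le)
      simp only [offs, off]
      rw [join_top]
      have e1 : (P.top m).map (fun E => (E.lvl m).length) =
          ((P.top m).map g).map List.length := by
        simp [g, Function.comp_def, top]
      have e2 : ((P.top m).flatMap fun E => E.top m).map (fun E : Lab X m => (E.lvl m).length) =
          ((P.top m).map g).flatten := by
        rw [← List.flatMap_def, List.map_flatMap]
      have e3 : ((map (joinHom X) P).top m).map (fun E : Lab X m => (E.lvl m).length) =
          ((P.top m).map g).map List.sum := by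
        simp only [top, map, List.map_map, g]
        apply List.map_congr_left
        intro q _
        simp [joinHom, join_lvl, expand, List.length_flatMap, Function.comp_def]
      rw [e1, e2, e3]
      exact h5
  have e1 : expand ((join P).offs m) (expand (P.offs m) (P.lvl m)) =
      (P.lvl m).flatMap fun p => (p.2.lvl m).flatMap fun r =>
        (r.2.lvl m).map fun s => ((join P).offs m (P.offs m p.1 + r.1) + s.1, s.2) := by
    simp [expand, List.flatMap_assoc, List.flatMap_map]
  have e2 : expand ((map (joinHom X) P).offs m) ((map (joinHom X) P).lvl m) =
      (P.lvl m).flatMap fun p => (p.2.lvl m).flatMap fun r =>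
        (r.2.lvl m).map fun s =>
          ((map (joinHom X) P).offs m p.1 + p.2.offs m r.1 + s.1, s.2) := by
    simp only [expand, map, List.flatMap_map]
    congr 1
    funext p
    simp [joinHom, join_lvl, expand, List.map_flatMap, Function.comp_def, Nat.add_assoc]
  rw [e1, e2]
  apply flatMap_congr_mem
  intro p hp
  apply flatMap_congr_mem
  intro r hr
  rw [key p hp r hr]

/-- The monad of labelled diagrams. -/
def monad (n : ℕ) : Monad (GSet.{u} n) where
  toFunctor := functor n
  η :=
    { app := pureHom
      naturality := fun _ _ f => GSet.hom_ext fun _ x => pure_map f x }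
  μ :=
    { app := joinHom
      naturality := fun _ _ f => GSet.hom_ext fun _ P => join_map f P }
  assoc _ := GSet.hom_ext fun _ P => (join_join P).symm
  left_unit _ := GSet.hom_ext fun _ P => join_pure P
  right_unit _ := GSet.hom_ext fun _ P => join_map_pure P

end Lab

/-! ### Simple string diagrams -/

/-- A simple `k`-string diagram: a sequence of maps `⟨ℓ_k⟩ → ⋯ → ⟨ℓ_1⟩ → ⟨ℓ_0⟩ = ⟨1⟩` of finite
ordinals, not necessarily order preserving.  The map `v^m` is given by the list of its values
(positions are counted from `0`), so that `ℓ_m` is the length of the list `v m`.  By convention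
`v 0 = [0]`, and `v m` is empty for `m > k`. -/
@[ext]
structure Diagram (k : ℕ) where
  v : ℕ → List ℕ
  v_zero : v 0 = [0]
  v_lt : ∀ m, ∀ q ∈ v (m + 1), q < (v m).length
  v_top : ∀ m, k < m → v m = []

namespace Diagram

variable {k : ℕ}

/-- The number `ℓ_m` of dots of dimension `m`. -/
abbrev len (D : Diagram k) (m : ℕ) : ℕ := (D.v m).length

/-- The map `v^(m+1) : ⟨ℓ_(m+1)⟩ → ⟨ℓ_m⟩`. -/
def par (D : Diagram k) {m : ℕ} (i : Fin (D.len (m + 1))) : Fin (D.len m) :=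
  ⟨(D.v (m + 1)).get i, D.v_lt m _ (List.get_mem _ _)⟩

/-- The set of all `j < i` with `v^(m+1) j = v^(m+1) i`. -/
def earlier (D : Diagram k) {m : ℕ} (i : Fin (D.len (m + 1))) : Finset (Fin (D.len (m + 1))) :=
  Finset.univ.filter fun j => j < i ∧ D.par j = D.par i

theorem mem_earlier (D : Diagram k) {m : ℕ} (i j : Fin (D.len (m + 1))) :
    j ∈ D.earlier i ↔ j < i ∧ D.par j = D.par i := by
  simp [earlier]

/-- The `m`-cell to which the source of the `(m+1)`-cell `x^(m+1)_i` is attached: the cell `x^m_q`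
with `q = v^(m+1) i` if `i` is the least element of its fibre under `v^(m+1)`, and otherwise the
target of `x^(m+1)_p` where `p` is the largest `j < i` with `v^(m+1) j = v^(m+1) i`.
(For the names of the cells see `hat`.) -/
def attach (D : Diagram k) {m : ℕ} (i : Fin (D.len (m + 1))) :
    Fin (D.len m) ⊕ Fin (D.len (m + 1)) :=
  if h : (D.earlier i).Nonempty then .inr ((D.earlier i).max' h) else .inl (D.par i)

theorem par_max' (D : Diagram k) {m : ℕ} (i : Fin (D.len (m + 1))) (h : (D.earlier i).Nonempty) :
    D.par ((D.earlier i).max' h) = D.par i :=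
  ((D.mem_earlier i _).1 (Finset.max'_mem _ h)).2

/-- The source map of `hat`. -/
def hatSrc (D : Diagram k) {m : ℕ} :
    Fin (D.len (m + 1)) ⊕ Fin (D.len (m + 2)) → Fin (D.len m) ⊕ Fin (D.len (m + 1))
  | .inl i => D.attach i
  | .inr j => D.attach (D.par j)

/-- The target map of `hat`. -/
def hatTgt (D : Diagram k) {m : ℕ} :
    Fin (D.len (m + 1)) ⊕ Fin (D.len (m + 2)) → Fin (D.len m) ⊕ Fin (D.len (m + 1))
  | .inl i => .inr i
  | .inr j => .inr (D.par j)

theorem hatSrc_attach (D : Diagram k) {m : ℕ} (i : Fin (D.len (m + 2))) :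
    D.hatSrc (D.attach i) = D.attach (D.par i) := by
  rw [attach]
  split_ifs with h
  · simp only [hatSrc, par_max']
  · rfl

theorem hatTgt_attach (D : Diagram k) {m : ℕ} (i : Fin (D.len (m + 2))) :
    D.hatTgt (D.attach i) = .inr (D.par i) := by
  rw [attach]
  split_ifs with h
  · simp only [hatTgt, par_max']
  · rfl

/-- The `k`-globular set `D^` obtained by successively attaching, for each `m` and each
`i ∈ ⟨ℓ_m⟩`, a new `m`-cell `x^m_i` along its source.  Attaching an `m`-cell along its source adds
two cells: the cell `x^m_i` itself and its target.  Hence the `m`-cells of `D^` are the cells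
`x^m_i` for `i ∈ ⟨ℓ_m⟩` (written `inl i`) and the targets `t(x^(m+1)_j)` for `j ∈ ⟨ℓ_(m+1)⟩`
(written `inr j`).  Since `s(x^(m+1)_j)` is parallel to `t(x^(m+1)_j)` and to `x^m_q` for
`q = v^(m+1) j`, the boundary of the cell `inr j` is that of `inl q`. -/
abbrev hat (D : Diagram k) : GSet.{0} k where
  cell m := Fin (D.len m) ⊕ Fin (D.len (m + 1))
  src := D.hatSrc
  tgt := D.hatTgt
  src_tgt x := by
    rcases x with i | j
    · exact (D.hatSrc_attach i).symm
    · exact (D.hatSrc_attach (D.par j)).symm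
  tgt_src x := by
    rcases x with i | j
    · exact D.hatTgt_attach i
    · exact D.hatTgt_attach (D.par j)
  dim_le {m} x := by
    by_contra hc
    have h1 : D.len m = 0 := by rw [len, D.v_top m (by omega)]; rfl
    have h2 : D.len (m + 1) = 0 := by rw [len, D.v_top (m + 1) (by omega)]; rfl
    rcases x with i | j
    · exact absurd i.2 (by omega)
    · exact absurd j.2 (by omega)

variable {n : ℕ} {X : GSet.{u} n}

/-- The label which the source of the label of `x^(m+1)_i` has to match. -/
def attachLab (D : Diagram k) (x : ∀ m : ℕ, Fin (D.len m) → X.cell m) {m : ℕ}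
    (i : Fin (D.len (m + 1))) : X.cell m :=
  if h : (D.earlier i).Nonempty then X.tgt (x (m + 1) ((D.earlier i).max' h)) else x m (D.par i)

/-- The image of a cell of `D^`, given the images of the attached cells. -/
def descApp (D : Diagram k) (x : ∀ m : ℕ, Fin (D.len m) → X.cell m) (m : ℕ) :
    Fin (D.len m) ⊕ Fin (D.len (m + 1)) → X.cell m
  | .inl i => x m i
  | .inr j => X.tgt (x (m + 1) j)

theorem descApp_attach (D : Diagram k) (x : ∀ m : ℕ, Fin (D.len m) → X.cell m) {m : ℕ}
    (i : Fin (D.len (m + 1))) : D.descApp x m (D.attach i) = D.attachLab x i := by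
  rw [attach, attachLab]
  split_ifs <;> rfl

theorem parallel (D : Diagram k) (x : ∀ m : ℕ, Fin (D.len m) → X.cell m)
    (h : ∀ (m : ℕ) (i : Fin (D.len (m + 1))), X.src (x (m + 1) i) = D.attachLab x i)
    (m : ℕ) (j : Fin (D.len (m + 2))) :
    X.src (X.src (x (m + 2) j)) = X.src (x (m + 1) (D.par j)) ∧
      X.tgt (X.src (x (m + 2) j)) = X.tgt (x (m + 1) (D.par j)) := by
  induction hj : j.val using Nat.strong_induction_on generalizing j with
  | _ a ih =>
    subst hj
    rw [h (m + 1), attachLab]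
    split_ifs with hn
    · have hp := (D.mem_earlier j _).1 (Finset.max'_mem _ hn)
      have := ih _ hp.1 _ rfl
      rw [hp.2] at this
      rw [X.src_tgt, ← X.tgt_src]
      exact this
    · exact ⟨rfl, rfl⟩

/-- A map out of `D^` is determined by the images of the attached cells `x^m_i`, subject to the
compatibility of their sources. -/
def desc (D : Diagram k) (x : ∀ m : ℕ, Fin (D.len m) → X.cell m)
    (h : ∀ (m : ℕ) (i : Fin (D.len (m + 1))), X.src (x (m + 1) i) = D.attachLab x i) :
    GSet.Hom D.hat X where
  app := D.descApp x
  map_src m c := by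
    rcases c with i | j
    · exact (D.descApp_attach x i).trans (h m i).symm
    · refine (D.descApp_attach x (D.par j)).trans ?_
      rw [← h, ← (D.parallel x h m j).1, ← X.src_tgt]
      rfl
  map_tgt m c := by
    rcases c with i | j
    · rfl
    · change X.tgt (x (m + 1) (D.par j)) = X.tgt (X.tgt (x (m + 2) j))
      rw [← (D.parallel x h m j).2, X.tgt_src]

theorem hom_ext {D : Diagram k} {f g : GSet.Hom D.hat X}
    (h : ∀ (m : ℕ) (i : Fin (D.len m)), f.app m (.inl i) = g.app m (.inl i)) : f = g := by
  apply GSet.Hom.ext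
  funext m c
  rcases c with i | j
  · exact h m i
  · have hf := f.map_tgt m (.inl j)
    have hg := g.map_tgt m (.inl j)
    rw [h] at hf
    exact hf.trans hg.symm

theorem map_attach {D : Diagram k} (f : GSet.Hom D.hat X) (m : ℕ) (i : Fin (D.len (m + 1))) :
    f.app m (D.attach i) = D.attachLab (fun m i => f.app m (.inl i)) i := by
  rw [attach, attachLab]
  split_ifs with h
  · exact f.map_tgt m (.inl _)
  · rfl

theorem attach_eq_inl {D : Diagram k} {m : ℕ} {i : Fin (D.len (m + 1))}
    (h : ∀ j < i, D.par j ≠ D.par i) : D.attach i = .inl (D.par i) := by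
  rw [attach, dif_neg]
  rintro ⟨j, hj⟩
  rw [mem_earlier] at hj
  exact h j hj.1 hj.2

theorem attach_eq_inr {D : Diagram k} {m : ℕ} {i p : Fin (D.len (m + 1))} (hp : p < i)
    (hp' : D.par p = D.par i) (h : ∀ j < i, p < j → D.par j ≠ D.par i) :
    D.attach i = .inr p := by
  have hm : p ∈ D.earlier i := (D.mem_earlier _ _).2 ⟨hp, hp'⟩
  rw [attach, dif_pos ⟨p, hm⟩]
  congr 1
  apply le_antisymm
  · apply Finset.max'_le
    intro j hj
    rw [mem_earlier] at hj
    by_contra hc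
    exact h j hj.1 (not_le.1 hc) hj.2
  · exact Finset.le_max' _ _ hm

/-- The source and target of a `(k+1)`-diagram: truncation. -/
def trunc (D : Diagram (k + 1)) : Diagram k where
  v m := if m ≤ k then D.v m else []
  v_zero := by rw [if_pos (Nat.zero_le k), D.v_zero]
  v_lt m q hq := by
    by_cases h : m + 1 ≤ k
    · rw [if_pos h] at hq
      rw [if_pos ((Nat.le_succ m).trans h)]
      exact D.v_lt m q hq
    · rw [if_neg h] at hq
      cases hq
  v_top m h := if_neg (by omega)

theorem trunc_v (D : Diagram (k + 1)) {m : ℕ} (h : m ≤ k) : D.trunc.v m = D.v m := if_pos h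

theorem trunc_len (D : Diagram (k + 1)) {m : ℕ} (h : m ≤ k) : D.trunc.len m = D.len m := by
  rw [len, D.trunc_v h, len]

theorem trunc_le (D : Diagram (k + 1)) {m : ℕ} (i : Fin (D.trunc.len m)) : m ≤ k := by
  by_contra h
  have : D.trunc.len m = 0 := by rw [len, D.trunc.v_top m (by omega)]; rfl
  exact absurd i.2 (by omega)

/-- The dots of the truncation are dots of the diagram. -/
def emb (D : Diagram (k + 1)) {m : ℕ} (i : Fin (D.trunc.len m)) : Fin (D.len m) :=
  ⟨i, by rw [← D.trunc_len (D.trunc_le i)]; exact i.2⟩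

theorem emb_par (D : Diagram (k + 1)) {m : ℕ} (i : Fin (D.trunc.len (m + 1))) :
    D.emb (D.trunc.par i) = D.par (D.emb i) := by
  apply Fin.ext
  change (D.trunc.v (m + 1))[i.1]'i.2 = (D.v (m + 1))[i.1]'(D.emb i).2
  congr 1
  exact D.trunc_v (D.trunc_le i)

theorem emb_lt (D : Diagram (k + 1)) {m : ℕ} (i j : Fin (D.trunc.len m)) :
    D.emb i < D.emb j ↔ i < j := Iff.rfl

theorem emb_injective (D : Diagram (k + 1)) {m : ℕ} {i j : Fin (D.trunc.len m)}
    (h : D.emb i = D.emb j) : i = j := Fin.ext (congrArg Fin.val h :)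

theorem attach_emb (D : Diagram (k + 1)) {m : ℕ} (i : Fin (D.trunc.len (m + 1))) :
    D.attach (D.emb i) = Sum.map D.emb D.emb (D.trunc.attach i) := by
  have hlt : ∀ j : Fin (D.len (m + 1)), ∃ j', D.emb j' = j := fun j =>
    ⟨⟨j, by rw [D.trunc_len (D.trunc_le i)]; exact j.2⟩, rfl⟩
  by_cases h : (D.trunc.earlier i).Nonempty
  · have hp := (D.trunc.mem_earlier _ _).1 (Finset.max'_mem _ h)
    conv_rhs => rw [attach, dif_pos h]
    refine attach_eq_inr (p := D.emb _) hp.1 ?_ ?_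
    · rw [← emb_par, ← emb_par, hp.2]
    · intro j hj hj'
      obtain ⟨j, rfl⟩ := hlt j
      rw [← emb_par, ← emb_par]
      intro hc
      have := Finset.le_max' (D.trunc.earlier i) j
        ((D.trunc.mem_earlier _ _).2 ⟨hj, D.emb_injective hc⟩)
      exact absurd hj' (not_lt.2 this)
  · conv_rhs => rw [attach, dif_neg h]
    refine (attach_eq_inl ?_).trans ?_
    · intro j hj
      obtain ⟨j, rfl⟩ := hlt j
      rw [← emb_par, ← emb_par]
      intro hc
      exact h ⟨j, (D.trunc.mem_earlier _ _).2 ⟨hj, D.emb_injective hc⟩⟩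
    · rw [← emb_par]; rfl

/-- The set of all `j` with `v^(m+1) j = i`. -/
def fibre (D : Diagram k) {m : ℕ} (i : Fin (D.len m)) : Finset (Fin (D.len (m + 1))) :=
  Finset.univ.filter fun j => D.par j = i

theorem mem_fibre (D : Diagram k) {m : ℕ} (i : Fin (D.len m)) (j : Fin (D.len (m + 1))) :
    j ∈ D.fibre i ↔ D.par j = i := by
  simp [fibre]

/-- The inclusion of `D^` for the source: `x^m_i` is sent to `x^m_i`. -/
def srcIncl (D : Diagram (k + 1)) : GSet.Hom D.trunc.hat D.hat :=
  D.trunc.desc (fun _ i => .inl (D.emb i)) <| by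
    intro m i
    refine (D.attach_emb i).trans ?_
    rw [attach, attachLab]
    split_ifs <;> rfl

/-- The images of the attached cells under the target inclusion. -/
def tgtInclAux (D : Diagram (k + 1)) (m : ℕ) (i : Fin (D.trunc.len m)) :
    Fin (D.len m) ⊕ Fin (D.len (m + 1)) :=
  if h : m = k ∧ (D.fibre (D.emb i)).Nonempty then .inr ((D.fibre (D.emb i)).max' h.2)
  else .inl (D.emb i)

/-- The inclusion of `D^` for the target: `x^k_i` is sent to `t(x^(k+1)_p)`, where `p` is the
largest element with `v^(k+1) p = i`, if there is one; all other `x^m_i` are sent to `x^m_i`. -/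
def tgtIncl (D : Diagram (k + 1)) : GSet.Hom D.trunc.hat D.hat :=
  D.trunc.desc D.tgtInclAux <| by
    intro m i
    have hm := D.trunc_le i
    have h1 : D.hat.src (D.tgtInclAux (m + 1) i) = D.attach (D.emb i) := by
      rw [tgtInclAux]
      split_ifs with h
      · have hp := (D.mem_fibre _ _).1 (Finset.max'_mem _ h.2)
        change D.attach (D.par _) = _
        rw [hp]
      · rfl
    have h2 : ∀ j : Fin (D.trunc.len (m + 1)),
        D.hat.tgt (D.tgtInclAux (m + 1) j) = .inr (D.emb j) := by
      intro j
      rw [tgtInclAux]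
      split_ifs with h
      · have hp := (D.mem_fibre _ _).1 (Finset.max'_mem _ h.2)
        change Sum.inr (D.par _) = _
        rw [hp]
      · rfl
    have h3 : ∀ j : Fin (D.trunc.len m), D.tgtInclAux m j = .inl (D.emb j) := by
      intro j
      rw [tgtInclAux, dif_neg (by omega)]
    rw [h1, attach_emb, attachLab, attach]
    split_ifs
    · rw [h2]; rfl
    · rw [h3]; rfl

end Diagram

/-! ### Labelled simple string diagrams -/

/-- A `k`-cell of `T X`: a simple `k`-string diagram `D`, where `k ≤ n`, together with an
`X`-labelling of `D`, i.e. a map of globular sets `D^ → X`. -/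
structure Labelled {n : ℕ} (X : GSet.{u} n) (k : ℕ) where
  le : k ≤ n
  diag : Diagram k
  lab : GSet.Hom diag.hat X

namespace Labelled

variable {n : ℕ} {X : GSet.{u} n} {k : ℕ}

/-- The source: restriction of the labelling to the source. -/
abbrev src (z : Labelled X (k + 1)) : Labelled X k where
  le := (Nat.le_succ k).trans z.le
  diag := z.diag.trunc
  lab := z.diag.srcIncl.comp z.lab

/-- The target: restriction of the labelling to the target. -/
abbrev tgt (z : Labelled X (k + 1)) : Labelled X k where
  le := (Nat.le_succ k).trans z.le
  diag := z.diag.trunc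
  lab := z.diag.tgtIncl.comp z.lab

/-- Renaming the labels. -/
def map {Y : GSet.{v} n} (f : GSet.Hom X Y) (z : Labelled X k) : Labelled Y k where
  le := z.le
  diag := z.diag
  lab := z.lab.comp f

/-- The label of the dot `x^m_i`. -/
def label (z : Labelled X k) {m : ℕ} (i : Fin (z.diag.len m)) : X.cell m := z.lab.app m (.inl i)

/-- The list of the labelled dots of level `m`. -/
def lvl (z : Labelled X k) (m : ℕ) : List (ℕ × X.cell m) :=
  List.ofFn fun i : Fin (z.diag.len m) => ((z.diag.v m).get i, z.label i)

theorem lvl_fst (z : Labelled X k) (m : ℕ) : (z.lvl m).map Prod.fst = z.diag.v m := by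
  apply List.ext_getElem
  · simp [lvl, Diagram.len]
  · intro i h1 h2
    simp only [lvl, List.getElem_map, List.getElem_ofFn]
    rfl

theorem lvl_inj {y z : Labelled X k} (h : ∀ m, y.lvl m = z.lvl m) : y = z := by
  obtain ⟨hy, D, f⟩ := y
  obtain ⟨hz, E, g⟩ := z
  have hDE : D = E := by
    apply Diagram.ext
    funext m
    have := congrArg (List.map Prod.fst) (h m)
    rwa [lvl_fst, lvl_fst] at this
  subst hDE
  congr 1
  apply Diagram.hom_ext
  intro m i
  have := List.ofFn_injective (h m)
  exact congrArg Prod.snd (congrFun this i)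

end Labelled

section moves

variable {A : Type u}

theorem fst_get {L M : List (ℕ × A)} (h : L.map Prod.fst = M.map Prod.fst) (i : ℕ)
    (h1 : i < L.length) (h2 : i < M.length) : L[i].1 = M[i].1 := by
  have := congrArg (fun K => K[i]?) h
  simp only [List.getElem?_map] at this
  rw [List.getElem?_eq_getElem h1, List.getElem?_eq_getElem h2] at this
  simpa using this

theorem fits_iff (st : List A) (L : List (ℕ × A × A)) : Fits st L ↔
    ∀ (i : ℕ) (h : i < L.length), (run st (L.take i))[L[i].1]? = some L[i].2.1 := by
  induction L generalizing st with
  | nil => simp [Fits]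
  | cons mv L ih =>
    rw [Fits, ih]
    constructor
    · rintro ⟨h1, h2⟩ i hi
      cases i with
      | zero => exact h1
      | succ i => exact h2 i (by simpa using hi)
    · intro h
      exact ⟨h 0 (by simp), fun i hi => h (i + 1) (by simpa using hi)⟩

theorem run_get_none (st : List A) (L : List (ℕ × A × A)) (q : ℕ) (h : ∀ mv ∈ L, mv.1 ≠ q) :
    (run st L)[q]? = st[q]? := by
  induction L generalizing st with
  | nil => rfl
  | cons mv L ih =>
    rw [run, ih _ fun m hm => h m (List.mem_cons_of_mem _ hm),
      List.getElem?_set_ne (h mv List.mem_cons_self)]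

theorem run_get_some (st : List A) (L : List (ℕ × A × A)) (q : ℕ) (hq : q < st.length) (p i : ℕ)
    (hpi : p < i) (hi : i ≤ L.length) (hp : L[p].1 = q)
    (h : ∀ (j : ℕ) (hj : j < i), p < j → L[j].1 ≠ q) :
    (run st (L.take i))[q]? = some L[p].2.2 := by
  have e : L.take i = L.take p ++ L[p] :: (L.take i).drop (p + 1) := by
    have h1 := List.take_append_drop (p + 1) (L.take i)
    rw [List.take_take, min_eq_left (by omega), ← List.take_concat_get' L p (by omega)] at h1
    rw [List.append_assoc] at h1
    exact h1.symm
  rw [e, run_append, run, run_get_none, hp, List.getElem?_set_self]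
  · rw [run_length]; exact hq
  · intro mv hm
    obtain ⟨j, hj, rfl⟩ := List.getElem_of_mem hm
    simp only [List.length_drop, List.length_take] at hj
    simp only [List.getElem_drop, List.getElem_take]
    exact h _ (by omega) (by omega)

end moves

namespace Labelled

variable {n : ℕ} {X : GSet.{u} n} {k : ℕ}

theorem lvl_length (z : Labelled X k) (m : ℕ) : (z.lvl m).length = z.diag.len m := by
  simp [lvl]

theorem lvl_get (z : Labelled X k) (m i : ℕ) (h : i < (z.lvl m).length) :
    (z.lvl m)[i] = ((z.diag.v m).get ⟨i, by simpa [lvl, Diagram.len] using h⟩,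
      z.label ⟨i, by simpa [lvl] using h⟩) := by
  simp only [lvl, List.getElem_ofFn]

/-- The state of the labels of level `m` after passing the first `i` dots of level `m + 1`. -/
theorem state_none (z : Labelled X k) (m i : ℕ) (q : Fin (z.diag.len m))
    (h : ∀ j : Fin (z.diag.len (m + 1)), j < i → z.diag.par j ≠ q) :
    (run ((z.lvl m).map Prod.snd) ((moves X (z.lvl (m + 1))).take i))[q.1]? =
      some (z.label q) := by
  rw [run_get_none]
  · rw [List.getElem?_map, List.getElem?_eq_getElem (by rw [lvl_length]; exact q.2), lvl_get]
    rfl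
  · intro mv hm
    obtain ⟨j, hj, rfl⟩ := List.getElem_of_mem hm
    have hj' : j < i ∧ j < z.diag.len (m + 1) := by
      simpa [moves, lvl_length] using hj
    have := h ⟨j, hj'.2⟩ hj'.1
    intro hc
    apply this
    apply Fin.ext
    simp only [List.getElem_take, moves, List.getElem_map, lvl_get] at hc
    exact hc

theorem state_some (z : Labelled X k) (m i : ℕ) (hi : i ≤ z.diag.len (m + 1))
    (p : Fin (z.diag.len (m + 1))) (hp : p < i)
    (h : ∀ j : Fin (z.diag.len (m + 1)), j < i → p < j → z.diag.par j ≠ z.diag.par p) :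
    (run ((z.lvl m).map Prod.snd) ((moves X (z.lvl (m + 1))).take i))[(z.diag.par p).1]? =
      some (X.tgt (z.label p)) := by
  have hl : (moves X (z.lvl (m + 1))).length = z.diag.len (m + 1) := by simp [moves, lvl_length]
  rw [run_get_some _ _ _ ?_ p.1 i hp (by omega)]
  · simp only [moves, List.getElem_map, lvl_get]
  · simp only [moves, List.getElem_map, lvl_get]
    rfl
  · intro j hj hpj hc
    refine h ⟨j, by omega⟩ hj hpj ?_
    apply Fin.ext
    simp only [moves, List.getElem_map, lvl_get] at hc
    exact hc
  · rw [List.length_map, lvl_length]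
    exact (z.diag.par p).2

theorem src_label (z : Labelled X k) (m : ℕ) (i : Fin (z.diag.len (m + 1))) :
    X.src (z.label i) = z.diag.attachLab (fun _ => z.label) i := by
  have := z.lab.map_src m (.inl i)
  exact this.symm.trans (Diagram.map_attach z.lab m i)

theorem lvl_fits (z : Labelled X k) (m : ℕ) :
    Fits ((z.lvl m).map Prod.snd) (moves X (z.lvl (m + 1))) := by
  rw [fits_iff]
  intro i hi
  have hi' : i < z.diag.len (m + 1) := by simpa [moves, lvl_length] using hi
  have e : (moves X (z.lvl (m + 1)))[i] = ((z.diag.par ⟨i, hi'⟩).1,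
      X.src (z.label ⟨i, hi'⟩), X.tgt (z.label ⟨i, hi'⟩)) := by
    simp only [moves, List.getElem_map, lvl_get]
    rfl
  rw [e]
  simp only
  rw [z.src_label, Diagram.attachLab]
  split_ifs with h
  · have hp := (z.diag.mem_earlier _ _).1 (Finset.max'_mem _ h)
    rw [← hp.2]
    apply state_some _ _ _ hi'.le _ hp.1
    intro j hj hpj hc
    have := Finset.le_max' _ j ((z.diag.mem_earlier _ _).2 ⟨hj, hc.trans hp.2⟩)
    exact absurd hpj (not_lt.2 this)
  · apply state_none
    intro j hj hc
    exact h ⟨j, (z.diag.mem_earlier _ _).2 ⟨hj, hc⟩⟩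

/-- The lists of labelled dots of a labelled diagram. -/
def toLab (z : Labelled X k) : Lab X k where
  lvl := z.lvl
  le := z.le
  lvl_zero := by
    have h1 : (z.lvl 0).map Prod.fst = [0] := (z.lvl_fst 0).trans z.diag.v_zero
    obtain ⟨⟨q, x⟩, ha⟩ := List.length_eq_one_iff.1
      (show (z.lvl 0).length = 1 by simpa using congrArg List.length h1)
    rw [ha] at h1 ⊢
    obtain rfl : q = 0 := by simpa using h1
    exact ⟨x, rfl⟩
  lvl_top m h := by
    apply List.eq_nil_of_length_eq_zero
    rw [lvl_length, Diagram.len, z.diag.v_top m h]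
    rfl
  fits := z.lvl_fits

theorem toLab_inj {y z : Labelled X k} (h : y.toLab = z.toLab) : y = z :=
  lvl_inj fun m => congrFun (congrArg Lab.lvl h) m

theorem emb_lvl (z : Labelled X (k + 1)) (w : Labelled X k) (hw : w.diag = z.diag.trunc)
    (m : ℕ) (hm : m ≤ k) : (w.lvl m).map Prod.fst = (z.lvl m).map Prod.fst := by
  rw [lvl_fst, lvl_fst, hw, Diagram.trunc_v _ hm]

theorem toLab_src (z : Labelled X (k + 1)) : z.src.toLab = z.toLab.src := by
  apply Lab.ext_le
  intro m hm
  rw [Lab.src_lvl _ hm]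
  apply List.ext_getElem
  · simp only [toLab, lvl_length]
    exact z.diag.trunc_len hm
  · intro i h1 h2
    apply Prod.ext
    · exact fst_get (emb_lvl z z.src rfl m hm) i h1 h2
    · simp only [toLab, lvl_get]
      rfl

theorem toLab_tgt (z : Labelled X (k + 1)) : z.tgt.toLab = z.toLab.tgt := by
  symm
  have hlab : ∀ (m : ℕ) (i : Fin (z.diag.trunc.len m)),
      z.tgt.label i = z.lab.app m (z.diag.tgtInclAux m i) := fun _ _ => rfl
  apply Lab.ext_tgt
  · intro m hm
    symm
    apply List.ext_getElem
    · simp only [toLab, lvl_length]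
      exact z.diag.trunc_len hm.le
    · intro i h1 h2
      apply Prod.ext
      · exact fst_get (emb_lvl z z.tgt rfl m hm.le) i h1 h2
      · simp only [toLab, lvl_get]
        refine (hlab m _).trans ?_
        rw [Diagram.tgtInclAux, dif_neg (by omega)]
        rfl
  · apply pair_ext
    · rw [relabel_fst _ _ (Lab.out_length _ _)]
      exact (emb_lvl z z.tgt rfl k le_rfl).symm
    · rw [relabel_snd _ _ (Lab.out_length _ _)]
      apply List.ext_getElem?
      intro i
      have hlen : (z.toLab.out k).length = z.diag.trunc.len k := by
        rw [← Lab.out_length, z.diag.trunc_len le_rfl]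
        exact z.lvl_length k
      by_cases hi : i < z.diag.trunc.len k
      · have h2 : ((z.tgt.toLab.lvl k).map Prod.snd)[i]? = some (z.tgt.label ⟨i, hi⟩) := by
          have hi' : i < (z.tgt.lvl k).length := by rw [lvl_length]; exact hi
          rw [List.getElem?_map]
          change Option.map Prod.snd (z.tgt.lvl k)[i]? = _
          rw [List.getElem?_eq_getElem hi', lvl_get]
          rfl
        rw [h2]
        refine Eq.trans ?_ (congrArg some (hlab k ⟨i, hi⟩)).symm
        rw [Diagram.tgtInclAux]
        have hout : z.toLab.out k = run ((z.lvl k).map Prod.snd)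
            ((moves X (z.lvl (k + 1))).take (z.diag.len (k + 1))) := by
          rw [List.take_of_length_le]
          · rfl
          · simp [moves, lvl_length]
        rw [hout]
        split_ifs with h
        · have hp := (z.diag.mem_fibre _ _).1 (Finset.max'_mem _ h.2)
          have hs := z.state_some k _ le_rfl ((z.diag.fibre (z.diag.emb ⟨i, hi⟩)).max' h.2)
            (Fin.is_lt _) (by
              intro j _ hpj hc
              have := Finset.le_max' _ j ((z.diag.mem_fibre _ _).2 (hc.trans hp))
              exact absurd hpj (not_lt.2 this))
          rw [hp] at hs
          exact hs.trans (congrArg some (z.lab.map_tgt k (.inl _)).symm)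
        · exact z.state_none k _ (z.diag.emb ⟨i, hi⟩) fun j _ hc =>
            h ⟨rfl, j, (z.diag.mem_fibre _ _).2 hc⟩
      · rw [List.getElem?_eq_none (by omega), List.getElem?_eq_none]
        have : (z.tgt.lvl k).length = z.diag.trunc.len k := lvl_length _ _
        simp only [List.length_map, toLab]
        omega

theorem toLab_surj (P : Lab X k) : ∃ z : Labelled X k, z.toLab = P := by
  let D : Diagram k :=
    { v := fun m => (P.lvl m).map Prod.fst
      v_zero := by obtain ⟨x, hx⟩ := P.lvl_zero; simp [hx]
      v_lt := by
        intro m q hq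
        obtain ⟨p, hp, rfl⟩ := List.mem_map.1 hq
        have h1 := Lab.fits_mem P m (fun _ => ()) (fun _ => rfl) p hp
        simpa [Lab.top] using (List.getElem?_eq_some_iff.1 h1).1
      v_top := fun m h => by simp [P.lvl_top m h] }
  have hlen : ∀ m, D.len m = (P.lvl m).length := fun m => by simp [Diagram.len, D]
  let x : ∀ m : ℕ, Fin (D.len m) → X.cell m := fun m i =>
    ((P.lvl m)[i.1]'(by rw [← hlen]; exact i.2)).2
  have hpar : ∀ m (i : Fin (D.len (m + 1))), (D.par i).1 =
      ((P.lvl (m + 1))[i.1]'(by rw [← hlen]; exact i.2)).1 := by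
    intro m i
    simp only [Diagram.par, D, List.get_eq_getElem, List.getElem_map]
  have hx : ∀ (m : ℕ) (i : Fin (D.len (m + 1))), X.src (x (m + 1) i) = D.attachLab x i := by
    intro m i
    have hml : (moves X (P.lvl (m + 1))).length = D.len (m + 1) := by simp [moves, hlen]
    have h1 := (fits_iff _ _).1 (P.fits m) i.1 (by rw [hml]; exact i.2)
    have e : ∀ (j : ℕ) (hj : j < D.len (m + 1)),
        (moves X (P.lvl (m + 1)))[j]'(by rw [hml]; exact hj) =
          ((D.par ⟨j, hj⟩).1, X.src (x (m + 1) ⟨j, hj⟩), X.tgt (x (m + 1) ⟨j, hj⟩)) := by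
      intro j hj
      rw [hpar]
      simp only [moves, List.getElem_map, x]
    rw [e _ i.2] at h1
    simp only at h1
    rw [Diagram.attachLab]
    split_ifs with h
    · have hp := (D.mem_earlier _ _).1 (Finset.max'_mem _ h)
      rw [run_get_some _ _ _ ?_ ((D.earlier i).max' h).1 i.1 hp.1 (by rw [hml]; exact i.2.le)] at h1
      · rw [e _ (Fin.is_lt _)] at h1
        exact (Option.some.inj h1).symm
      · rw [e _ (Fin.is_lt _)]
        exact congrArg Fin.val hp.2
      · intro j hj hpj hc
        have hj' : j < D.len (m + 1) := hj.trans i.2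
        rw [e _ hj'] at hc
        have := Finset.le_max' _ ⟨j, hj'⟩ ((D.mem_earlier _ _).2 ⟨hj, Fin.ext hc⟩)
        exact absurd hpj (not_lt.2 this)
      · rw [List.length_map, ← hlen]
        exact (D.par i).2
    · rw [run_get_none, List.getElem?_map, List.getElem?_eq_getElem
        (by rw [← hlen]; exact (D.par i).2)] at h1
      · exact (Option.some.inj h1).symm
      · intro mv hm hc
        obtain ⟨j, hj, rfl⟩ := List.getElem_of_mem hm
        have hj' : j < i.1 ∧ j < D.len (m + 1) := by
          rw [List.length_take, hml] at hj; exact lt_min_iff.1 hj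
        rw [List.getElem_take, e _ hj'.2] at hc
        exact h ⟨⟨j, hj'.2⟩, (D.mem_earlier _ _).2 ⟨hj'.1, Fin.ext hc⟩⟩
  refine ⟨⟨P.le, D, D.desc x hx⟩, ?_⟩
  apply Lab.ext
  funext m
  apply List.ext_getElem
  · rw [← hlen]
    exact lvl_length _ m
  · intro i h1 h2
    refine (lvl_get _ m i h1).trans ?_
    apply Prod.ext
    · simp [D]
    · rfl

/-- The `n`-globular set `T X`, with `(T X)_k` the set of `X`-labelled simple `k`-string diagrams,
whose source and target maps are given by restriction of labellings. -/
abbrev obj (X : GSet.{u} n) : GSet.{u} n where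
  cell k := Labelled X k
  src := src
  tgt := tgt
  src_tgt z := toLab_inj <| by
    simp only [toLab_src, toLab_tgt]; exact (Lab.obj X).src_tgt z.toLab
  tgt_src z := toLab_inj <| by
    simp only [toLab_src, toLab_tgt]; exact (Lab.obj X).tgt_src z.toLab
  dim_le z := z.le

/-- The endofunctor `T` of the category of `n`-globular sets. -/
abbrev functor (n : ℕ) : GSet.{u} n ⥤ GSet.{u} n where
  obj X := obj X
  map f := ⟨fun _ z => map f z, fun _ _ => rfl, fun _ _ => rfl⟩
  map_id _ := rfl
  map_comp _ _ := rfl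

theorem toLab_map {Y : GSet.{u} n} (f : X ⟶ Y) (z : Labelled X k) :
    (map f z).toLab = Lab.map f z.toLab := by
  apply Lab.ext
  funext m
  simp only [toLab, Lab.map, lvl, List.map_ofFn]
  rfl

/-- A labelled diagram is the same thing as its lists of labelled dots. -/
noncomputable def equivLab (X : GSet.{u} n) (k : ℕ) : Labelled X k ≃ Lab X k :=
  Equiv.ofBijective toLab ⟨fun _ _ h => toLab_inj h, toLab_surj⟩

/-- The identification of labelled diagrams with lists of labelled dots. -/
noncomputable def isoLab (n : ℕ) : Lab.functor.{u} n ≅ functor.{u} n :=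
  NatIso.ofComponents
    (fun X =>
      { hom := ⟨fun k => (equivLab X k).symm,
          fun k P => (Equiv.symm_apply_eq _).2
            (((toLab_src _).trans (congrArg Lab.src ((equivLab X (k + 1)).apply_symm_apply P))).symm),
          fun k P => (Equiv.symm_apply_eq _).2
            (((toLab_tgt _).trans (congrArg Lab.tgt ((equivLab X (k + 1)).apply_symm_apply P))).symm)⟩
        inv := ⟨fun _ z => z.toLab, fun _ z => toLab_src z, fun _ z => toLab_tgt z⟩
        hom_inv_id := GSet.hom_ext fun k P => (equivLab X k).apply_symm_apply P
        inv_hom_id := GSet.hom_ext fun k z => (equivLab X k).symm_apply_apply z })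
    (fun f => GSet.hom_ext fun k P => (Equiv.symm_apply_eq _).2
      (((toLab_map f _).trans
        (congrArg (Lab.map f) ((equivLab _ k).apply_symm_apply P))).symm))

end Labelled

/-- The monad `T_n^(D^s)` of labelled simple string diagrams.  Its functor sends `X` to the globular
set of `X`-labelled simple string diagrams.  Its unit sends a `k`-cell `x` to the diagram with
exactly one dot in each dimension up to `k`, the dot of dimension `k` being labelled by `x`; its
multiplication replaces every dot of a diagram by the diagram which labels it.  These two are
defined on the lists of labelled dots. -/
noncomputable def sesquiMonad (n : ℕ) : Monad (GSet.{u} n) :=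
  (Lab.monad n).transport (Labelled.isoLab n)

/-! ### The monad presented by generators and relations -/

/-- Rooted trees whose leaves are labelled by cells of `X`, and whose internal vertices are labelled
by the generators: the binary operations `∘_(i,j)` and the unary operations `u_i`.  The indices of
the generators are determined by the dimensions of the subtrees. -/
inductive Tree {n : ℕ} (X : GSet.{u} n) : Type u
  | leaf : X.Cell → Tree X
  | comp : Tree X → Tree X → Tree X
  | unit : Tree X → Tree X

namespace Tree

variable {n : ℕ} {X Y Z : GSet.{u} n}

/-- The dimension of a tree. -/
def dim : Tree X → ℕ
  | leaf c => c.dim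
  | comp a b => max a.dim b.dim
  | unit a => a.dim + 1

/-- The source of a tree (only meaningful in positive dimension). -/
def src : Tree X → Tree X
  | leaf c => leaf c.s
  | comp a b =>
    if a.dim = b.dim then b.src else if a.dim < b.dim then comp a b.src else comp a.src b
  | unit a => a

/-- The target of a tree (only meaningful in positive dimension). -/
def tgt : Tree X → Tree X
  | leaf c => leaf c.t
  | comp a b =>
    if a.dim = b.dim then a.tgt else if a.dim < b.dim then comp a b.tgt else comp a.tgt b
  | unit a => a

/-- The iterated source `s^(i-m+1)(a)`, where `i = |a|` and `m = min(|a|, |b|)`. -/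
def sB (a b : Tree X) : Tree X := src^[a.dim - min a.dim b.dim + 1] a

/-- The iterated target `t^(j-m+1)(b)`, where `j = |b|` and `m = min(|a|, |b|)`. -/
def tB (a b : Tree X) : Tree X := tgt^[b.dim - min a.dim b.dim + 1] b

/-- `Rel a b` says that the trees `a` and `b` are compatible and that they are equivalent modulo the
relations.  In particular, `Rel a a` says that `a` is compatible, which means: for every subtree
`x ∘_(i,j) y` of `a`, one has `i, j ≥ 1` and `s^(i-m+1)(x)` is equivalent to `t^(j-m+1)(y)`, where
`m = min(i, j)`; for every subtree `u_i(x)`, one has `i ≤ n`.  Compatibility and equivalence are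
defined simultaneously: `Rel` is the least symmetric and transitive relation which contains the
leaves, is closed under grafting compatible trees, and identifies the two sides of each of the
relations (associativity and unitality) as soon as these two sides are compatible. -/
inductive Rel : Tree X → Tree X → Prop
  | leaf (c : X.Cell) : Rel (leaf c) (leaf c)
  | symm {a b : Tree X} : Rel a b → Rel b a
  | trans {a b c : Tree X} : Rel a b → Rel b c → Rel a c
  | comp {a a' b b' : Tree X} : 1 ≤ a.dim → 1 ≤ b.dim → Rel a a' → Rel b b' →
      Rel (sB a b) (tB a b) → Rel (sB a' b') (tB a' b') → Rel (comp a b) (comp a' b')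
  | unit {a a' : Tree X} : a.dim < n → Rel a a' → Rel (unit a) (unit a')
  | assoc {a b c : Tree X} :
      (a.dim = b.dim ∧ a.dim ≤ c.dim) ∨ (a.dim = c.dim ∧ a.dim ≤ b.dim) ∨
        (b.dim = c.dim ∧ b.dim ≤ a.dim) →
      Rel (comp (comp a b) c) (comp (comp a b) c) → Rel (comp a (comp b c)) (comp a (comp b c)) →
      Rel (comp (comp a b) c) (comp a (comp b c))
  | comp_comp_left {a b c : Tree X} : a.dim < b.dim → a.dim < c.dim →
      Rel (comp a (comp b c)) (comp a (comp b c)) →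
      Rel (comp (comp a b) (comp a c)) (comp (comp a b) (comp a c)) →
      Rel (comp a (comp b c)) (comp (comp a b) (comp a c))
  | comp_comp_right {a b c : Tree X} : c.dim < a.dim → c.dim < b.dim →
      Rel (comp (comp a b) c) (comp (comp a b) c) →
      Rel (comp (comp a c) (comp b c)) (comp (comp a c) (comp b c)) →
      Rel (comp (comp a b) c) (comp (comp a c) (comp b c))
  | unit_comp_of_lt {a b : Tree X} : a.dim < b.dim →
      Rel (comp (unit a) b) (comp (unit a) b) → Rel b b → Rel (comp (unit a) b) b
  | unit_comp_of_le {a b : Tree X} : b.dim ≤ a.dim →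
      Rel (comp (unit a) b) (comp (unit a) b) → Rel (unit (comp a b)) (unit (comp a b)) →
      Rel (comp (unit a) b) (unit (comp a b))
  | comp_unit_of_lt {a b : Tree X} : b.dim < a.dim →
      Rel (comp a (unit b)) (comp a (unit b)) → Rel a a → Rel (comp a (unit b)) a
  | comp_unit_of_le {a b : Tree X} : a.dim ≤ b.dim →
      Rel (comp a (unit b)) (comp a (unit b)) → Rel (unit (comp a b)) (unit (comp a b)) →
      Rel (comp a (unit b)) (unit (comp a b))

theorem Rel.left {a b : Tree X} (h : Rel a b) : Rel a a := h.trans h.symm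

theorem Rel.right {a b : Tree X} (h : Rel a b) : Rel b b := h.symm.trans h

theorem Rel.dim_eq {a b : Tree X} (h : Rel a b) : a.dim = b.dim := by
  induction h with
  | leaf c => rfl
  | symm _ ih => exact ih.symm
  | trans _ _ ih1 ih2 => exact ih1.trans ih2
  | comp _ _ _ _ _ _ ih1 ih2 => simp only [dim, ih1, ih2]
  | unit _ _ ih => simp only [dim, ih]
  | assoc => simp only [dim]; omega
  | comp_comp_left => simp only [dim]; omega
  | comp_comp_right => simp only [dim]; omega
  | unit_comp_of_lt => simp only [dim]; omega
  | unit_comp_of_le => simp only [dim]; omega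
  | comp_unit_of_lt => simp only [dim]; omega
  | comp_unit_of_le => simp only [dim]; omega

theorem Rel.dim_le {a b : Tree X} (h : Rel a b) : a.dim ≤ n ∧ b.dim ≤ n := by
  induction h with
  | leaf c => exact ⟨X.dim_le c.2, X.dim_le c.2⟩
  | symm _ ih => exact ih.symm
  | trans _ _ ih1 ih2 => exact ⟨ih1.1, ih2.2⟩
  | comp _ _ _ _ _ _ ih1 ih2 => simp only [dim]; omega
  | unit h1 h2 ih => have := h2.dim_eq; simp only [dim]; omega
  | assoc _ _ _ ih1 ih2 => exact ⟨ih1.1, ih2.1⟩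
  | comp_comp_left _ _ _ _ ih1 ih2 => exact ⟨ih1.1, ih2.1⟩
  | comp_comp_right _ _ _ _ ih1 ih2 => exact ⟨ih1.1, ih2.1⟩
  | unit_comp_of_lt _ _ _ ih1 ih2 => exact ⟨ih1.1, ih2.1⟩
  | unit_comp_of_le _ _ _ ih1 ih2 => exact ⟨ih1.1, ih2.1⟩
  | comp_unit_of_lt _ _ _ ih1 ih2 => exact ⟨ih1.1, ih2.1⟩
  | comp_unit_of_le _ _ _ ih1 ih2 => exact ⟨ih1.1, ih2.1⟩

/-- The condition at the root for a tree to be compatible. -/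
def Inv : Tree X → Prop
  | leaf _ => True
  | comp a b => 1 ≤ a.dim ∧ 1 ≤ b.dim ∧ Rel a a ∧ Rel b b ∧ Rel (sB a b) (tB a b)
  | unit a => a.dim < n ∧ Rel a a

theorem Rel.inv {a b : Tree X} (h : Rel a b) : Inv a ∧ Inv b := by
  induction h with
  | leaf c => exact ⟨trivial, trivial⟩
  | symm _ ih => exact ih.symm
  | trans _ _ ih1 ih2 => exact ⟨ih1.1, ih2.2⟩
  | comp ha hb h1 h2 h3 h4 =>
    have e1 := h1.dim_eq
    have e2 := h2.dim_eq
    exact ⟨⟨ha, hb, h1.left, h2.left, h3⟩, ⟨by omega, by omega, h1.right, h2.right, h4⟩⟩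
  | unit h1 h2 =>
    have e1 := h2.dim_eq
    exact ⟨⟨h1, h2.left⟩, ⟨by omega, h2.right⟩⟩
  | assoc _ _ _ ih1 ih2 => exact ⟨ih1.1, ih2.1⟩
  | comp_comp_left _ _ _ _ ih1 ih2 => exact ⟨ih1.1, ih2.1⟩
  | comp_comp_right _ _ _ _ ih1 ih2 => exact ⟨ih1.1, ih2.1⟩
  | unit_comp_of_lt _ _ _ ih1 ih2 => exact ⟨ih1.1, ih2.1⟩
  | unit_comp_of_le _ _ _ ih1 ih2 => exact ⟨ih1.1, ih2.1⟩
  | comp_unit_of_lt _ _ _ ih1 ih2 => exact ⟨ih1.1, ih2.1⟩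
  | comp_unit_of_le _ _ _ ih1 ih2 => exact ⟨ih1.1, ih2.1⟩

/-- A tree is compatible if and only if it is so at the root and its subtrees are compatible. -/
theorem compat_comp_iff {a b : Tree X} : Rel (comp a b) (comp a b) ↔
    1 ≤ a.dim ∧ 1 ≤ b.dim ∧ Rel a a ∧ Rel b b ∧ Rel (sB a b) (tB a b) :=
  ⟨fun h => h.inv.1, fun h => .comp h.1 h.2.1 h.2.2.1 h.2.2.2.1 h.2.2.2.2 h.2.2.2.2⟩

theorem compat_unit_iff {a : Tree X} : Rel (unit a) (unit a) ↔ a.dim < n ∧ Rel a a :=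
  ⟨fun h => h.inv.1, fun h => .unit h.1 h.2⟩

theorem comp_congr {a a' b b' : Tree X} (h1 : Rel a a') (h2 : Rel b b')
    (h : Rel (comp a b) (comp a b)) (h' : Rel (comp a' b') (comp a' b')) :
    Rel (comp a b) (comp a' b') :=
  have i := compat_comp_iff.1 h
  .comp i.1 i.2.1 h1 h2 i.2.2.2.2 (compat_comp_iff.1 h').2.2.2.2

theorem src_comp_eq {a b : Tree X} (h : a.dim = b.dim) : src (comp a b) = b.src := if_pos h

theorem src_comp_lt {a b : Tree X} (h : a.dim < b.dim) : src (comp a b) = comp a b.src := by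
  rw [src, if_neg (by omega), if_pos h]

theorem src_comp_gt {a b : Tree X} (h : b.dim < a.dim) : src (comp a b) = comp a.src b := by
  rw [src, if_neg (by omega), if_neg (by omega)]

theorem tgt_comp_eq {a b : Tree X} (h : a.dim = b.dim) : tgt (comp a b) = a.tgt := if_pos h

theorem tgt_comp_lt {a b : Tree X} (h : a.dim < b.dim) : tgt (comp a b) = comp a b.tgt := by
  rw [tgt, if_neg (by omega), if_pos h]

theorem tgt_comp_gt {a b : Tree X} (h : b.dim < a.dim) : tgt (comp a b) = comp a.tgt b := by
  rw [tgt, if_neg (by omega), if_neg (by omega)]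

theorem dim_src (a : Tree X) : a.src.dim = a.dim - 1 := by
  induction a with
  | leaf c => obtain ⟨k, x⟩ := c; cases k <;> rfl
  | comp a b iha ihb =>
    rcases lt_trichotomy a.dim b.dim with h | h | h
    · rw [src_comp_lt h]; simp only [dim]; omega
    · rw [src_comp_eq h]; simp only [dim]; omega
    · rw [src_comp_gt h]; simp only [dim]; omega
  | unit a ih => simp [src, dim]

theorem dim_tgt (a : Tree X) : a.tgt.dim = a.dim - 1 := by
  induction a with
  | leaf c => obtain ⟨k, x⟩ := c; cases k <;> rfl
  | comp a b iha ihb =>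
    rcases lt_trichotomy a.dim b.dim with h | h | h
    · rw [tgt_comp_lt h]; simp only [dim]; omega
    · rw [tgt_comp_eq h]; simp only [dim]; omega
    · rw [tgt_comp_gt h]; simp only [dim]; omega
  | unit a ih => simp [tgt, dim]

theorem sB_le {a b : Tree X} (h : a.dim ≤ b.dim) : sB a b = a.src := by
  rw [sB, show a.dim - min a.dim b.dim + 1 = 1 by omega]; rfl

theorem tB_le {a b : Tree X} (h : b.dim ≤ a.dim) : tB a b = b.tgt := by
  rw [tB, show b.dim - min a.dim b.dim + 1 = 1 by omega]; rfl

theorem sB_lt {a b : Tree X} (h : b.dim < a.dim) :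
    sB a b = src^[a.dim - b.dim - 1] a.src.src := by
  rw [sB, show a.dim - min a.dim b.dim + 1 = (a.dim - b.dim - 1) + 1 + 1 by omega]; rfl

theorem tB_lt {a b : Tree X} (h : a.dim < b.dim) :
    tB a b = tgt^[b.dim - a.dim - 1] b.tgt.tgt := by
  rw [tB, show b.dim - min a.dim b.dim + 1 = (b.dim - a.dim - 1) + 1 + 1 by omega]; rfl

theorem sB_pred {a a' b : Tree X} (h : b.dim < a.dim) (ha : a'.dim = a.dim - 1) :
    sB a' b = src^[a.dim - b.dim - 1] a'.src := by
  rw [sB, show a'.dim - min a'.dim b.dim + 1 = (a.dim - b.dim - 1) + 1 by omega]; rfl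

theorem tB_pred {a b b' : Tree X} (h : a.dim < b.dim) (hb : b'.dim = b.dim - 1) :
    tB a b' = tgt^[b.dim - a.dim - 1] b'.tgt := by
  rw [tB, show b'.dim - min a.dim b'.dim + 1 = (b.dim - a.dim - 1) + 1 by omega]; rfl

/-- Globularity of a tree up to equivalence. -/
def Glob (a : Tree X) : Prop :=
  2 ≤ a.dim → Rel a.src.src a.tgt.src ∧ Rel a.src.tgt a.tgt.tgt

/-- Sources and targets respect equivalence, and are globular. -/
def Bd (a b : Tree X) : Prop := Rel a.src b.src ∧ Rel a.tgt b.tgt ∧ Glob a ∧ Glob b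

/-- The induction hypothesis: sources and targets respect equivalence in dimensions below `d`. -/
def Below (X : GSet.{u} n) (d : ℕ) : Prop := ∀ a b : Tree X, a.dim < d → Rel a b → Bd a b

theorem Below.iter_src {d : ℕ} (H : Below X d) (p : ℕ) {a b : Tree X} (ha : a.dim < d)
    (h : Rel a b) : Rel (src^[p] a) (src^[p] b) := by
  induction p generalizing a b with
  | zero => exact h
  | succ p ih => exact ih (by rw [dim_src]; omega) (H _ _ ha h).1

theorem Below.iter_tgt {d : ℕ} (H : Below X d) (p : ℕ) {a b : Tree X} (ha : a.dim < d)
    (h : Rel a b) : Rel (tgt^[p] a) (tgt^[p] b) := by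
  induction p generalizing a b with
  | zero => exact h
  | succ p ih => exact ih (by rw [dim_tgt]; omega) (H _ _ ha h).2.1

theorem Below.compat_lt {d : ℕ} (H : Below X d) {a b : Tree X} (hab : a.dim < b.dim)
    (hd : b.dim ≤ d) (h : Rel (comp a b) (comp a b)) (hs : Rel b.src b.src) (ht : Rel b.tgt b.tgt)
    (hg : Glob b) : Rel (comp a b.src) (comp a b.src) ∧ Rel (comp a b.tgt) (comp a b.tgt) := by
  obtain ⟨h1, h2, h3, h4, h5⟩ := compat_comp_iff.1 h
  rw [sB_le hab.le, tB_lt hab] at h5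
  have ds := dim_src b
  have dt := dim_tgt b
  have g := hg (by omega)
  constructor
  · refine compat_comp_iff.2 ⟨h1, by omega, h3, hs, ?_⟩
    rw [sB_le (by omega), tB_pred hab ds]
    exact h5.trans (H.iter_tgt _ (by rw [dim_tgt, dim_src]; omega) g.2).symm
  · refine compat_comp_iff.2 ⟨h1, by omega, h3, ht, ?_⟩
    rw [sB_le (by omega), tB_pred hab dt]
    exact h5

theorem Below.compat_gt {d : ℕ} (H : Below X d) {a b : Tree X} (hab : b.dim < a.dim)
    (hd : a.dim ≤ d) (h : Rel (comp a b) (comp a b)) (hs : Rel a.src a.src) (ht : Rel a.tgt a.tgt)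
    (hg : Glob a) : Rel (comp a.src b) (comp a.src b) ∧ Rel (comp a.tgt b) (comp a.tgt b) := by
  obtain ⟨h1, h2, h3, h4, h5⟩ := compat_comp_iff.1 h
  rw [tB_le hab.le, sB_lt hab] at h5
  have ds := dim_src a
  have dt := dim_tgt a
  have g := hg (by omega)
  constructor
  · refine compat_comp_iff.2 ⟨by omega, h2, hs, h4, ?_⟩
    rw [tB_le (by omega), sB_pred hab ds]
    exact h5
  · refine compat_comp_iff.2 ⟨by omega, h2, ht, h4, ?_⟩
    rw [tB_le (by omega), sB_pred hab dt]
    exact (H.iter_src _ (by rw [dim_src, dim_src]; omega) g.1).symm.trans h5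

theorem Below.comp_src_tgt {d : ℕ} (H : Below X d) {a a' b b' : Tree X} (ha : Rel a a')
    (hb : Rel b b') (ba : Bd a a') (bb : Bd b b') (hda : a.dim ≤ d) (hdb : b.dim ≤ d)
    (h : Rel (comp a b) (comp a b)) (h' : Rel (comp a' b') (comp a' b')) :
    Rel (comp a b).src (comp a' b').src ∧ Rel (comp a b).tgt (comp a' b').tgt := by
  have ea := ha.dim_eq
  have eb := hb.dim_eq
  rcases lt_trichotomy a.dim b.dim with hab | hab | hab
  · rw [src_comp_lt hab, src_comp_lt (by omega), tgt_comp_lt hab, tgt_comp_lt (by omega)]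
    have k := H.compat_lt hab hdb h bb.1.left bb.2.1.left bb.2.2.1
    have k' := H.compat_lt (a := a') (b := b') (by omega) (by omega) h' bb.1.right bb.2.1.right
      bb.2.2.2
    exact ⟨comp_congr ha bb.1 k.1 k'.1, comp_congr ha bb.2.1 k.2 k'.2⟩
  · rw [src_comp_eq hab, src_comp_eq (by omega), tgt_comp_eq hab, tgt_comp_eq (by omega)]
    exact ⟨bb.1, ba.2.1⟩
  · rw [src_comp_gt hab, src_comp_gt (by omega), tgt_comp_gt hab, tgt_comp_gt (by omega)]
    have k := H.compat_gt hab hda h ba.1.left ba.2.1.left ba.2.2.1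
    have k' := H.compat_gt (a := a') (b := b') (by omega) (by omega) h' ba.1.right ba.2.1.right
      ba.2.2.2
    exact ⟨comp_congr ba.1 hb k.1 k'.1, comp_congr ba.2.1 hb k.2 k'.2⟩

theorem Below.glob_comp {d : ℕ} (H : Below X d) {a b : Tree X} (ba : Bd a a) (bb : Bd b b)
    (hda : a.dim ≤ d) (hdb : b.dim ≤ d) (h : Rel (comp a b) (comp a b)) : Glob (comp a b) := by
  intro h2
  have i := compat_comp_iff.1 h
  have dsa := dim_src a
  have dta := dim_tgt a
  have dsb := dim_src b
  have dtb := dim_tgt b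
  rcases lt_trichotomy a.dim b.dim with hab | hab | hab
  · rw [src_comp_lt hab, tgt_comp_lt hab]
    have k := H.compat_lt hab hdb h bb.1 bb.2.1 bb.2.2.1
    have g := bb.2.2.1 (by omega)
    have k1 := H _ _ (by simp only [dim]; omega) k.1
    have k2 := H _ _ (by simp only [dim]; omega) k.2
    rcases (show a.dim = b.dim - 1 ∨ a.dim < b.dim - 1 by omega) with e | e
    · rw [src_comp_eq (by omega), src_comp_eq (by omega), tgt_comp_eq (by omega),
        tgt_comp_eq (by omega)]
      exact ⟨g.1, ba.2.1⟩
    · rw [Bd, src_comp_lt (by omega), tgt_comp_lt (by omega)] at k1 k2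
      rw [src_comp_lt (by omega), src_comp_lt (by omega), tgt_comp_lt (by omega),
        tgt_comp_lt (by omega)]
      exact ⟨comp_congr i.2.2.1 g.1 k1.1 k2.1, comp_congr i.2.2.1 g.2 k1.2.1 k2.2.1⟩
  · rw [src_comp_eq hab, tgt_comp_eq hab]
    have e : Rel a.src b.tgt := by
      have := i.2.2.2.2
      rwa [sB_le hab.le, tB_le hab.ge] at this
    simp only [dim] at h2
    have ga := ba.2.2.1 (by omega)
    have gb := bb.2.2.1 (by omega)
    have k := H _ _ (by omega) e
    exact ⟨(gb.1.trans k.1.symm).trans ga.1, (gb.2.trans k.2.1.symm).trans ga.2⟩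
  · rw [src_comp_gt hab, tgt_comp_gt hab]
    have k := H.compat_gt hab hda h ba.1 ba.2.1 ba.2.2.1
    have g := ba.2.2.1 (by omega)
    have k1 := H _ _ (by simp only [dim]; omega) k.1
    have k2 := H _ _ (by simp only [dim]; omega) k.2
    rcases (show b.dim = a.dim - 1 ∨ b.dim < a.dim - 1 by omega) with e | e
    · rw [src_comp_eq (by omega), src_comp_eq (by omega), tgt_comp_eq (by omega),
        tgt_comp_eq (by omega)]
      exact ⟨bb.1, g.2⟩
    · rw [Bd, src_comp_gt (by omega), tgt_comp_gt (by omega)] at k1 k2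
      rw [src_comp_gt (by omega), src_comp_gt (by omega), tgt_comp_gt (by omega),
        tgt_comp_gt (by omega)]
      exact ⟨comp_congr g.1 i.2.2.2.1 k1.1 k2.1, comp_congr g.2 i.2.2.2.1 k1.2.1 k2.2.1⟩

theorem Bd.left {a b : Tree X} (h : Bd a b) : Bd a a := ⟨h.1.left, h.2.1.left, h.2.2.1, h.2.2.1⟩

theorem Bd.right {a b : Tree X} (h : Bd a b) : Bd b b :=
  ⟨h.1.right, h.2.1.right, h.2.2.2, h.2.2.2⟩

set_option linter.unusedSimpArgs false in
set_option linter.unusedTactic false in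
theorem Below.succ {d : ℕ} (H : Below X d) : Below X (d + 1) := by
  intro a b hd h
  induction h with
  | leaf c =>
    refine ⟨.leaf _, .leaf _, fun h2 => ?_, fun h2 => ?_⟩ <;>
    · obtain ⟨k, x⟩ := c
      match k, x, h2 with
      | k + 2, x, _ =>
        simp only [src, tgt, GSet.Cell.s, GSet.Cell.t, X.src_tgt, X.tgt_src]
        exact ⟨.leaf _, .leaf _⟩
  | symm h ih =>
    have := ih (by rw [h.dim_eq]; exact hd)
    exact ⟨this.1.symm, this.2.1.symm, this.2.2.2, this.2.2.1⟩
  | trans h1 h2 ih1 ih2 =>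
    have k1 := ih1 hd
    have k2 := ih2 (by rw [← h1.dim_eq]; exact hd)
    exact ⟨k1.1.trans k2.1, k1.2.1.trans k2.2.1, k1.2.2.1, k2.2.2.2⟩
  | @comp a a' b b' h1 h2 h3 h4 h5 h6 ih1 ih2 _ _ =>
    simp only [dim] at hd
    have ba := ih1 (by omega)
    have bb := ih2 (by omega)
    have ea := h3.dim_eq
    have eb := h4.dim_eq
    have k : Rel (comp a b) (comp a b) := compat_comp_iff.2 ⟨h1, h2, h3.left, h4.left, h5⟩
    have k' : Rel (comp a' b') (comp a' b') :=
      compat_comp_iff.2 ⟨by omega, by omega, h3.right, h4.right, h6⟩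
    have st := H.comp_src_tgt h3 h4 ba bb (by omega) (by omega) k k'
    exact ⟨st.1, st.2, H.glob_comp ba.left bb.left (by omega) (by omega) k,
      H.glob_comp ba.right bb.right (by omega) (by omega) k'⟩
  | unit h1 h2 ih =>
    simp only [dim] at hd
    have k := H _ _ (by omega) h2
    exact ⟨h2, h2, fun _ => ⟨k.left.1, k.left.2.1⟩, fun _ => ⟨k.right.1, k.right.2.1⟩⟩
  | @assoc a b c hh hL hR ihL ihR =>
    have bL := ihL hd
    have bR := ihR (by simp only [dim] at hd ⊢; omega)
    suffices k : Rel (src (comp (comp a b) c)) (src (comp a (comp b c))) ∧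
        Rel (tgt (comp (comp a b) c)) (tgt (comp a (comp b c))) from
      ⟨k.1, k.2, bL.2.2.1, bR.2.2.1⟩
    have i := compat_comp_iff.1 hL
    have i' := compat_comp_iff.1 i.2.2.1
    rcases hh with hh | hh | hh
    · rcases (show c.dim = a.dim ∨ a.dim < c.dim by omega) with h | h
      · constructor
        · have kL := bL.1
          have kR := bR.1
          simp (disch := ((try simp only [dim, dim_src]); omega)) only [src_comp_eq, src_comp_lt, src_comp_gt] at kL kR ⊢
          exact kL
        · have kL := bL.2.1
          have kR := bR.2.1
          simp (disch := ((try simp only [dim, dim_tgt]); omega)) only [tgt_comp_eq, tgt_comp_lt, tgt_comp_gt] at kL kR ⊢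
          exact kL
      · constructor
        · have kL := bL.1
          have kR := bR.1
          simp (disch := ((try simp only [dim, dim_src]); omega)) only [src_comp_eq, src_comp_lt, src_comp_gt] at kL kR ⊢
          exact .assoc (by (try simp only [dim_src]); omega) kL kR
        · have kL := bL.2.1
          have kR := bR.2.1
          simp (disch := ((try simp only [dim, dim_tgt]); omega)) only [tgt_comp_eq, tgt_comp_lt, tgt_comp_gt] at kL kR ⊢
          exact .assoc (by (try simp only [dim_tgt]); omega) kL kR
    · rcases (show b.dim = a.dim ∨ a.dim < b.dim by omega) with h | h
      · constructor
        · have kL := bL.1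
          have kR := bR.1
          simp (disch := ((try simp only [dim, dim_src]); omega)) only [src_comp_eq, src_comp_lt, src_comp_gt] at kL kR ⊢
          exact kL
        · have kL := bL.2.1
          have kR := bR.2.1
          simp (disch := ((try simp only [dim, dim_tgt]); omega)) only [tgt_comp_eq, tgt_comp_lt, tgt_comp_gt] at kL kR ⊢
          exact kL
      · constructor
        · have kL := bL.1
          have kR := bR.1
          simp (disch := ((try simp only [dim, dim_src]); omega)) only [src_comp_eq, src_comp_lt, src_comp_gt] at kL kR ⊢
          exact .assoc (by (try simp only [dim_src]); omega) kL kR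
        · have kL := bL.2.1
          have kR := bR.2.1
          simp (disch := ((try simp only [dim, dim_tgt]); omega)) only [tgt_comp_eq, tgt_comp_lt, tgt_comp_gt] at kL kR ⊢
          exact .assoc (by (try simp only [dim_tgt]); omega) kL kR
    · rcases (show b.dim = a.dim ∨ b.dim < a.dim by omega) with h | h
      · constructor
        · have kL := bL.1
          have kR := bR.1
          simp (disch := ((try simp only [dim, dim_src]); omega)) only [src_comp_eq, src_comp_lt, src_comp_gt] at kL kR ⊢
          exact kL
        · have kL := bL.2.1
          have kR := bR.2.1
          simp (disch := ((try simp only [dim, dim_tgt]); omega)) only [tgt_comp_eq, tgt_comp_lt, tgt_comp_gt] at kL kR ⊢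
          exact kL
      · constructor
        · have kL := bL.1
          have kR := bR.1
          simp (disch := ((try simp only [dim, dim_src]); omega)) only [src_comp_eq, src_comp_lt, src_comp_gt] at kL kR ⊢
          exact .assoc (by (try simp only [dim_src]); omega) kL kR
        · have kL := bL.2.1
          have kR := bR.2.1
          simp (disch := ((try simp only [dim, dim_tgt]); omega)) only [tgt_comp_eq, tgt_comp_lt, tgt_comp_gt] at kL kR ⊢
          exact .assoc (by (try simp only [dim_tgt]); omega) kL kR
  | @comp_comp_left a b c h1 h2 hL hR ihL ihR =>
    have bL := ihL hd
    have bR := ihR (by simp only [dim] at hd ⊢; omega)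
    suffices k : Rel (src (comp a (comp b c))) (src (comp (comp a b) (comp a c))) ∧
        Rel (tgt (comp a (comp b c))) (tgt (comp (comp a b) (comp a c))) from
      ⟨k.1, k.2, bL.2.2.1, bR.2.2.1⟩
    rcases lt_trichotomy b.dim c.dim with h | h | h
    · constructor
      · have kL := bL.1
        have kR := bR.1
        simp (disch := ((try simp only [dim, dim_src]); omega)) only [src_comp_eq, src_comp_lt, src_comp_gt] at kL kR ⊢
        exact .comp_comp_left (by (try simp only [dim_src]); omega) (by (try simp only [dim_src]); omega) kL kR
      · have kL := bL.2.1
        have kR := bR.2.1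
        simp (disch := ((try simp only [dim, dim_tgt]); omega)) only [tgt_comp_eq, tgt_comp_lt, tgt_comp_gt] at kL kR ⊢
        exact .comp_comp_left (by (try simp only [dim_tgt]); omega) (by (try simp only [dim_tgt]); omega) kL kR
    · constructor
      · have kL := bL.1
        have kR := bR.1
        simp (disch := ((try simp only [dim, dim_src]); omega)) only [src_comp_eq, src_comp_lt, src_comp_gt] at kL kR ⊢
        exact kL
      · have kL := bL.2.1
        have kR := bR.2.1
        simp (disch := ((try simp only [dim, dim_tgt]); omega)) only [tgt_comp_eq, tgt_comp_lt, tgt_comp_gt] at kL kR ⊢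
        exact kL
    · constructor
      · have kL := bL.1
        have kR := bR.1
        simp (disch := ((try simp only [dim, dim_src]); omega)) only [src_comp_eq, src_comp_lt, src_comp_gt] at kL kR ⊢
        exact .comp_comp_left (by (try simp only [dim_src]); omega) (by (try simp only [dim_src]); omega) kL kR
      · have kL := bL.2.1
        have kR := bR.2.1
        simp (disch := ((try simp only [dim, dim_tgt]); omega)) only [tgt_comp_eq, tgt_comp_lt, tgt_comp_gt] at kL kR ⊢
        exact .comp_comp_left (by (try simp only [dim_tgt]); omega) (by (try simp only [dim_tgt]); omega) kL kR
  | @comp_comp_right a b c h1 h2 hL hR ihL ihR =>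
    have bL := ihL hd
    have bR := ihR (by simp only [dim] at hd ⊢; omega)
    suffices k : Rel (src (comp (comp a b) c)) (src (comp (comp a c) (comp b c))) ∧
        Rel (tgt (comp (comp a b) c)) (tgt (comp (comp a c) (comp b c))) from
      ⟨k.1, k.2, bL.2.2.1, bR.2.2.1⟩
    rcases lt_trichotomy a.dim b.dim with h | h | h
    · constructor
      · have kL := bL.1
        have kR := bR.1
        simp (disch := ((try simp only [dim, dim_src]); omega)) only [src_comp_eq, src_comp_lt, src_comp_gt] at kL kR ⊢
        exact .comp_comp_right (by (try simp only [dim_src]); omega) (by (try simp only [dim_src]); omega) kL kR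
      · have kL := bL.2.1
        have kR := bR.2.1
        simp (disch := ((try simp only [dim, dim_tgt]); omega)) only [tgt_comp_eq, tgt_comp_lt, tgt_comp_gt] at kL kR ⊢
        exact .comp_comp_right (by (try simp only [dim_tgt]); omega) (by (try simp only [dim_tgt]); omega) kL kR
    · constructor
      · have kL := bL.1
        have kR := bR.1
        simp (disch := ((try simp only [dim, dim_src]); omega)) only [src_comp_eq, src_comp_lt, src_comp_gt] at kL kR ⊢
        exact kL
      · have kL := bL.2.1
        have kR := bR.2.1
        simp (disch := ((try simp only [dim, dim_tgt]); omega)) only [tgt_comp_eq, tgt_comp_lt, tgt_comp_gt] at kL kR ⊢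
        exact kL
    · constructor
      · have kL := bL.1
        have kR := bR.1
        simp (disch := ((try simp only [dim, dim_src]); omega)) only [src_comp_eq, src_comp_lt, src_comp_gt] at kL kR ⊢
        exact .comp_comp_right (by (try simp only [dim_src]); omega) (by (try simp only [dim_src]); omega) kL kR
      · have kL := bL.2.1
        have kR := bR.2.1
        simp (disch := ((try simp only [dim, dim_tgt]); omega)) only [tgt_comp_eq, tgt_comp_lt, tgt_comp_gt] at kL kR ⊢
        exact .comp_comp_right (by (try simp only [dim_tgt]); omega) (by (try simp only [dim_tgt]); omega) kL kR
  | @unit_comp_of_lt a b h1 hL hR ihL ihR =>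
    have bL := ihL hd
    have bR := ihR (by simp only [dim] at hd ⊢; omega)
    suffices k : Rel (src (comp (unit a) b)) (src (b)) ∧
        Rel (tgt (comp (unit a) b)) (tgt (b)) from
      ⟨k.1, k.2, bL.2.2.1, bR.2.2.1⟩
    have i := (compat_comp_iff.1 hL).2.2.2.2
    rcases (show (unit a).dim = b.dim ∨ (unit a).dim < b.dim by simp only [dim]; omega) with h | h
    · rw [sB_le h.le, tB_le h.ge] at i
      rw [src_comp_eq h, tgt_comp_eq h]
      exact ⟨bR.1, i⟩
    · have k1 := bL.1
      have k2 := bL.2.1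
      rw [src_comp_lt h] at k1 ⊢
      rw [tgt_comp_lt h] at k2 ⊢
      exact ⟨.unit_comp_of_lt (by rw [dim_src]; simp only [dim] at h; omega) k1 bR.1,
        .unit_comp_of_lt (by rw [dim_tgt]; simp only [dim] at h; omega) k2 bR.2.1⟩
  | @unit_comp_of_le a b h1 hL hR ihL ihR =>
    have bL := ihL hd
    have bR := ihR (by simp only [dim] at hd ⊢; omega)
    suffices k : Rel (src (comp (unit a) b)) (src (unit (comp a b))) ∧
        Rel (tgt (comp (unit a) b)) (tgt (unit (comp a b))) from
      ⟨k.1, k.2, bL.2.2.1, bR.2.2.1⟩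
    have h : b.dim < (unit a).dim := by simp only [dim]; omega
    rw [src_comp_gt h, tgt_comp_gt h]
    exact ⟨bR.1, bR.2.1⟩
  | @comp_unit_of_lt a b h1 hL hR ihL ihR =>
    have bL := ihL hd
    have bR := ihR (by simp only [dim] at hd ⊢; omega)
    suffices k : Rel (src (comp a (unit b))) (src (a)) ∧
        Rel (tgt (comp a (unit b))) (tgt (a)) from
      ⟨k.1, k.2, bL.2.2.1, bR.2.2.1⟩
    have i := (compat_comp_iff.1 hL).2.2.2.2
    rcases (show a.dim = (unit b).dim ∨ (unit b).dim < a.dim by simp only [dim]; omega) with h | h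
    · rw [sB_le h.le, tB_le h.ge] at i
      rw [src_comp_eq h, tgt_comp_eq h]
      exact ⟨i.symm, bR.2.1⟩
    · have k1 := bL.1
      have k2 := bL.2.1
      rw [src_comp_gt h] at k1 ⊢
      rw [tgt_comp_gt h] at k2 ⊢
      exact ⟨.comp_unit_of_lt (by rw [dim_src]; simp only [dim] at h; omega) k1 bR.1,
        .comp_unit_of_lt (by rw [dim_tgt]; simp only [dim] at h; omega) k2 bR.2.1⟩
  | @comp_unit_of_le a b h1 hL hR ihL ihR =>
    have bL := ihL hd
    have bR := ihR (by simp only [dim] at hd ⊢; omega)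
    suffices k : Rel (src (comp a (unit b))) (src (unit (comp a b))) ∧
        Rel (tgt (comp a (unit b))) (tgt (unit (comp a b))) from
      ⟨k.1, k.2, bL.2.2.1, bR.2.2.1⟩
    have h : a.dim < (unit b).dim := by simp only [dim]; omega
    rw [src_comp_lt h, tgt_comp_lt h]
    exact ⟨bR.1, bR.2.1⟩

/-- Sources and targets respect equivalence, and are globular up to equivalence. -/
theorem Rel.bd {a b : Tree X} (h : Rel a b) : Bd a b := by
  have H : ∀ d, Below X d := fun d => by
    induction d with
    | zero => exact fun a b hd => absurd hd (by omega)
    | succ d ih => exact ih.succ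
  exact H _ a b (Nat.lt_succ_self _) h

end Tree

namespace Tree

variable {n : ℕ} {X Y Z : GSet.{u} n}

/-- Grafting trees onto the leaves of a tree. -/
def bind (f : X.Cell → Tree Y) : Tree X → Tree Y
  | leaf c => f c
  | comp a b => comp (bind f a) (bind f b)
  | unit a => unit (bind f a)

theorem bind_leaf (a : Tree X) : bind leaf a = a := by
  induction a with
  | leaf c => rfl
  | comp a b iha ihb => rw [bind, iha, ihb]
  | unit a ih => rw [bind, ih]

theorem bind_bind (f : X.Cell → Tree Y) (g : Y.Cell → Tree Z) (a : Tree X) :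
    bind g (bind f a) = bind (fun c => bind g (f c)) a := by
  induction a with
  | leaf c => rfl
  | comp a b iha ihb => simp only [bind, iha, ihb]
  | unit a ih => simp only [bind, ih]

theorem Rel.iter_src (p : ℕ) {a b : Tree X} (h : Rel a b) : Rel (src^[p] a) (src^[p] b) := by
  induction p generalizing a b with
  | zero => exact h
  | succ p ih => exact ih h.bd.1

theorem Rel.iter_tgt (p : ℕ) {a b : Tree X} (h : Rel a b) : Rel (tgt^[p] a) (tgt^[p] b) := by
  induction p generalizing a b with
  | zero => exact h
  | succ p ih => exact ih h.bd.2.1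

theorem dim_iter_src (p : ℕ) (a : Tree X) : (src^[p] a).dim = a.dim - p := by
  induction p generalizing a with
  | zero => rfl
  | succ p ih => rw [Function.iterate_succ_apply, ih, dim_src]; omega

/-- A family of compatible trees, indexed by the cells of `X`, which respects the boundaries up to
equivalence. -/
structure Good (f : X.Cell → Tree Y) : Prop where
  dim : ∀ c, (f c).dim = c.dim
  compat : ∀ c, Rel (f c) (f c)
  src : ∀ c, 1 ≤ c.dim → Rel (f c.s) (f c).src
  tgt : ∀ c, 1 ≤ c.dim → Rel (f c.t) (f c).tgt

theorem Good.dim_bind {f : X.Cell → Tree Y} (hf : Good f) (a : Tree X) :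
    (bind f a).dim = a.dim := by
  induction a with
  | leaf c => exact hf.dim c
  | comp a b iha ihb => simp only [bind, Tree.dim, iha, ihb]
  | unit a ih => simp only [bind, Tree.dim, ih]

/-- Grafting commutes with sources and targets. -/
def Comm (f : X.Cell → Tree Y) (a : Tree X) : Prop :=
  1 ≤ a.dim → Rel (bind f a.src) (bind f a).src ∧ Rel (bind f a.tgt) (bind f a).tgt

/-- The induction hypothesis for the compatibility of grafting with equivalence. -/
def GraftBelow (f : X.Cell → Tree Y) (d : ℕ) : Prop :=
  ∀ a b : Tree X, a.dim < d → Rel a b → Rel (bind f a) (bind f b) ∧ Comm f a ∧ Comm f b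

theorem GraftBelow.iter_src {f : X.Cell → Tree Y} {d : ℕ} (H : GraftBelow f d) (p : ℕ)
    {a : Tree X} (ha : a.dim < d) (hp : p ≤ a.dim) (h : Rel a a) :
    Rel (bind f (src^[p] a)) (src^[p] (bind f a)) := by
  induction p generalizing a with
  | zero => exact (H a a ha h).1
  | succ p ih =>
    have := dim_src a
    exact (ih (by omega) (by omega) h.bd.1).trans
      (Rel.iter_src p ((H a a ha h).2.1 (by omega)).1)

theorem GraftBelow.iter_tgt {f : X.Cell → Tree Y} {d : ℕ} (H : GraftBelow f d) (p : ℕ)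
    {a : Tree X} (ha : a.dim < d) (hp : p ≤ a.dim) (h : Rel a a) :
    Rel (bind f (tgt^[p] a)) (tgt^[p] (bind f a)) := by
  induction p generalizing a with
  | zero => exact (H a a ha h).1
  | succ p ih =>
    have := dim_tgt a
    exact (ih (by omega) (by omega) h.bd.2.1).trans
      (Rel.iter_tgt p ((H a a ha h).2.1 (by omega)).2)

theorem GraftBelow.bound {f : X.Cell → Tree Y} (hf : Good f) {d : ℕ} (H : GraftBelow f d)
    {a b : Tree X} (ha : a.dim ≤ d) (hb : b.dim ≤ d) (ha1 : 1 ≤ a.dim) (hb1 : 1 ≤ b.dim)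
    (ra : Rel a a) (rb : Rel b b) (ca : Comm f a) (cb : Comm f b) (h : Rel (sB a b) (tB a b)) :
    Rel (sB (bind f a) (bind f b)) (tB (bind f a) (bind f b)) := by
  have ds := dim_src a
  have dt := dim_tgt b
  rw [sB, tB, hf.dim_bind, hf.dim_bind]
  rw [sB, tB] at h
  have k1 := H.iter_src (a.dim - min a.dim b.dim) (by omega) (by omega) ra.bd.1
  have k2 := H.iter_tgt (b.dim - min a.dim b.dim) (by omega) (by omega) rb.bd.2.1
  have e1 := Rel.iter_src (a.dim - min a.dim b.dim) (ca ha1).1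
  have e2 := Rel.iter_tgt (b.dim - min a.dim b.dim) (cb hb1).2
  have k := (H _ _ (by rw [dim_iter_src]; omega) h).1
  exact ((k1.trans e1).symm.trans k).trans (k2.trans e2)

theorem GraftBelow.succ {f : X.Cell → Tree Y} (hf : Good f) {d : ℕ} (H : GraftBelow f d) :
    GraftBelow f (d + 1) := by
  intro a b hd h
  induction h with
  | leaf c =>
    have k : Comm f (Tree.leaf c) := fun h1 => ⟨hf.src c h1, hf.tgt c h1⟩
    exact ⟨hf.compat c, k, k⟩
  | symm h ih =>
    have := ih (by rw [h.dim_eq]; exact hd)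
    exact ⟨this.1.symm, this.2.2, this.2.1⟩
  | trans h1 h2 ih1 ih2 =>
    have k1 := ih1 hd
    have k2 := ih2 (by rw [← h1.dim_eq]; exact hd)
    exact ⟨k1.1.trans k2.1, k1.2.1, k2.2.2⟩
  | @comp a a' b b' h1 h2 h3 h4 h5 h6 ih1 ih2 _ _ =>
    simp only [Tree.dim] at hd
    have ba := ih1 (by omega)
    have bb := ih2 (by omega)
    have ea := h3.dim_eq
    have eb := h4.dim_eq
    have k : Rel (Tree.comp a b) (Tree.comp a b) :=
      compat_comp_iff.2 ⟨h1, h2, h3.left, h4.left, h5⟩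
    have k' : Rel (Tree.comp a' b') (Tree.comp a' b') :=
      compat_comp_iff.2 ⟨by omega, by omega, h3.right, h4.right, h6⟩
    have B := H.bound hf (by omega) (by omega) h1 h2 h3.left h4.left ba.2.1 bb.2.1 h5
    have B' := H.bound hf (by omega) (by omega) (by omega) (by omega) h3.right h4.right ba.2.2
      bb.2.2 h6
    have P : Rel (Tree.comp (bind f a) (bind f b)) (Tree.comp (bind f a') (bind f b')) :=
      .comp (by rw [hf.dim_bind]; omega) (by rw [hf.dim_bind]; omega) ba.1 bb.1 B B'
    have Q : ∀ x y : Tree X, x.dim ≤ d → y.dim ≤ d → Rel (Tree.comp x y) (Tree.comp x y) →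
        Rel (Tree.comp (bind f x) (bind f y)) (Tree.comp (bind f x) (bind f y)) →
        Comm f x → Comm f y → Comm f (Tree.comp x y) := by
      intro x y hx hy r r' cx cy _
      have i := compat_comp_iff.1 r'
      have j := compat_comp_iff.1 r
      have dx := hf.dim_bind x
      have dy := hf.dim_bind y
      have rs := (H _ _ (by rw [dim_src]; simp only [Tree.dim]; omega) r.bd.1).1
      have rt := (H _ _ (by rw [dim_tgt]; simp only [Tree.dim]; omega) r.bd.2.1).1
      have rs' := r'.bd.1
      have rt' := r'.bd.2.1
      simp only [bind]
      rcases lt_trichotomy x.dim y.dim with e | e | e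
      · rw [src_comp_lt e] at rs ⊢
        rw [tgt_comp_lt e] at rt ⊢
        rw [src_comp_lt (by omega)] at rs' ⊢
        rw [tgt_comp_lt (by omega)] at rt' ⊢
        exact ⟨comp_congr i.2.2.1 (cy j.2.1).1 rs rs', comp_congr i.2.2.1 (cy j.2.1).2 rt rt'⟩
      · rw [src_comp_eq e, tgt_comp_eq e, src_comp_eq (by omega), tgt_comp_eq (by omega)]
        exact ⟨(cy j.2.1).1, (cx j.1).2⟩
      · rw [src_comp_gt e] at rs ⊢
        rw [tgt_comp_gt e] at rt ⊢
        rw [src_comp_gt (by omega)] at rs' ⊢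
        rw [tgt_comp_gt (by omega)] at rt' ⊢
        exact ⟨comp_congr (cx j.1).1 i.2.2.2.1 rs rs', comp_congr (cx j.1).2 i.2.2.2.1 rt rt'⟩
    exact ⟨P, Q a b (by omega) (by omega) k P.left ba.2.1 bb.2.1,
      Q a' b' (by omega) (by omega) k' P.right ba.2.2 bb.2.2⟩
  | unit h1 h2 ih =>
    simp only [Tree.dim] at hd
    have k := ih (by omega)
    exact ⟨.unit (by rw [hf.dim_bind]; exact h1) k.1, fun _ => ⟨k.1.left, k.1.left⟩,
      fun _ => ⟨k.1.right, k.1.right⟩⟩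
  | assoc hh hL hR ihL ihR =>
    have kL := ihL hd
    have kR := ihR (by simp only [Tree.dim] at hd ⊢; omega)
    exact ⟨.assoc (by simpa only [hf.dim_bind] using hh) kL.1 kR.1, kL.2.1, kR.2.1⟩
  | comp_comp_left h1 h2 hL hR ihL ihR =>
    have kL := ihL hd
    have kR := ihR (by simp only [Tree.dim] at hd ⊢; omega)
    exact ⟨.comp_comp_left (by simpa only [hf.dim_bind] using h1)
      (by simpa only [hf.dim_bind] using h2) kL.1 kR.1, kL.2.1, kR.2.1⟩
  | comp_comp_right h1 h2 hL hR ihL ihR =>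
    have kL := ihL hd
    have kR := ihR (by simp only [Tree.dim] at hd ⊢; omega)
    exact ⟨.comp_comp_right (by simpa only [hf.dim_bind] using h1)
      (by simpa only [hf.dim_bind] using h2) kL.1 kR.1, kL.2.1, kR.2.1⟩
  | unit_comp_of_lt h1 hL hR ihL ihR =>
    have kL := ihL hd
    have kR := ihR (by simp only [Tree.dim] at hd ⊢; omega)
    exact ⟨.unit_comp_of_lt (by simpa only [hf.dim_bind] using h1) kL.1 kR.1, kL.2.1, kR.2.1⟩
  | unit_comp_of_le h1 hL hR ihL ihR =>
    have kL := ihL hd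
    have kR := ihR (by simp only [Tree.dim] at hd ⊢; omega)
    exact ⟨.unit_comp_of_le (by simpa only [hf.dim_bind] using h1) kL.1 kR.1, kL.2.1, kR.2.1⟩
  | comp_unit_of_lt h1 hL hR ihL ihR =>
    have kL := ihL hd
    have kR := ihR (by simp only [Tree.dim] at hd ⊢; omega)
    exact ⟨.comp_unit_of_lt (by simpa only [hf.dim_bind] using h1) kL.1 kR.1, kL.2.1, kR.2.1⟩
  | comp_unit_of_le h1 hL hR ihL ihR =>
    have kL := ihL hd
    have kR := ihR (by simp only [Tree.dim] at hd ⊢; omega)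
    exact ⟨.comp_unit_of_le (by simpa only [hf.dim_bind] using h1) kL.1 kR.1, kL.2.1, kR.2.1⟩

theorem Good.graft {f : X.Cell → Tree Y} (hf : Good f) {a b : Tree X} (h : Rel a b) :
    Rel (bind f a) (bind f b) ∧ Comm f a ∧ Comm f b := by
  have H : ∀ d, GraftBelow f d := fun d => by
    induction d with
    | zero => exact fun a b hd => absurd hd (by omega)
    | succ d ih => exact ih.succ hf
  exact H _ a b (Nat.lt_succ_self _) h

theorem Good.congr {f g : X.Cell → Tree Y} (hf : Good f) (hg : Good g) (h : ∀ c, Rel (f c) (g c))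
    {a : Tree X} (ha : Rel a a) : Rel (bind f a) (bind g a) := by
  induction a with
  | leaf c => exact h c
  | comp a b iha ihb =>
    have i := compat_comp_iff.1 ha
    exact comp_congr (iha i.2.2.1) (ihb i.2.2.2.1) (hf.graft ha).1 (hg.graft ha).1
  | unit a ih =>
    have i := compat_unit_iff.1 ha
    exact .unit (by rw [hf.dim_bind]; exact i.1) (ih i.2)

/-! The globular set of equivalence classes of compatible trees. -/

/-- Compatible trees of dimension `k`. -/
def Compat (X : GSet.{u} n) (k : ℕ) : Type u := {a : Tree X // Rel a a ∧ a.dim = k}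

/-- Equivalence of compatible trees. -/
instance setoid (X : GSet.{u} n) (k : ℕ) : Setoid (Compat X k) where
  r a b := Rel a.1 b.1
  iseqv := ⟨fun a => a.2.1, fun h => h.symm, fun h k => h.trans k⟩

/-- The source of a compatible tree. -/
def Compat.src {k : ℕ} (a : Compat X (k + 1)) : Compat X k :=
  ⟨a.1.src, a.2.1.bd.1, by rw [dim_src, a.2.2]; rfl⟩

/-- The target of a compatible tree. -/
def Compat.tgt {k : ℕ} (a : Compat X (k + 1)) : Compat X k :=
  ⟨a.1.tgt, a.2.1.bd.2.1, by rw [dim_tgt, a.2.2]; rfl⟩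

/-- The `n`-globular set of equivalence classes of compatible trees. -/
abbrev obj (X : GSet.{u} n) : GSet.{u} n where
  cell k := Quotient (setoid X k)
  src := Quotient.map Compat.src fun _ _ h => Rel.bd h |>.1
  tgt := Quotient.map Compat.tgt fun _ _ h => Rel.bd h |>.2.1
  src_tgt {k} x := Quotient.inductionOn x fun a =>
    Quotient.sound (a.2.1.bd.2.2.1 (by rw [a.2.2]; omega)).1.symm
  tgt_src {k} x := Quotient.inductionOn x fun a =>
    Quotient.sound (a.2.1.bd.2.2.1 (by rw [a.2.2]; omega)).2
  dim_le x := Quotient.inductionOn x fun a => a.2.2 ▸ a.2.1.dim_le.1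

/-- The equivalence class of a compatible tree. -/
def mk (a : Tree X) (h : Rel a a) : (obj X).Cell := ⟨a.dim, Quotient.mk _ ⟨a, h, rfl⟩⟩

theorem mk_eq {a b : Tree X} (h : Rel a b) : mk a h.left = mk b h.right := by
  have e := h.dim_eq
  simp only [mk]
  refine Sigma.ext e ?_
  have : ∀ (k : ℕ) (e : k = b.dim) (h1 : Rel a a ∧ a.dim = k),
      HEq (Quotient.mk (setoid X k) ⟨a, h1⟩) (Quotient.mk (setoid X b.dim) ⟨b, h.right, rfl⟩) := by
    rintro k rfl h1
    exact heq_of_eq (Quotient.sound h)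
  exact this _ e _

/-- A representative of an equivalence class of trees. -/
noncomputable def out (c : (obj X).Cell) : Tree X := (Quotient.out c.2).1

theorem out_compat (c : (obj X).Cell) : Rel (out c) (out c) := (Quotient.out c.2).2.1

theorem dim_out (c : (obj X).Cell) : (out c).dim = c.dim := (Quotient.out c.2).2.2

theorem out_mk {k : ℕ} (a : Compat X k) : Rel (out ⟨k, Quotient.mk _ a⟩) a.1 :=
  Quotient.exact (Quotient.out_eq (Quotient.mk _ a))

theorem good_out : Good (out (X := X)) where
  dim := dim_out
  compat := out_compat
  src c h := by
    obtain ⟨k, x⟩ := c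
    obtain ⟨k, rfl⟩ : ∃ j, k = j + 1 := ⟨k - 1, by simp only [GSet.Cell.dim] at h; omega⟩
    induction x using Quotient.inductionOn with
    | h a => exact (out_mk a.src).trans (out_mk a).bd.1.symm
  tgt c h := by
    obtain ⟨k, x⟩ := c
    obtain ⟨k, rfl⟩ : ∃ j, k = j + 1 := ⟨k - 1, by simp only [GSet.Cell.dim] at h; omega⟩
    induction x using Quotient.inductionOn with
    | h a => exact (out_mk a.tgt).trans (out_mk a).bd.2.1.symm

theorem Good.comp {f : X.Cell → Tree Y} {g : Y.Cell → Tree Z} (hf : Good f) (hg : Good g) :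
    Good fun c => bind g (f c) where
  dim c := by rw [hg.dim_bind, hf.dim]
  compat c := (hg.graft (hf.compat c)).1
  src c h := (hg.graft (hf.src c h)).1.trans ((hg.graft (hf.compat c)).2.1 (by rwa [hf.dim])).1
  tgt c h := (hg.graft (hf.tgt c h)).1.trans ((hg.graft (hf.compat c)).2.1 (by rwa [hf.dim])).2

theorem good_leaf (f : X ⟶ Y) : Good fun c => leaf (GSet.Hom.onCell f c) where
  dim _ := rfl
  compat _ := .leaf _
  src c h := by
    obtain ⟨k, x⟩ := c
    obtain ⟨k, rfl⟩ : ∃ j, k = j + 1 := ⟨k - 1, by simp only [GSet.Cell.dim] at h; omega⟩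
    simp only [src, GSet.Cell.s, GSet.Hom.onCell, f.map_src]
    exact .leaf _
  tgt c h := by
    obtain ⟨k, x⟩ := c
    obtain ⟨k, rfl⟩ : ∃ j, k = j + 1 := ⟨k - 1, by simp only [GSet.Cell.dim] at h; omega⟩
    simp only [tgt, GSet.Cell.t, GSet.Hom.onCell, f.map_tgt]
    exact .leaf _

/-- Grafting, on compatible trees. -/
def Good.onCompat {f : X.Cell → Tree Y} (hf : Good f) {k : ℕ} (a : Compat X k) : Compat Y k :=
  ⟨bind f a.1, (hf.graft a.2.1).1, by rw [hf.dim_bind, a.2.2]⟩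

/-- Grafting, on equivalence classes of compatible trees. -/
def Good.hom {f : X.Cell → Tree Y} (hf : Good f) : obj X ⟶ obj Y where
  app k := Quotient.map hf.onCompat fun _ _ h => (hf.graft h).1
  map_src k x := Quotient.inductionOn x fun a =>
    Quotient.sound ((hf.graft a.2.1).2.1 (by rw [a.2.2]; omega)).1
  map_tgt k x := Quotient.inductionOn x fun a =>
    Quotient.sound ((hf.graft a.2.1).2.1 (by rw [a.2.2]; omega)).2

theorem Good.hom_eq {f g : X.Cell → Tree Y} (hf : Good f) (hg : Good g)
    (h : ∀ c, Rel (f c) (g c)) : hf.hom = hg.hom :=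
  GSet.hom_ext fun _ x => Quotient.inductionOn x fun a => Quotient.sound (hf.congr hg h a.2.1)

theorem Good.hom_comp {f : X.Cell → Tree Y} {g : Y.Cell → Tree Z} (hf : Good f) (hg : Good g) :
    hf.hom ≫ hg.hom = (hf.comp hg).hom :=
  GSet.hom_ext fun _ x => Quotient.inductionOn x fun a =>
    congrArg (Quotient.mk _) (Subtype.ext (bind_bind f g a.1))

theorem hom_leaf (h : Good (leaf : X.Cell → Tree X)) : h.hom = 𝟙 (obj X) :=
  GSet.hom_ext fun _ x => Quotient.inductionOn x fun a =>
    congrArg (Quotient.mk _) (Subtype.ext (bind_leaf a.1))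

/-- The endofunctor of `n`-globular sets given by equivalence classes of compatible trees; a map
of globular sets acts by relabelling the leaves. -/
abbrev functor (n : ℕ) : GSet.{u} n ⥤ GSet.{u} n where
  obj X := obj X
  map f := (good_leaf f).hom
  map_id X := hom_leaf (good_leaf (𝟙 X))
  map_comp f g := ((good_leaf f).hom_comp (good_leaf g)).symm

/-- The map which sends a cell to the tree with no edges labelled by that cell. -/
def pureHom (X : GSet.{u} n) : X ⟶ obj X where
  app k x := Quotient.mk _ ⟨leaf ⟨k, x⟩, .leaf _, rfl⟩
  map_src _ _ := rfl
  map_tgt _ _ := rfl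

/-- The map which grafts, onto the leaves of a tree of trees, the trees which label them. -/
noncomputable def joinHom (X : GSet.{u} n) : obj (obj X) ⟶ obj X := good_out.hom

theorem out_onCell {f : X.Cell → Tree Y} (hf : Good f) (c : (obj X).Cell) :
    Rel (bind f (out c)) (out (GSet.Hom.onCell hf.hom c)) := by
  obtain ⟨k, x⟩ := c
  induction x using Quotient.inductionOn with
  | h a => exact (hf.graft (out_mk a)).1.trans (out_mk (hf.onCompat a)).symm

/-- Grafting trees, modulo the relations, is natural. -/
theorem hom_join {f : X.Cell → Tree Y} (hf : Good f) :
    (good_leaf hf.hom).hom ≫ joinHom Y = joinHom X ≫ hf.hom := by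
  rw [joinHom, joinHom, Good.hom_comp, Good.hom_comp]
  exact Good.hom_eq _ _ fun c => (out_onCell hf c).symm

theorem pure_hom {f : X.Cell → Tree Y} (hf : Good f) (k : ℕ) (x : X.cell k) :
    GSet.Hom.app (pureHom X ≫ hf.hom) k x = Quotient.mk _ ⟨f ⟨k, x⟩, hf.compat _, hf.dim _⟩ :=
  rfl

/-- The monad presented by the generators `∘_(i,j)`, `u_i` and by the relations: equivalence classes
of compatible trees whose leaves are labelled by cells.  Its unit is given by trees with no edges,
its multiplication by grafting. -/
noncomputable def monad (n : ℕ) : Monad (GSet.{u} n) where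
  toFunctor := functor n
  η :=
    { app := pureHom
      naturality := fun _ _ f => GSet.hom_ext fun _ x => rfl }
  μ :=
    { app := joinHom
      naturality := fun _ _ f => hom_join (good_leaf f) }
  assoc X := hom_join good_out
  left_unit X := GSet.hom_ext fun k x => Quotient.inductionOn x fun a =>
    Quotient.sound (out_mk a)
  right_unit X := by
    refine (Good.hom_comp _ _).trans ((Good.hom_eq _ (good_leaf (𝟙 X)) fun c => ?_).trans
      (hom_leaf _))
    exact out_mk (X := X) (k := c.1) ⟨leaf c, .leaf _, rfl⟩

end Tree

/-! ### Composition, whiskering and units -/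

section operations

variable {n : ℕ}

/-- A pair of cells `(x, y)` of dimensions `i, j ≥ 1` belongs to the pullback of `s^(i-m+1)` and
`t^(j-m+1)`, where `m = min(i, j)`. -/
def Composable {C : GSet.{u} n} (x y : C.Cell) : Prop :=
  1 ≤ x.dim ∧ 1 ≤ y.dim ∧
    GSet.Cell.s^[x.dim - min x.dim y.dim + 1] x = GSet.Cell.t^[y.dim - min x.dim y.dim + 1] y

theorem onCell_iter_s {C D : GSet.{u} n} (f : C ⟶ D) (p : ℕ) (x : C.Cell) :
    GSet.Hom.onCell f (GSet.Cell.s^[p] x) = GSet.Cell.s^[p] (GSet.Hom.onCell f x) := by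
  induction p generalizing x with
  | zero => rfl
  | succ p ih =>
    rw [Function.iterate_succ_apply, Function.iterate_succ_apply, ih]
    obtain ⟨k, x⟩ := x
    cases k with
    | zero => rfl
    | succ k => simp only [GSet.Cell.s, GSet.Hom.onCell, f.map_src]

theorem onCell_iter_t {C D : GSet.{u} n} (f : C ⟶ D) (p : ℕ) (x : C.Cell) :
    GSet.Hom.onCell f (GSet.Cell.t^[p] x) = GSet.Cell.t^[p] (GSet.Hom.onCell f x) := by
  induction p generalizing x with
  | zero => rfl
  | succ p ih =>
    rw [Function.iterate_succ_apply, Function.iterate_succ_apply, ih]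
    obtain ⟨k, x⟩ := x
    cases k with
    | zero => rfl
    | succ k => simp only [GSet.Cell.t, GSet.Hom.onCell, f.map_tgt]

theorem Composable.map {C D : GSet.{u} n} (f : C ⟶ D) {x y : C.Cell} (h : Composable x y) :
    Composable (GSet.Hom.onCell f x) (GSet.Hom.onCell f y) :=
  ⟨h.1, h.2.1, (onCell_iter_s f _ x).symm.trans
    ((congrArg (GSet.Hom.onCell f) h.2.2).trans (onCell_iter_t f _ y))⟩

/-- Binary operations (composition and whiskering) and unary operations (units) on a globular set,
subject to the laws of sources and targets, the associativity laws and the unitality laws.  The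
operation `∘_(i,j)` is the restriction of `comp` to the pairs of cells of dimensions `(i, j)`, and
`u_i` is the restriction of `unit` to the cells of dimension `i - 1`. -/
structure SesquiStr (C : GSet.{u} n) where
  comp : ∀ x y : C.Cell, Composable x y → C.Cell
  unit : ∀ x : C.Cell, x.dim < n → C.Cell
  dim_comp : ∀ x y h, (comp x y h).dim = max x.dim y.dim
  dim_unit : ∀ x h, (unit x h).dim = x.dim + 1
  s_comp_of_gt : ∀ x y h h', y.dim < x.dim → (comp x y h).s = comp x.s y h'
  t_comp_of_gt : ∀ x y h h', y.dim < x.dim → (comp x y h).t = comp x.t y h'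
  s_comp_of_lt : ∀ x y h h', x.dim < y.dim → (comp x y h).s = comp x y.s h'
  t_comp_of_lt : ∀ x y h h', x.dim < y.dim → (comp x y h).t = comp x y.t h'
  s_comp_of_eq : ∀ x y h, x.dim = y.dim → (comp x y h).s = y.s
  t_comp_of_eq : ∀ x y h, x.dim = y.dim → (comp x y h).t = x.t
  s_unit : ∀ x h, (unit x h).s = x
  t_unit : ∀ x h, (unit x h).t = x
  assoc : ∀ x y z hxy h hyz h',
    (x.dim = y.dim ∧ x.dim ≤ z.dim) ∨ (x.dim = z.dim ∧ x.dim ≤ y.dim) ∨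
      (y.dim = z.dim ∧ y.dim ≤ x.dim) →
    comp (comp x y hxy) z h = comp x (comp y z hyz) h'
  comp_comp_left : ∀ x y z hyz h hxy hxz h', x.dim < y.dim → x.dim < z.dim →
    comp x (comp y z hyz) h = comp (comp x y hxy) (comp x z hxz) h'
  comp_comp_right : ∀ x y z hxy h hxz hyz h', z.dim < x.dim → z.dim < y.dim →
    comp (comp x y hxy) z h = comp (comp x z hxz) (comp y z hyz) h'
  unit_comp_of_lt : ∀ x y hx h, x.dim < y.dim → comp (unit x hx) y h = y
  unit_comp_of_le : ∀ x y hx h hxy hu, y.dim ≤ x.dim →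
    comp (unit x hx) y h = unit (comp x y hxy) hu
  comp_unit_of_lt : ∀ x y hy h, y.dim < x.dim → comp x (unit y hy) h = x
  comp_unit_of_le : ∀ x y hy h hxy hu, x.dim ≤ y.dim →
    comp x (unit y hy) h = unit (comp x y hxy) hu

/-- A map of globular sets preserves the operations. -/
def SesquiStr.Preserves {C D : GSet.{u} n} (S : SesquiStr C) (S' : SesquiStr D) (f : C ⟶ D) :
    Prop :=
  (∀ (x y : C.Cell) (h : Composable x y),
    GSet.Hom.onCell f (S.comp x y h) =
      S'.comp (GSet.Hom.onCell f x) (GSet.Hom.onCell f y) (h.map f)) ∧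
  ∀ (x : C.Cell) (h : x.dim < n),
    GSet.Hom.onCell f (S.unit x h) = S'.unit (GSet.Hom.onCell f x) h

end operations

/-! ### Generators -/

namespace Diagram

/-- The simple `max(i, j)`-string diagram `∘_(i,j)`, for `i, j ≥ 1`: it has two dots of dimension
`min(i, j)` and one dot of every other dimension.  If `i ≠ j`, then the dot of dimension
`min(i, j) + 1` lies on the first dot of dimension `min(i, j)` if `i < j`, on the second one if
`j < i`. -/
def circ (i j : ℕ) (hi : 1 ≤ i) (hj : 1 ≤ j) : Diagram (max i j) where
  v m :=
    if max i j < m then [] else if m = min i j then [0, 0]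
    else if m = min i j + 1 ∧ j < i then [1] else [0]
  v_zero := by rw [if_neg (by omega), if_neg (by omega), if_neg (by omega)]
  v_lt m q hq := by
    by_cases h1 : max i j < m + 1
    · simp [h1] at hq
    · by_cases h2 : m = min i j
      · have h3 : ¬ max i j < m := by omega
        rw [if_neg h3, if_pos h2]
        rw [if_neg h1, if_neg (by omega)] at hq
        split_ifs at hq <;> simp at hq ⊢ <;> omega
      · have h3 : ¬ max i j < m := by omega
        rw [if_neg h3, if_neg h2]
        rw [if_neg h1, if_neg (show ¬(m + 1 = min i j + 1 ∧ j < i) by omega)] at hq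
        split_ifs at hq ⊢ <;> simp at hq ⊢ <;> omega
  v_top m hm := if_pos hm

/-- The simple `k`-string diagram `u_k`, for `k ≥ 1`: it has one dot of every dimension less
than `k`, and no dot of dimension `k`. -/
def unit (k : ℕ) (hk : 1 ≤ k) : Diagram k where
  v m := if k ≤ m then [] else [0]
  v_zero := if_neg (by omega)
  v_lt m q hq := by
    split_ifs at hq ⊢ <;> simp at hq ⊢ <;> omega
  v_top m hm := if_pos hm.le

end Diagram

section generators

variable {n : ℕ} {X : GSet.{u} n}

/-- The dot number `p` (counted from `0`) of dimension `|c|` of `z` is labelled by `c`. -/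
def Labelled.HasLabel {k : ℕ} (z : Labelled X k) (p : ℕ) (c : X.Cell) : Prop :=
  ∃ i : Fin (z.diag.len c.1), i.val = p ∧ z.label i = c.2

/-- `z` is the diagram `∘_(i,j)`, labelled by the cells `x` and `y` of dimensions `i` and `j` (the
labels of the other dots are iterated sources of these).  The label of the second dot of dimension
`min(i, j)` is `x` if `i ≤ j`, and that of the first one is `y` if `j ≤ i`. -/
def IsCircDiagram (x y : X.Cell) (z : (Labelled.obj X).Cell) : Prop :=
  ∃ (hx : 1 ≤ x.dim) (hy : 1 ≤ y.dim) (le : max x.dim y.dim ≤ n)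
    (f : GSet.Hom (Diagram.circ x.dim y.dim hx hy).hat X),
    z = ⟨max x.dim y.dim, ⟨le, Diagram.circ x.dim y.dim hx hy, f⟩⟩ ∧
      z.2.HasLabel (if x.dim ≤ y.dim then 1 else 0) x ∧ z.2.HasLabel 0 y

/-- `z` is the diagram `u_(i+1)`, labelled by the cell `x` of dimension `i`. -/
def IsUnitDiagram (x : X.Cell) (z : (Labelled.obj X).Cell) : Prop :=
  ∃ (le : x.dim + 1 ≤ n) (f : GSet.Hom (Diagram.unit (x.dim + 1) (Nat.le_add_left 1 _)).hat X),
    z = ⟨x.dim + 1, ⟨le, Diagram.unit (x.dim + 1) (Nat.le_add_left 1 _), f⟩⟩ ∧ z.2.HasLabel 0 x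

namespace Tree

theorem iter_src_leaf (p : ℕ) (c : X.Cell) :
    src^[p] (leaf c) = leaf (GSet.Cell.s^[p] c) := by
  induction p generalizing c with
  | zero => rfl
  | succ p ih => exact ih c.s

theorem iter_tgt_leaf (p : ℕ) (c : X.Cell) :
    tgt^[p] (leaf c) = leaf (GSet.Cell.t^[p] c) := by
  induction p generalizing c with
  | zero => rfl
  | succ p ih => exact ih c.t

theorem compat_comp_leaf {x y : X.Cell} (h : Composable x y) :
    Rel (comp (leaf x) (leaf y)) (comp (leaf x) (leaf y)) := by
  refine compat_comp_iff.2 ⟨h.1, h.2.1, .leaf _, .leaf _, ?_⟩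
  rw [sB, tB, iter_src_leaf, iter_tgt_leaf]
  exact h.2.2 ▸ .leaf _

theorem compat_unit_leaf {x : X.Cell} (h : x.dim < n) : Rel (unit (leaf x)) (unit (leaf x)) :=
  .unit h (.leaf x)

/-- The class of the tree with one internal vertex `∘_(i,j)` and with leaves `x` and `y`. -/
def circ (x y : X.Cell) (h : Composable x y) : (obj X).Cell :=
  mk (comp (leaf x) (leaf y)) (compat_comp_leaf h)

/-- The class of the tree with one internal vertex `u_(i+1)` and with the leaf `x`. -/
def unitCell (x : X.Cell) (h : x.dim < n) : (obj X).Cell := mk (unit (leaf x)) (compat_unit_leaf h)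

end Tree

end generators

/-! ### Sesquicategories -/

/-- A structure of algebra over the monad `T` on the globular set `C`. -/
structure AlgStr {n : ℕ} (T : Monad (GSet.{u} n)) (C : GSet.{u} n) where
  a : T.obj C ⟶ C
  unit : T.η.app C ≫ a = 𝟙 C
  assoc : T.μ.app C ≫ a = T.map a ≫ a

/-- The globular set `C` with a structure of algebra, as an object of the category of algebras. -/
abbrev AlgStr.algebra {n : ℕ} {T : Monad (GSet.{u} n)} {C : GSet.{u} n} (S : AlgStr T C) :
    T.Algebra where
  A := C
  a := S.a
  unit := S.unit
  assoc := S.assoc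

/-- The composite of a labelled simple string diagram in an `n`-sesquicategory, that is, in an
algebra over `T_n^(D^s)`. -/
def AlgStr.eval {n : ℕ} {C : GSet.{u} n} (S : AlgStr (sesquiMonad n) C)
    (z : (Labelled.obj C).Cell) : C.Cell :=
  GSet.Hom.onCell (X := Labelled.obj C) S.a z

/-- The action of a morphism of monads to `T_n^(D^s)` on classes of trees. -/
def interpret {n : ℕ} (φ : Tree.monad.{u} n ⟶ sesquiMonad.{u} n) (X : GSet.{u} n)
    (x : (Tree.obj X).Cell) : (Labelled.obj X).Cell :=
  GSet.Hom.onCell (X := Tree.obj X) (Y := Labelled.obj X) (φ.app X) x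

end Sesqui

open CategoryTheory Sesqui

/-! Both monads send a globular set `X` to the free globular set with operations satisfying 1–9 on
`X`, and both parts of the theorem follow formally from this. `FreeSesqui T` collects what has to be
known about a monad `T`: every `T X` carries the operations; `T f` and the multiplication preserve
them; `T X` is generated by the image of the unit (`ind`); and every structure on `C` has an
operation-preserving evaluation `T C ⟶ C` which is the identity on generators (`ev`). Generation
gives uniqueness of operation-preserving maps out of `T X` (`FreeSesqui.hom_ext`), evaluation gives
their existence. Hence two such monads are canonically isomorphic (`FreeSesqui.iso`), and algebra
structures are the same as families of operations (`FreeSesqui.equiv`): an algebra preserves formal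
operations (`a_c`, `a_u`), so it inherits the laws, and conversely an evaluation is an algebra
because both sides of the associativity axiom preserve operations and agree on generators.

For trees, freeness is close to the definition. A tree is evaluated by recursion, and an induction
over the relation shows that equivalent compatible trees have defined and equal values
(`Tree.Rel.ev_eq`).

For diagrams the work is real. Write `m + 1` for the smaller of the dimensions of `x` and `y`. In `x
∘ y` the levels up to `m` are those of `y`; from level `m + 1` on, the dots of `y` are followed by
those of `x`, and the dots of `x` on level `m + 2` are moved past the dots of `y` on level `m + 1`.
The laws are then comparisons of lists, level by level.

Generation (`Lab.gen_all`): the dots of top dimension can be split off one at a time, so one top dot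
may be assumed. Such a dot lies over a single dot of the dimension below; the dots before and after
the latter are split off as whiskerings by lower-dimensional diagrams, and repeating this downwards
leaves one dot in each dimension, which is a generator (`Lab.gen_narrow`).

Evaluation reverses this decomposition. By recursion on the dimension one defines the value
`Dots.ev` of a diagram together with `Dots.whisk`, which puts a cell, possibly of higher dimension,
in the place of one top dot and composes it with everything around it. The dots of the next
dimension are whiskered in the diagrams reached one after the other and composed; an empty list
gives a unit. To see that evaluation turns `x ∘ y` into the composite of the values, observe that
the factor of dimension `m + 1` only adds dots at the end or at the beginning of level `m + 1` of
the other one. By induction on the number of levels above, this amounts to composing with the value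
of that factor (`Dots.ev_addLast`, `Dots.ev_addFirst`): associativity is used on level `m + 1`, and
the distributivity laws 6 and 7 and the unit laws 8 and 9 above it.

Finally, labelled string diagrams correspond to their lists of labelled dots, and `sesquiMonad` is
by definition transported along this correspondence. -/

namespace Sesqui

/-! ### Iterated boundaries of cells -/

namespace GSet.Cell

variable {n : ℕ} {X : GSet.{u} n}

/-- The iterated source of dimension `p` of a cell (the cell itself, if its dimension is at
most `p`). -/
def bs (p : ℕ) (x : X.Cell) : X.Cell := s^[x.dim - p] x

/-- The iterated target of dimension `p` of a cell (the cell itself, if its dimension is at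
most `p`). -/
def bt (p : ℕ) (x : X.Cell) : X.Cell := t^[x.dim - p] x

theorem dim_s (x : X.Cell) : x.s.dim = x.dim - 1 := by
  obtain ⟨k, x⟩ := x
  cases k <;> rfl

theorem dim_t (x : X.Cell) : x.t.dim = x.dim - 1 := by
  obtain ⟨k, x⟩ := x
  cases k <;> rfl

theorem le_dim (x : X.Cell) : x.dim ≤ n := X.dim_le x.2

theorem s_t {x : X.Cell} (h : 2 ≤ x.dim) : x.t.s = x.s.s := by
  obtain ⟨k, x⟩ := x
  match k, x, h with
  | k + 2, x, _ => exact congrArg (Sigma.mk k) (X.src_tgt x)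

theorem t_s {x : X.Cell} (h : 2 ≤ x.dim) : x.s.t = x.t.t := by
  obtain ⟨k, x⟩ := x
  match k, x, h with
  | k + 2, x, _ => exact congrArg (Sigma.mk k) (X.tgt_src x)

theorem bs_of_le {p : ℕ} {x : X.Cell} (h : x.dim ≤ p) : bs p x = x := by
  rw [bs, Nat.sub_eq_zero_of_le h]; rfl

theorem bt_of_le {p : ℕ} {x : X.Cell} (h : x.dim ≤ p) : bt p x = x := by
  rw [bt, Nat.sub_eq_zero_of_le h]; rfl

theorem bs_s {p : ℕ} {x : X.Cell} (h : p < x.dim) : bs p x.s = bs p x := by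
  rw [bs, bs, dim_s, show x.dim - p = (x.dim - 1 - p) + 1 by omega]; rfl

theorem bt_t {p : ℕ} {x : X.Cell} (h : p < x.dim) : bt p x.t = bt p x := by
  rw [bt, bt, dim_t, show x.dim - p = (x.dim - 1 - p) + 1 by omega]; rfl

/-- Globularity. The bound is strict because for `x.dim = p + 1` the two sides are the target and
the source of `x`. -/
theorem bs_t {p : ℕ} {x : X.Cell} (h : p + 1 < x.dim) : bs p x.t = bs p x := by
  rw [← bs_s (by rw [dim_t]; omega), s_t (by omega), bs_s (by rw [dim_s]; omega),
    bs_s (by omega)]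

theorem bt_s {p : ℕ} {x : X.Cell} (h : p + 1 < x.dim) : bt p x.s = bt p x := by
  rw [← bt_t (by rw [dim_s]; omega), t_s (by omega), bt_t (by rw [dim_t]; omega),
    bt_t (by omega)]

theorem s_eq_bs {p : ℕ} {x : X.Cell} (h : x.dim = p + 1) : x.s = bs p x := by
  rw [← bs_s (by omega), bs_of_le (by rw [dim_s]; omega)]

theorem t_eq_bt {p : ℕ} {x : X.Cell} (h : x.dim = p + 1) : x.t = bt p x := by
  rw [← bt_t (by omega), bt_of_le (by rw [dim_t]; omega)]

/-- Induction on the codimension over `p`, with the hypothesis for the source and the target at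
once, so that one principle serves `bs`, `bt` and their mixtures. -/
theorem cell_induction {P : ℕ → X.Cell → Prop} (p : ℕ)
    (h0 : ∀ x : X.Cell, x.dim ≤ p → P p x)
    (h1 : ∀ x : X.Cell, p < x.dim → P p x.s → P p x.t → P p x) (x : X.Cell) : P p x := by
  induction hd : x.dim - p generalizing x with
  | zero => exact h0 x (by omega)
  | succ d ih =>
    exact h1 x (by omega) (ih _ (by rw [dim_s]; omega)) (ih _ (by rw [dim_t]; omega))

theorem dim_bs (p : ℕ) (x : X.Cell) : (bs p x).dim = min x.dim p := by
  refine cell_induction (P := fun p x => (bs p x).dim = min x.dim p) p ?_ ?_ x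
  · intro x h; rw [bs_of_le h]; omega
  · intro x h h1 _; rw [← bs_s h, h1, dim_s]; omega

theorem dim_bt (p : ℕ) (x : X.Cell) : (bt p x).dim = min x.dim p := by
  refine cell_induction (P := fun p x => (bt p x).dim = min x.dim p) p ?_ ?_ x
  · intro x h; rw [bt_of_le h]; omega
  · intro x h _ h1; rw [← bt_t h, h1, dim_t]; omega

theorem bs_bs {p q : ℕ} (h : p ≤ q) (x : X.Cell) : bs p (bs q x) = bs p x := by
  refine cell_induction (P := fun q x => bs p (bs q x) = bs p x) q ?_ ?_ x
  · intro x h; rw [bs_of_le h]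
  · intro x h h1 _; rw [← bs_s h, h1, bs_s (by omega)]

theorem bt_bt {p q : ℕ} (h : p ≤ q) (x : X.Cell) : bt p (bt q x) = bt p x := by
  refine cell_induction (P := fun q x => bt p (bt q x) = bt p x) q ?_ ?_ x
  · intro x h; rw [bt_of_le h]
  · intro x h _ h1; rw [← bt_t h, h1, bt_t (by omega)]

theorem bs_bt {p q : ℕ} (h : p < q) (x : X.Cell) : bs p (bt q x) = bs p x := by
  refine cell_induction (P := fun q x => bs p (bt q x) = bs p x) q ?_ ?_ x
  · intro x h; rw [bt_of_le h]
  · intro x h _ h1; rw [← bt_t h, h1, bs_t (by omega)]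

theorem bt_bs {p q : ℕ} (h : p < q) (x : X.Cell) : bt p (bs q x) = bt p x := by
  refine cell_induction (P := fun q x => bt p (bs q x) = bt p x) q ?_ ?_ x
  · intro x h; rw [bs_of_le h]
  · intro x h h1 _; rw [← bs_s h, h1, bt_s (by omega)]

theorem onCell_bs {Y : GSet.{u} n} (f : X ⟶ Y) (p : ℕ) (x : X.Cell) :
    Hom.onCell f (bs p x) = bs p (Hom.onCell f x) := onCell_iter_s f _ x

theorem onCell_bt {Y : GSet.{u} n} (f : X ⟶ Y) (p : ℕ) (x : X.Cell) :
    Hom.onCell f (bt p x) = bt p (Hom.onCell f x) := onCell_iter_t f _ x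

theorem onCell_s {Y : GSet.{u} n} (f : X ⟶ Y) (x : X.Cell) :
    Hom.onCell f x.s = (Hom.onCell f x).s := onCell_iter_s f 1 x

theorem onCell_t {Y : GSet.{u} n} (f : X ⟶ Y) (x : X.Cell) :
    Hom.onCell f x.t = (Hom.onCell f x).t := onCell_iter_t f 1 x

end GSet.Cell

open GSet GSet.Cell

section

variable {n : ℕ} {C D : GSet.{u} n}

theorem GSet.hom_ext_onCell {f g : C ⟶ D} (h : ∀ x, Hom.onCell f x = Hom.onCell g x) : f = g :=
  GSet.hom_ext fun k x => eq_of_heq (Sigma.mk.inj (h ⟨k, x⟩)).2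

theorem GSet.cell_src_inj {k : ℕ} {x y : C.cell k} (h : (⟨k, x⟩ : C.Cell) = ⟨k, y⟩) : x = y :=
  eq_of_heq (Sigma.mk.inj h).2

/-- A map of globular sets, from its action on cells of arbitrary dimension. -/
def GSet.homOfCell (g : C.Cell → D.Cell) (hd : ∀ x, (g x).dim = x.dim)
    (hs : ∀ x, 1 ≤ x.dim → g x.s = (g x).s) (ht : ∀ x, 1 ≤ x.dim → g x.t = (g x).t) : C ⟶ D :=
  -- The map `g` preserves dimensions only up to a proof, so its components need a cast. The cast
  -- disappears once the result is regarded as a cell of arbitrary dimension, where the boundary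
  -- conditions can be used.
  have key : ∀ (k : ℕ) (x : C.cell k),
      (⟨k, cast (congrArg D.cell (hd ⟨k, x⟩)) (g ⟨k, x⟩).2⟩ : D.Cell) = g ⟨k, x⟩ := by
    intro k x
    exact Sigma.ext (hd ⟨k, x⟩).symm (cast_heq _ _)
  { app := fun k x => cast (congrArg D.cell (hd ⟨k, x⟩)) (g ⟨k, x⟩).2
    map_src := fun k x => GSet.cell_src_inj <| by
      rw [key k (C.src x)]
      exact (hs ⟨k + 1, x⟩ (Nat.le_add_left 1 k)).trans (congrArg GSet.Cell.s (key (k + 1) x).symm)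
    map_tgt := fun k x => GSet.cell_src_inj <| by
      rw [key k (C.tgt x)]
      exact (ht ⟨k + 1, x⟩ (Nat.le_add_left 1 k)).trans (congrArg GSet.Cell.t (key (k + 1) x).symm) }

theorem GSet.onCell_homOfCell (g : C.Cell → D.Cell) (hd : ∀ x, (g x).dim = x.dim)
    (hs : ∀ x, 1 ≤ x.dim → g x.s = (g x).s) (ht : ∀ x, 1 ≤ x.dim → g x.t = (g x).t) (x : C.Cell) :
    Hom.onCell (GSet.homOfCell g hd hs ht) x = g x :=
  Sigma.ext (hd x).symm (cast_heq _ _)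

/-! ### Composability -/

/-- Since `i - m + 1 = i - (m - 1)`, the pullback condition compares boundaries of dimension `m -
1`. Below it is mostly used with the minimum written as `m + 1`, which removes the subtraction. -/
theorem composable_iff {x y : C.Cell} : Composable x y ↔ 1 ≤ x.dim ∧ 1 ≤ y.dim ∧
    bs (min x.dim y.dim - 1) x = bt (min x.dim y.dim - 1) y := by
  unfold Composable bs bt
  refine and_congr_right fun h1 => and_congr_right fun h2 => ?_
  rw [show x.dim - min x.dim y.dim + 1 = x.dim - (min x.dim y.dim - 1) by omega,
    show y.dim - min x.dim y.dim + 1 = y.dim - (min x.dim y.dim - 1) by omega]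

theorem Composable.of_eq {x y : C.Cell} {m : ℕ} (hm : min x.dim y.dim = m + 1)
    (h : bs m x = bt m y) : Composable x y :=
  composable_iff.2 ⟨by omega, by omega, by rw [hm]; exact h⟩

theorem Composable.eq {x y : C.Cell} (h : Composable x y) {m : ℕ} (hm : min x.dim y.dim = m + 1) :
    bs m x = bt m y := by
  have := (composable_iff.1 h).2.2
  rwa [hm] at this

theorem Composable.exists_dim {x y : C.Cell} (h : Composable x y) :
    ∃ m, min x.dim y.dim = m + 1 :=
  ⟨min x.dim y.dim - 1, by have := h.1; have := h.2.1; omega⟩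

/-- Composable cells share a cell of dimension `m` on their boundaries, and in dimensions below `m`
the boundaries of either cell are those of the shared one. -/
theorem Composable.bs_eq {x y : C.Cell} (h : Composable x y) {p : ℕ}
    (hp : p + 1 < min x.dim y.dim) : bs p x = bs p y := by
  obtain ⟨m, hm⟩ := h.exists_dim
  rw [← bs_bs (q := m) (by omega), h.eq hm, bs_bt (by omega)]

theorem Composable.bt_eq {x y : C.Cell} (h : Composable x y) {p : ℕ}
    (hp : p + 1 < min x.dim y.dim) : bt p x = bt p y := by
  obtain ⟨m, hm⟩ := h.exists_dim
  rw [← bt_bs (q := m) (by omega), h.eq hm, bt_bt (by omega)]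

theorem Composable.s_left {x y : C.Cell} (h : Composable x y) (hd : y.dim < x.dim) :
    Composable x.s y := by
  obtain ⟨m, hm⟩ := h.exists_dim
  have := dim_s x
  refine .of_eq (m := m) (by omega) ?_
  rw [bs_s (by omega), h.eq hm]

theorem Composable.t_left {x y : C.Cell} (h : Composable x y) (hd : y.dim < x.dim) :
    Composable x.t y := by
  obtain ⟨m, hm⟩ := h.exists_dim
  have := dim_t x
  refine .of_eq (m := m) (by omega) ?_
  rw [bs_t (by omega), h.eq hm]

theorem Composable.s_right {x y : C.Cell} (h : Composable x y) (hd : x.dim < y.dim) :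
    Composable x y.s := by
  obtain ⟨m, hm⟩ := h.exists_dim
  have := dim_s y
  refine .of_eq (m := m) (by omega) ?_
  rw [bt_s (by omega), h.eq hm]

theorem Composable.t_right {x y : C.Cell} (h : Composable x y) (hd : x.dim < y.dim) :
    Composable x y.t := by
  obtain ⟨m, hm⟩ := h.exists_dim
  have := dim_t y
  refine .of_eq (m := m) (by omega) ?_
  rw [bt_t (by omega), h.eq hm]

end

/-! ### Operations, extended to all cells -/

namespace SesquiStr

variable {n : ℕ} {C D : GSet.{u} n} (S : SesquiStr C)

open Classical in
/-- The composition, extended to all pairs of cells. -/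
noncomputable def c (x y : C.Cell) : C.Cell := if h : Composable x y then S.comp x y h else x

/-- The unit, extended to all cells. -/
def u (x : C.Cell) : C.Cell := if h : x.dim < n then S.unit x h else x

variable {S} {x y z : C.Cell}

/-- Off its domain `c` has a junk value. Being total, it allows rewriting in the arguments without
transporting proofs of composability; the laws below are therefore restated for `c` and `u`. -/
theorem c_eq (h : Composable x y) : S.c x y = S.comp x y h := dif_pos h

theorem u_eq (h : x.dim < n) : S.u x = S.unit x h := dif_pos h

theorem dim_c (h : Composable x y) : (S.c x y).dim = max x.dim y.dim := by
  rw [c_eq h, S.dim_comp]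

theorem dim_u (h : x.dim < n) : (S.u x).dim = x.dim + 1 := by rw [u_eq h, S.dim_unit]

theorem s_u (h : x.dim < n) : (S.u x).s = x := by rw [u_eq h, S.s_unit]

theorem t_u (h : x.dim < n) : (S.u x).t = x := by rw [u_eq h, S.t_unit]

theorem s_c_gt (h : Composable x y) (hd : y.dim < x.dim) : (S.c x y).s = S.c x.s y := by
  rw [c_eq h, c_eq (h.s_left hd), S.s_comp_of_gt _ _ _ _ hd]

theorem t_c_gt (h : Composable x y) (hd : y.dim < x.dim) : (S.c x y).t = S.c x.t y := by
  rw [c_eq h, c_eq (h.t_left hd), S.t_comp_of_gt _ _ _ _ hd]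

theorem s_c_lt (h : Composable x y) (hd : x.dim < y.dim) : (S.c x y).s = S.c x y.s := by
  rw [c_eq h, c_eq (h.s_right hd), S.s_comp_of_lt _ _ _ _ hd]

theorem t_c_lt (h : Composable x y) (hd : x.dim < y.dim) : (S.c x y).t = S.c x y.t := by
  rw [c_eq h, c_eq (h.t_right hd), S.t_comp_of_lt _ _ _ _ hd]

theorem s_c_eq (h : Composable x y) (hd : x.dim = y.dim) : (S.c x y).s = y.s := by
  rw [c_eq h, S.s_comp_of_eq _ _ _ hd]

theorem t_c_eq (h : Composable x y) (hd : x.dim = y.dim) : (S.c x y).t = x.t := by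
  rw [c_eq h, S.t_comp_of_eq _ _ _ hd]

/-- By laws 1 and 2, taking a source lowers the longer factor until the dimensions agree, and then
law 3 keeps only the source of `y`. Hence the induction on the sum of the dimensions. -/
theorem bs_c_lt (h : Composable x y) {p : ℕ} (hp : p < min x.dim y.dim) :
    bs p (S.c x y) = bs p y := by
  induction hd : x.dim + y.dim using Nat.strong_induction_on generalizing x y with
  | _ d ih =>
    have hc := dim_c (S := S) h
    have hx := dim_s x
    have hy := dim_s y
    rw [← bs_s (by omega)]
    rcases lt_trichotomy x.dim y.dim with hxy | hxy | hxy
    · rw [s_c_lt h hxy, ih _ (by omega) (h.s_right hxy) (by omega) rfl, bs_s (by omega)]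
    · rw [s_c_eq h hxy, bs_s (by omega)]
    · rw [s_c_gt h hxy, ih _ (by omega) (h.s_left hxy) (by omega) rfl]

theorem bt_c_lt (h : Composable x y) {p : ℕ} (hp : p < min x.dim y.dim) :
    bt p (S.c x y) = bt p x := by
  induction hd : x.dim + y.dim using Nat.strong_induction_on generalizing x y with
  | _ d ih =>
    have hc := dim_c (S := S) h
    have hx := dim_t x
    have hy := dim_t y
    rw [← bt_t (by omega)]
    rcases lt_trichotomy x.dim y.dim with hxy | hxy | hxy
    · rw [t_c_lt h hxy, ih _ (by omega) (h.t_right hxy) (by omega) rfl]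
    · rw [t_c_eq h hxy, bt_t (by omega)]
    · rw [t_c_gt h hxy, ih _ (by omega) (h.t_left hxy) (by omega) rfl, bt_t (by omega)]

/-- Law 2 iterated: down to the dimension of `x`, whiskering by `x` commutes with boundaries.
Composability of the result is recorded as well, since the total operation `c` does not reveal it.
-/
theorem bs_c_right (h : Composable x y) {p : ℕ} (hp : x.dim ≤ p) :
    bs p (S.c x y) = S.c x (bs p y) ∧ Composable x (bs p y) := by
  induction hd : y.dim generalizing x y with
  | zero => rw [bs_of_le (by rw [dim_c h]; omega), bs_of_le (by omega)]; exact ⟨rfl, h⟩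
  | succ d ih =>
    have hc := dim_c (S := S) h
    have hy := dim_s y
    by_cases hyp : y.dim ≤ p
    · rw [bs_of_le (by omega), bs_of_le (by omega)]; exact ⟨rfl, h⟩
    · rw [← bs_s (by omega), s_c_lt h (by omega), ← bs_s (x := y) (by omega)]
      exact ih (h.s_right (by omega)) hp (by omega)

theorem bt_c_right (h : Composable x y) {p : ℕ} (hp : x.dim ≤ p) :
    bt p (S.c x y) = S.c x (bt p y) ∧ Composable x (bt p y) := by
  induction hd : y.dim generalizing x y with
  | zero => rw [bt_of_le (by rw [dim_c h]; omega), bt_of_le (by omega)]; exact ⟨rfl, h⟩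
  | succ d ih =>
    have hc := dim_c (S := S) h
    have hy := dim_t y
    by_cases hyp : y.dim ≤ p
    · rw [bt_of_le (by omega), bt_of_le (by omega)]; exact ⟨rfl, h⟩
    · rw [← bt_t (by omega), t_c_lt h (by omega), ← bt_t (x := y) (by omega)]
      exact ih (h.t_right (by omega)) hp (by omega)

theorem bs_c_left (h : Composable x y) {p : ℕ} (hp : y.dim ≤ p) :
    bs p (S.c x y) = S.c (bs p x) y ∧ Composable (bs p x) y := by
  induction hd : x.dim generalizing x y with
  | zero => rw [bs_of_le (by rw [dim_c h]; omega), bs_of_le (by omega)]; exact ⟨rfl, h⟩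
  | succ d ih =>
    have hc := dim_c (S := S) h
    have hx := dim_s x
    by_cases hxp : x.dim ≤ p
    · rw [bs_of_le (by omega), bs_of_le (by omega)]; exact ⟨rfl, h⟩
    · rw [← bs_s (by omega), s_c_gt h (by omega), ← bs_s (x := x) (by omega)]
      exact ih (h.s_left (by omega)) hp (by omega)

theorem bt_c_left (h : Composable x y) {p : ℕ} (hp : y.dim ≤ p) :
    bt p (S.c x y) = S.c (bt p x) y ∧ Composable (bt p x) y := by
  induction hd : x.dim generalizing x y with
  | zero => rw [bt_of_le (by rw [dim_c h]; omega), bt_of_le (by omega)]; exact ⟨rfl, h⟩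
  | succ d ih =>
    have hc := dim_c (S := S) h
    have hx := dim_t x
    by_cases hxp : x.dim ≤ p
    · rw [bt_of_le (by omega), bt_of_le (by omega)]; exact ⟨rfl, h⟩
    · rw [← bt_t (by omega), t_c_gt h (by omega), ← bt_t (x := x) (by omega)]
      exact ih (h.t_left (by omega)) hp (by omega)

/-- The condition that the two smallest dimensions agree guarantees two things: the dimension in
which `y` and `z` meet lies below both `|x|` and `|y|`, so that the source of `x ∘ y` there is that
of `y`; and `x ∘ y` meets `z` in that same dimension. -/
theorem composable_c_left (hxy : Composable x y) (hyz : Composable y z)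
    (hd : (x.dim = y.dim ∧ x.dim ≤ z.dim) ∨ (x.dim = z.dim ∧ x.dim ≤ y.dim) ∨
      (y.dim = z.dim ∧ y.dim ≤ x.dim)) : Composable (S.c x y) z := by
  obtain ⟨m, hm⟩ := hyz.exists_dim
  have := dim_c (S := S) hxy
  have := hxy.1
  refine .of_eq (m := m) (by omega) ?_
  rw [bs_c_lt hxy (by omega), hyz.eq hm]

theorem composable_c_right (hxy : Composable x y) (hyz : Composable y z)
    (hd : (x.dim = y.dim ∧ x.dim ≤ z.dim) ∨ (x.dim = z.dim ∧ x.dim ≤ y.dim) ∨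
      (y.dim = z.dim ∧ y.dim ≤ x.dim)) : Composable x (S.c y z) := by
  obtain ⟨m, hm⟩ := hxy.exists_dim
  have := dim_c (S := S) hyz
  have := hyz.2.1
  refine .of_eq (m := m) (by omega) ?_
  rw [bt_c_lt hyz (by omega), hxy.eq hm]

theorem c_assoc (hxy : Composable x y) (hyz : Composable y z)
    (hd : (x.dim = y.dim ∧ x.dim ≤ z.dim) ∨ (x.dim = z.dim ∧ x.dim ≤ y.dim) ∨
      (y.dim = z.dim ∧ y.dim ≤ x.dim)) : S.c (S.c x y) z = S.c x (S.c y z) := by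
  have h1 := composable_c_left (S := S) hxy hyz hd
  have h2 := composable_c_right (S := S) hxy hyz hd
  rw [c_eq hxy] at h1 ⊢
  rw [c_eq hyz] at h2 ⊢
  rw [c_eq h1, c_eq h2, S.assoc _ _ _ _ _ _ _ hd]

/-- The cells `y` and `z` meet in a dimension above that in which `x` meets `y`, so they have the
same target there. -/
theorem composable_whisker_left (hyz : Composable y z) (hxy : Composable x y)
    (h1 : x.dim < y.dim) (h2 : x.dim < z.dim) : Composable x z := by
  obtain ⟨m, hm⟩ := hxy.exists_dim
  refine .of_eq (m := m) (by omega) ?_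
  rw [hxy.eq hm, hyz.bt_eq (by omega)]

theorem composable_whisker_left' (hyz : Composable y z) (hxy : Composable x y)
    (h1 : x.dim < y.dim) (h2 : x.dim < z.dim) : Composable x (S.c y z) := by
  obtain ⟨m, hm⟩ := hxy.exists_dim
  have := dim_c (S := S) hyz
  refine .of_eq (m := m) (by omega) ?_
  rw [hxy.eq hm, bt_c_lt hyz (by omega)]

/-- The dimension in which `y` and `z` meet is at least `|x|`, so whiskering by `x` commutes with
the boundaries to be compared. -/
theorem composable_c_c_left (hyz : Composable y z) (hxy : Composable x y)
    (h1 : x.dim < y.dim) (h2 : x.dim < z.dim) : Composable (S.c x y) (S.c x z) := by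
  have hxz := composable_whisker_left hyz hxy h1 h2
  obtain ⟨m, hm⟩ := hyz.exists_dim
  have := dim_c (S := S) hxy
  have := dim_c (S := S) hxz
  refine .of_eq (m := m) (by omega) ?_
  rw [(bs_c_right hxy (by omega)).1, (bt_c_right hxz (by omega)).1, hyz.eq hm]

theorem c_c_left (hyz : Composable y z) (hxy : Composable x y)
    (h1 : x.dim < y.dim) (h2 : x.dim < z.dim) :
    S.c x (S.c y z) = S.c (S.c x y) (S.c x z) := by
  have hxz := composable_whisker_left hyz hxy h1 h2
  have k1 := composable_c_c_left (S := S) hyz hxy h1 h2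
  have k2 := composable_whisker_left' (S := S) hyz hxy h1 h2
  rw [c_eq hyz] at k2 ⊢
  rw [c_eq hxy, c_eq hxz] at k1 ⊢
  rw [c_eq k1, c_eq k2, S.comp_comp_left _ _ _ _ _ _ _ _ h1 h2]

theorem composable_whisker_right (hxy : Composable x y) (hyz : Composable y z)
    (h1 : z.dim < x.dim) (h2 : z.dim < y.dim) : Composable x z := by
  obtain ⟨m, hm⟩ := hyz.exists_dim
  refine .of_eq (m := m) (by omega) ?_
  rw [← hyz.eq hm, hxy.bs_eq (by omega)]

theorem composable_whisker_right' (hxy : Composable x y) (hyz : Composable y z)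
    (h1 : z.dim < x.dim) (h2 : z.dim < y.dim) : Composable (S.c x y) z := by
  obtain ⟨m, hm⟩ := hyz.exists_dim
  have := dim_c (S := S) hxy
  refine .of_eq (m := m) (by omega) ?_
  rw [← hyz.eq hm, bs_c_lt hxy (by omega)]

theorem composable_c_c_right (hxy : Composable x y) (hyz : Composable y z)
    (h1 : z.dim < x.dim) (h2 : z.dim < y.dim) : Composable (S.c x z) (S.c y z) := by
  have hxz := composable_whisker_right hxy hyz h1 h2
  obtain ⟨m, hm⟩ := hxy.exists_dim
  have := dim_c (S := S) hyz
  have := dim_c (S := S) hxz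
  refine .of_eq (m := m) (by omega) ?_
  rw [(bs_c_left hxz (by omega)).1, (bt_c_left hyz (by omega)).1, hxy.eq hm]

theorem c_c_right (hxy : Composable x y) (hyz : Composable y z)
    (h1 : z.dim < x.dim) (h2 : z.dim < y.dim) :
    S.c (S.c x y) z = S.c (S.c x z) (S.c y z) := by
  have hxz := composable_whisker_right hxy hyz h1 h2
  have k1 := composable_c_c_right (S := S) hxy hyz h1 h2
  have k2 := composable_whisker_right' (S := S) hxy hyz h1 h2
  rw [c_eq hxy] at k2 ⊢
  rw [c_eq hxz, c_eq hyz] at k1 ⊢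
  rw [c_eq k1, c_eq k2, S.comp_comp_right _ _ _ _ _ _ _ _ h1 h2]

/-- Because `x` is the source of `u x`, composability means that `x` is the target of `y` in
dimension `|x|`. This form of the hypothesis does not mention the unit and is preserved by maps of
globular sets. -/
theorem composable_u_left (hx : x.dim < n) (hy : x.dim < y.dim) (h : x = bt x.dim y) :
    Composable (S.u x) y := by
  have hd := dim_u (S := S) hx
  refine .of_eq (m := x.dim) (by omega) ?_
  rw [← bs_s (by omega), s_u hx, bs_of_le le_rfl]; exact h

theorem u_c_lt (hx : x.dim < n) (hy : x.dim < y.dim) (h : x = bt x.dim y) :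
    S.c (S.u x) y = y := by
  have k := composable_u_left (S := S) hx hy h
  rw [u_eq hx] at k ⊢
  rw [c_eq k, S.unit_comp_of_lt _ _ _ _ hy]

theorem composable_u_right (hy : y.dim < n) (hx : y.dim < x.dim) (h : bs y.dim x = y) :
    Composable x (S.u y) := by
  have hd := dim_u (S := S) hy
  refine .of_eq (m := y.dim) (by omega) ?_
  rw [← bt_t (x := S.u y) (by omega), t_u hy, bt_of_le le_rfl]; exact h

theorem c_u_lt (hy : y.dim < n) (hx : y.dim < x.dim) (h : bs y.dim x = y) :
    S.c x (S.u y) = x := by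
  have k := composable_u_right (S := S) hy hx h
  rw [u_eq hy] at k ⊢
  rw [c_eq k, S.comp_unit_of_lt _ _ _ _ hx]

theorem composable_u_left' (hx : x.dim < n) (hxy : Composable x y) (hd : y.dim ≤ x.dim) :
    Composable (S.u x) y := by
  have := dim_u (S := S) hx
  obtain ⟨m, hm⟩ := hxy.exists_dim
  refine .of_eq (m := m) (by omega) ?_
  rw [← bs_s (by omega), s_u hx, hxy.eq hm]

theorem u_c_le (hx : x.dim < n) (hxy : Composable x y) (hd : y.dim ≤ x.dim) :
    S.c (S.u x) y = S.u (S.c x y) := by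
  have k := composable_u_left' (S := S) hx hxy hd
  have hu : (S.c x y).dim < n := by rw [dim_c hxy]; omega
  rw [u_eq hx] at k ⊢
  rw [c_eq k, u_eq hu]
  rw [S.unit_comp_of_le _ _ _ _ hxy (by rw [← c_eq hxy]; exact hu) hd]
  congr 1
  rw [c_eq hxy]

theorem composable_u_right' (hy : y.dim < n) (hxy : Composable x y) (hd : x.dim ≤ y.dim) :
    Composable x (S.u y) := by
  have := dim_u (S := S) hy
  obtain ⟨m, hm⟩ := hxy.exists_dim
  refine .of_eq (m := m) (by omega) ?_
  rw [← bt_t (x := S.u y) (by omega), t_u hy, hxy.eq hm]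

theorem c_u_le (hy : y.dim < n) (hxy : Composable x y) (hd : x.dim ≤ y.dim) :
    S.c x (S.u y) = S.u (S.c x y) := by
  have k := composable_u_right' (S := S) hy hxy hd
  have hu : (S.c x y).dim < n := by rw [dim_c hxy]; omega
  rw [u_eq hy] at k ⊢
  rw [c_eq k, u_eq hu]
  rw [S.comp_unit_of_le _ _ _ _ hxy (by rw [← c_eq hxy]; exact hu) hd]
  congr 1
  rw [c_eq hxy]

theorem Preserves.map_c {S' : SesquiStr D} {f : C ⟶ D} (hf : S.Preserves S' f)
    (h : Composable x y) :
    Hom.onCell f (S.c x y) = S'.c (Hom.onCell f x) (Hom.onCell f y) := by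
  rw [c_eq h, c_eq (h.map f), hf.1]

theorem Preserves.map_u {S' : SesquiStr D} {f : C ⟶ D} (hf : S.Preserves S' f)
    (h : x.dim < n) : Hom.onCell f (S.u x) = S'.u (Hom.onCell f x) := by
  have h' : (Hom.onCell f x).dim < n := h
  rw [u_eq h, u_eq h', hf.2]

theorem preserves_iff {S' : SesquiStr D} {f : C ⟶ D} : S.Preserves S' f ↔
    (∀ x y, Composable x y → Hom.onCell f (S.c x y) = S'.c (Hom.onCell f x) (Hom.onCell f y)) ∧
      ∀ x, x.dim < n → Hom.onCell f (S.u x) = S'.u (Hom.onCell f x) := by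
  constructor
  · exact fun hf => ⟨fun x y h => hf.map_c h, fun x h => hf.map_u h⟩
  · rintro ⟨h1, h2⟩
    refine ⟨fun x y h => ?_, fun x h => ?_⟩
    · have := h1 x y h
      rwa [c_eq h, c_eq (h.map f)] at this
    · have h' : (Hom.onCell f x).dim < n := h
      have := h2 x h
      rwa [u_eq h, u_eq h'] at this

theorem Preserves.comp {E : GSet.{u} n} {S' : SesquiStr D} {S'' : SesquiStr E} {f : C ⟶ D}
    {g : D ⟶ E} (hf : S.Preserves S' f) (hg : S'.Preserves S'' g) :
    S.Preserves S'' (f ≫ g) :=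
  ⟨fun x y h => (congrArg (Hom.onCell g) (hf.1 x y h)).trans (hg.1 _ _ _),
    fun x h => (congrArg (Hom.onCell g) (hf.2 x h)).trans (hg.2 _ _)⟩

theorem preserves_id : S.Preserves S (𝟙 C) := ⟨fun _ _ _ => rfl, fun _ _ => rfl⟩

theorem ext_ops {S' : SesquiStr C} (h1 : ∀ x y h, S.comp x y h = S'.comp x y h)
    (h2 : ∀ x h, S.unit x h = S'.unit x h) : S = S' := by
  have e1 : S.comp = S'.comp := by funext x y h; exact h1 x y h
  have e2 : S.unit = S'.unit := by funext x h; exact h2 x h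
  cases S
  cases S'
  simp only at e1 e2
  subst e1 e2
  rfl

end SesquiStr

end Sesqui

namespace Sesqui

open GSet GSet.Cell

/-! ### Monads of free structures -/

/-- The monad `T` sends every globular set to the free globular set with operations. -/
structure FreeSesqui {n : ℕ} (T : Monad (GSet.{u} n)) where
  str : ∀ X : GSet.{u} n, SesquiStr (T.obj X)
  pure : ∀ X : GSet.{u} n, X ⟶ T.obj X
  pure_eq : ∀ X, pure X = T.η.app X
  map_preserves : ∀ {X Y : GSet.{u} n} (f : X ⟶ Y), (str X).Preserves (str Y) (T.map f)
  mu_preserves : ∀ X : GSet.{u} n, (str (T.obj X)).Preserves (str X) (T.μ.app X)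
  ind : ∀ (X : GSet.{u} n) (p : (T.obj X).Cell → Prop), (∀ x, p (Hom.onCell (pure X) x)) →
    (∀ x y h, p x → p y → p ((str X).comp x y h)) → (∀ x h, p x → p ((str X).unit x h)) → ∀ x, p x
  ev : ∀ {C : GSet.{u} n}, SesquiStr C → (T.obj C ⟶ C)
  ev_preserves : ∀ {C : GSet.{u} n} (S : SesquiStr C), (str C).Preserves S (ev S)
  pure_ev : ∀ {C : GSet.{u} n} (S : SesquiStr C), pure C ≫ ev S = 𝟙 C

namespace FreeSesqui

variable {n : ℕ} {T T' : Monad (GSet.{u} n)} (F : FreeSesqui T) (F' : FreeSesqui T')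
variable {X Y C D : GSet.{u} n}

/-- Uniqueness in the universal property: the cells on which two operation-preserving maps agree are
closed under the operations and contain the generators. -/
theorem hom_ext (S : SesquiStr C) {f g : T.obj X ⟶ C} (hf : (F.str X).Preserves S f)
    (hg : (F.str X).Preserves S g) (h : F.pure X ≫ f = F.pure X ≫ g) : f = g := by
  apply GSet.hom_ext_onCell
  refine F.ind X _ ?_ ?_ ?_
  · intro x
    exact congrArg (fun k : X ⟶ C => Hom.onCell k x) h
  · intro x y h hx hy
    rw [hf.1, hg.1]
    congr 1
  · intro x h hx
    rw [hf.2, hg.2]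
    congr 1

theorem pure_map (f : X ⟶ Y) : F.pure X ≫ T.map f = f ≫ F.pure Y := by
  rw [F.pure_eq, F.pure_eq]
  exact (T.η.naturality f).symm

theorem pure_mu (X : GSet.{u} n) : F.pure (T.obj X) ≫ T.μ.app X = 𝟙 _ := by
  rw [F.pure_eq]; exact T.left_unit X

/-- The evaluation of formal composites is an algebra. -/
def algStr (S : SesquiStr C) : AlgStr T C where
  a := F.ev S
  unit := by rw [← F.pure_eq]; exact F.pure_ev S
  assoc := by
    -- Both sides preserve operations, so the axiom need only be checked on the generators of `T (T
    -- C)`, where it follows from the unit laws.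
    refine F.hom_ext S ((F.mu_preserves C).comp (F.ev_preserves S))
      ((F.map_preserves _).comp (F.ev_preserves S)) ?_
    rw [← Category.assoc, pure_mu, Category.id_comp, ← Category.assoc, pure_map,
      Category.assoc, F.pure_ev, Category.comp_id]

theorem pure_a (A : AlgStr T C) : F.pure C ≫ A.a = 𝟙 C := by
  rw [F.pure_eq]; exact A.unit

theorem a_pure (A : AlgStr T C) (x : C.Cell) :
    Hom.onCell A.a (Hom.onCell (F.pure C) x) = x :=
  congrArg (fun k : C ⟶ C => Hom.onCell k x) (F.pure_a A)

theorem pure_map_cell (f : X ⟶ Y) (x : X.Cell) :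
    Hom.onCell (T.map f) (Hom.onCell (F.pure X) x) = Hom.onCell (F.pure Y) (Hom.onCell f x) :=
  congrArg (fun k : X ⟶ T.obj Y => Hom.onCell k x) (F.pure_map f)

theorem pure_mu_cell (x : (T.obj X).Cell) :
    Hom.onCell (T.μ.app X) (Hom.onCell (F.pure (T.obj X)) x) = x :=
  congrArg (fun k : T.obj X ⟶ T.obj X => Hom.onCell k x) (F.pure_mu X)

theorem assoc_cell (A : AlgStr T C) (x : (T.obj (T.obj C)).Cell) :
    Hom.onCell A.a (Hom.onCell (T.μ.app C) x) = Hom.onCell A.a (Hom.onCell (T.map A.a) x) :=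
  congrArg (fun k : T.obj (T.obj C) ⟶ C => Hom.onCell k x) A.assoc

/-- The binary operation of an algebra. -/
noncomputable def cA (A : AlgStr T C) (x y : C.Cell) : C.Cell :=
  Hom.onCell A.a ((F.str C).c (Hom.onCell (F.pure C) x) (Hom.onCell (F.pure C) y))

/-- The unary operation of an algebra. -/
def uA (A : AlgStr T C) (x : C.Cell) : C.Cell :=
  Hom.onCell A.a ((F.str C).u (Hom.onCell (F.pure C) x))

/-- Apply the associativity axiom to the formal composite, in `T (T C)`, of the generators `P` and
`Q`. The multiplication sends it to the composite of `P` and `Q` in `T C`, and `T a` sends it to the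
formal composite of the generators `a P` and `a Q`. -/
theorem a_c (A : AlgStr T C) {P Q : (T.obj C).Cell} (h : Composable P Q) :
    Hom.onCell A.a ((F.str C).c P Q) = F.cA A (Hom.onCell A.a P) (Hom.onCell A.a Q) := by
  have h1 := h.map (F.pure (T.obj C))
  have := assoc_cell A ((F.str (T.obj C)).c (Hom.onCell (F.pure _) P) (Hom.onCell (F.pure _) Q))
  rw [(F.mu_preserves C).map_c h1, pure_mu_cell, pure_mu_cell,
    (F.map_preserves A.a).map_c h1, pure_map_cell, pure_map_cell] at this
  exact this

theorem a_u (A : AlgStr T C) {P : (T.obj C).Cell} (h : P.dim < n) :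
    Hom.onCell A.a ((F.str C).u P) = F.uA A (Hom.onCell A.a P) := by
  have h1 : (Hom.onCell (F.pure (T.obj C)) P).dim < n := h
  have := assoc_cell A ((F.str (T.obj C)).u (Hom.onCell (F.pure _) P))
  rw [(F.mu_preserves C).map_u h1, pure_mu_cell,
    (F.map_preserves A.a).map_u h1, pure_map_cell] at this
  exact this

variable {A : AlgStr T C} {x y z : C.Cell}

theorem dim_uA (h : x.dim < n) : (F.uA A x).dim = x.dim + 1 :=
  SesquiStr.dim_u (S := F.str C) (x := Hom.onCell (F.pure C) x) h

theorem dim_cA (h : Composable x y) : (F.cA A x y).dim = max x.dim y.dim :=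
  SesquiStr.dim_c (S := F.str C) (h.map (F.pure C))

theorem s_uA (h : x.dim < n) : (F.uA A x).s = x := by
  rw [uA, ← onCell_s, SesquiStr.s_u (x := Hom.onCell (F.pure C) x) h, a_pure]

theorem t_uA (h : x.dim < n) : (F.uA A x).t = x := by
  rw [uA, ← onCell_t, SesquiStr.t_u (x := Hom.onCell (F.pure C) x) h, a_pure]

theorem cA_cA_left (hxy : Composable x y)
    (h : Composable ((F.str C).c (Hom.onCell (F.pure C) x) (Hom.onCell (F.pure C) y))
      (Hom.onCell (F.pure C) z)) :
    F.cA A (F.cA A x y) z = Hom.onCell A.a ((F.str C).c ((F.str C).c (Hom.onCell (F.pure C) x)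
      (Hom.onCell (F.pure C) y)) (Hom.onCell (F.pure C) z)) := by
  rw [a_c _ _ h, a_c _ _ (hxy.map _), a_pure, a_pure, a_pure]

theorem cA_cA_right (hyz : Composable y z)
    (h : Composable (Hom.onCell (F.pure C) x) ((F.str C).c (Hom.onCell (F.pure C) y)
      (Hom.onCell (F.pure C) z))) :
    F.cA A x (F.cA A y z) = Hom.onCell A.a ((F.str C).c (Hom.onCell (F.pure C) x)
      ((F.str C).c (Hom.onCell (F.pure C) y) (Hom.onCell (F.pure C) z))) := by
  rw [a_c _ _ h, a_c _ _ (hyz.map _), a_pure, a_pure, a_pure]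

theorem dim_pure_lt (h : x.dim < y.dim) :
    (Hom.onCell (F.pure C) x).dim < (Hom.onCell (F.pure C) y).dim := h

theorem dim_pure_gt (h : y.dim < x.dim) :
    (Hom.onCell (F.pure C) y).dim < (Hom.onCell (F.pure C) x).dim := h

theorem dim_pure_eq (h : x.dim = y.dim) :
    (Hom.onCell (F.pure C) x).dim = (Hom.onCell (F.pure C) y).dim := h

/-- The operations of an algebra. -/
noncomputable def ops (A : AlgStr T C) : SesquiStr C where
  comp x y _ := F.cA A x y
  unit x _ := F.uA A x
  dim_comp x y h := F.dim_cA h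
  dim_unit x h := F.dim_uA h
  s_comp_of_gt x y h h' hd := by
    rw [cA, ← onCell_s, SesquiStr.s_c_gt (h.map (F.pure C)) (F.dim_pure_gt hd), ← onCell_s]; rfl
  t_comp_of_gt x y h h' hd := by
    rw [cA, ← onCell_t, SesquiStr.t_c_gt (h.map (F.pure C)) (F.dim_pure_gt hd), ← onCell_t]; rfl
  s_comp_of_lt x y h h' hd := by
    rw [cA, ← onCell_s, SesquiStr.s_c_lt (h.map (F.pure C)) (F.dim_pure_lt hd), ← onCell_s]; rfl
  t_comp_of_lt x y h h' hd := by
    rw [cA, ← onCell_t, SesquiStr.t_c_lt (h.map (F.pure C)) (F.dim_pure_lt hd), ← onCell_t]; rfl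
  s_comp_of_eq x y h hd := by
    rw [cA, ← onCell_s, SesquiStr.s_c_eq (h.map (F.pure C)) (F.dim_pure_eq hd), ← onCell_s, a_pure]
  t_comp_of_eq x y h hd := by
    rw [cA, ← onCell_t, SesquiStr.t_c_eq (h.map (F.pure C)) (F.dim_pure_eq hd), ← onCell_t, a_pure]
  s_unit x h := F.s_uA h
  t_unit x h := F.t_uA h
  -- By `a_c`, iterated operations of the algebra are the images under `A.a` of iterated composites
  -- of generators, for which the law holds in `T C`. The other laws are obtained in the same way.
  assoc x y z hxy h hyz h' hd := by
    rw [F.cA_cA_left hxy (SesquiStr.composable_c_left (hxy.map _) (hyz.map _) hd),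
      F.cA_cA_right hyz (SesquiStr.composable_c_right (hxy.map _) (hyz.map _) hd),
      SesquiStr.c_assoc (hxy.map (F.pure C)) (hyz.map (F.pure C)) hd]
  comp_comp_left x y z hyz h hxy hxz h' h1 h2 := by
    have k1 := hyz.map (F.pure C)
    have k2 := hxy.map (F.pure C)
    rw [F.cA_cA_right hyz (SesquiStr.composable_whisker_left' k1 k2 h1 h2),
      SesquiStr.c_c_left k1 k2 h1 h2, a_c _ _ (SesquiStr.composable_c_c_left k1 k2 h1 h2)]
    rfl
  comp_comp_right x y z hxy h hxz hyz h' h1 h2 := by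
    have k1 := hxy.map (F.pure C)
    have k2 := hyz.map (F.pure C)
    rw [F.cA_cA_left hxy (SesquiStr.composable_whisker_right' k1 k2 h1 h2),
      SesquiStr.c_c_right k1 k2 h1 h2, a_c _ _ (SesquiStr.composable_c_c_right k1 k2 h1 h2)]
    rfl
  unit_comp_of_lt x y hx h hd := by
    have hu := F.dim_uA (A := A) hx
    -- Composability of the unit on `x` with `y` unwinds to the statement that `x` is a target of
    -- `y`; this equation can be mapped to `T C`.
    have e := h.eq (m := x.dim) (by omega)
    rw [← bs_s (by omega), F.s_uA hx, bs_of_le le_rfl] at e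
    have e' := congrArg (Hom.onCell (F.pure C)) e
    rw [onCell_bt] at e'
    have k := SesquiStr.composable_u_left (S := F.str C)
      (x := Hom.onCell (F.pure C) x) hx (F.dim_pure_lt hd) e'
    have := F.a_c A k
    rw [SesquiStr.u_c_lt (x := Hom.onCell (F.pure C) x) hx (F.dim_pure_lt hd) e', a_pure] at this
    exact this.symm
  unit_comp_of_le x y hx h hxy hu hd := by
    have k := hxy.map (F.pure C)
    have k' := SesquiStr.composable_u_left' (S := F.str C) (x := Hom.onCell (F.pure C) x) hx k hd
    have := F.a_c A k'
    rw [SesquiStr.u_c_le (x := Hom.onCell (F.pure C) x) hx k hd, a_pure,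
      a_u _ _ (by rw [SesquiStr.dim_c k]; exact (F.dim_cA hxy).symm.trans_lt hu)] at this
    exact this.symm
  comp_unit_of_lt x y hy h hd := by
    have hu := F.dim_uA (A := A) hy
    have e := h.eq (m := y.dim) (by omega)
    rw [← bt_t (x := F.uA A y) (by omega), F.t_uA hy, bt_of_le (x := y) le_rfl] at e
    have e' := congrArg (Hom.onCell (F.pure C)) e
    rw [onCell_bs] at e'
    have k := SesquiStr.composable_u_right (S := F.str C)
      (y := Hom.onCell (F.pure C) y) hy (F.dim_pure_lt hd) e'
    have := F.a_c A k
    rw [SesquiStr.c_u_lt (y := Hom.onCell (F.pure C) y) hy (F.dim_pure_lt hd) e', a_pure] at this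
    exact this.symm
  comp_unit_of_le x y hy h hxy hu hd := by
    have k := hxy.map (F.pure C)
    have k' := SesquiStr.composable_u_right' (S := F.str C) (y := Hom.onCell (F.pure C) y) hy k hd
    have := F.a_c A k'
    rw [SesquiStr.c_u_le (y := Hom.onCell (F.pure C) y) hy k hd, a_pure,
      a_u _ _ (by rw [SesquiStr.dim_c k]; exact (F.dim_cA hxy).symm.trans_lt hu)] at this
    exact this.symm

theorem a_preserves (A : AlgStr T C) : (F.str C).Preserves (F.ops A) A.a :=
  ⟨fun x y h => by rw [← SesquiStr.c_eq h]; exact F.a_c A h,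
    fun x h => by rw [← SesquiStr.u_eq h]; exact F.a_u A h⟩

/-- Algebras over the monad are the same thing as families of operations. -/
noncomputable def equiv (C : GSet.{u} n) : AlgStr T C ≃ SesquiStr C where
  toFun := F.ops
  invFun := F.algStr
  left_inv A := by
    -- The given algebra map preserves the operations it induces and is the identity on generators;
    -- the evaluation is characterized by this.
    have : F.ev (F.ops A) = A.a := F.hom_ext (F.ops A) (F.ev_preserves _) (F.a_preserves A) (by
      rw [F.pure_ev, F.pure_a])
    cases A
    simp only [algStr]
    congr
  right_inv S := by
    have e : ∀ x : C.Cell, Hom.onCell (F.ev S) (Hom.onCell (F.pure C) x) = x := fun x =>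
      congrArg (fun k : C ⟶ C => Hom.onCell k x) (F.pure_ev S)
    apply SesquiStr.ext_ops
    · intro x y h
      refine ((F.ev_preserves S).map_c (h.map (F.pure C))).trans ?_
      rw [e, e, SesquiStr.c_eq h]
    · intro x h
      refine ((F.ev_preserves S).map_u (x := Hom.onCell (F.pure C) x) h).trans ?_
      rw [e, SesquiStr.u_eq h]

/-- A map between algebras is a morphism if and only if it preserves the operations. -/
theorem map_comp_a_iff (A : AlgStr T C) (B : AlgStr T D) (f : C ⟶ D) :
    T.map f ≫ B.a = A.a ≫ f ↔ (F.ops A).Preserves (F.ops B) f := by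
  constructor
  · intro h
    have e : ∀ P, Hom.onCell f (Hom.onCell A.a P) = Hom.onCell B.a (Hom.onCell (T.map f) P) :=
      fun P => congrArg (fun k : T.obj C ⟶ D => Hom.onCell k P) h.symm
    refine ⟨fun x y hxy => ?_, fun x hx => ?_⟩
    · refine (e _).trans ?_
      rw [(F.map_preserves f).map_c (hxy.map _), pure_map_cell, pure_map_cell]
      rfl
    · refine (e _).trans ?_
      rw [(F.map_preserves f).map_u (x := Hom.onCell (F.pure C) x) hx, pure_map_cell]
      rfl
  · intro h
    -- Both composites preserve operations and restrict to `f` on generators.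
    refine F.hom_ext (F.ops B) ((F.map_preserves f).comp (F.a_preserves B))
      ((F.a_preserves A).comp h) ?_
    rw [← Category.assoc, pure_map, Category.assoc, F.pure_a, ← Category.assoc, F.pure_a,
      Category.comp_id, Category.id_comp]

theorem exists_hom_iff (A : AlgStr T C) (B : AlgStr T D) (f : C ⟶ D) :
    (∃ g : A.algebra ⟶ B.algebra, g.f = f) ↔ (F.equiv C A).Preserves (F.equiv D B) f := by
  refine Iff.trans ?_ (F.map_comp_a_iff A B f)
  constructor
  · rintro ⟨g, rfl⟩
    exact g.h
  · exact fun h => ⟨⟨f, h⟩, rfl⟩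

/-- The comparison of two monads of free structures. -/
def compare (X : GSet.{u} n) : T.obj X ⟶ T'.obj X := T.map (F'.pure X) ≫ F.ev (F'.str X)

theorem compare_preserves (X : GSet.{u} n) :
    (F.str X).Preserves (F'.str X) (F.compare F' X) :=
  (F.map_preserves _).comp (F.ev_preserves _)

theorem pure_compare (X : GSet.{u} n) : F.pure X ≫ F.compare F' X = F'.pure X := by
  rw [compare, ← Category.assoc, pure_map, Category.assoc, F.pure_ev, Category.comp_id]

/-- The usual uniqueness of free objects: the composite preserves operations and fixes the
generators. -/
theorem compare_compare (X : GSet.{u} n) : F.compare F' X ≫ F'.compare F X = 𝟙 _ := by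
  refine F.hom_ext (F.str X) ((F.compare_preserves F' X).comp (F'.compare_preserves F X))
    SesquiStr.preserves_id ?_
  rw [← Category.assoc, pure_compare, pure_compare, Category.comp_id]

theorem compare_naturality (f : X ⟶ Y) :
    T.map f ≫ F.compare F' Y = F.compare F' X ≫ T'.map f := by
  refine F.hom_ext (F'.str Y) ((F.map_preserves f).comp (F.compare_preserves F' Y))
    ((F.compare_preserves F' X).comp (F'.map_preserves f)) ?_
  rw [← Category.assoc, pure_map, Category.assoc, pure_compare, ← Category.assoc, pure_compare,
    pure_map]

/-- Compatibility with the multiplications needs no information on how these are built: both sides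
preserve operations, and on the generators of `T (T X)` both are the comparison map itself. -/
theorem mu_compare (X : GSet.{u} n) : T.μ.app X ≫ F.compare F' X =
    (T.map (F.compare F' X) ≫ F.compare F' (T'.obj X)) ≫ T'.μ.app X := by
  refine F.hom_ext (F'.str X) ((F.mu_preserves X).comp (F.compare_preserves F' X))
    (((F.map_preserves _).comp (F.compare_preserves F' _)).comp (F'.mu_preserves X)) ?_
  rw [← Category.assoc, pure_mu, Category.id_comp, ← Category.assoc, ← Category.assoc, pure_map,
    Category.assoc, Category.assoc, ← Category.assoc (F.pure _), pure_compare, pure_mu,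
    Category.comp_id]

/-- Two monads of free structures are isomorphic. -/
def iso : T ≅ T' :=
  MonadIso.mk
    (NatIso.ofComponents
      (fun X => ⟨F.compare F' X, F'.compare F X, F.compare_compare F' X, F'.compare_compare F X⟩)
      (fun f => F.compare_naturality F' f))
    (fun X => by
      rw [← F.pure_eq, ← F'.pure_eq]
      exact F.pure_compare F' X)
    (fun X => F.mu_compare F' X)

theorem iso_comp {x y : X.Cell} (h : Composable x y) :
    Hom.onCell ((F.iso F').hom.app X)
        ((F.str X).c (Hom.onCell (F.pure X) x) (Hom.onCell (F.pure X) y)) =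
      (F'.str X).c (Hom.onCell (F'.pure X) x) (Hom.onCell (F'.pure X) y) := by
  have e : ∀ x : X.Cell, Hom.onCell (F.compare F' X) (Hom.onCell (F.pure X) x) =
      Hom.onCell (F'.pure X) x := fun x =>
    congrArg (fun k : X ⟶ T'.obj X => Hom.onCell k x) (F.pure_compare F' X)
  refine ((F.compare_preserves F' X).map_c (h.map _)).trans ?_
  rw [e, e]

theorem iso_unit {x : X.Cell} (h : x.dim < n) :
    Hom.onCell ((F.iso F').hom.app X) ((F.str X).u (Hom.onCell (F.pure X) x)) =
      (F'.str X).u (Hom.onCell (F'.pure X) x) := by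
  have e : ∀ x : X.Cell, Hom.onCell (F.compare F' X) (Hom.onCell (F.pure X) x) =
      Hom.onCell (F'.pure X) x := fun x =>
    congrArg (fun k : X ⟶ T'.obj X => Hom.onCell k x) (F.pure_compare F' X)
  refine ((F.compare_preserves F' X).map_u (x := Hom.onCell (F.pure X) x) h).trans ?_
  rw [e]

end FreeSesqui

end Sesqui

namespace Sesqui

open GSet GSet.Cell

/-! ### Trees are free -/

namespace Tree

variable {n : ℕ} {C X Y : GSet.{u} n} (S : SesquiStr C)

/-- The value of a tree. -/
noncomputable def ev : Tree C → C.Cell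
  | leaf x => x
  | comp a b => S.c (ev a) (ev b)
  | unit a => S.u (ev a)

/-- All the operations which occur in a tree are defined. -/
def Ok : Tree C → Prop
  | leaf _ => True
  | comp a b => Composable (ev S a) (ev S b) ∧ Ok a ∧ Ok b
  | unit a => (ev S a).dim < n ∧ Ok a

variable {S} {a b : Tree C}

theorem Ok.dim (h : Ok S a) : (ev S a).dim = a.dim := by
  induction a with
  | leaf c => rfl
  | comp a b iha ihb => rw [ev, SesquiStr.dim_c h.1, iha h.2.1, ihb h.2.2, Tree.dim]
  | unit a ih => rw [ev, SesquiStr.dim_u h.1, ih h.2, Tree.dim]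

/-- The recursive definition of the source of a tree copies the laws 1–4. Definedness is proved
along with the equation because the source of a composite tree may be a new composite. In dimension
0 both notions of source follow the same convention. -/
theorem Ok.src (h : Ok S a) : Ok S a.src ∧ ev S a.src = (ev S a).s := by
  induction a with
  | leaf c => exact ⟨trivial, rfl⟩
  | comp a b iha ihb =>
    have ha := h.2.1.dim
    have hb := h.2.2.dim
    rcases lt_trichotomy a.dim b.dim with e | e | e
    · rw [src_comp_lt e, ev, ev, SesquiStr.s_c_lt h.1 (by omega), (ihb h.2.2).2]
      refine ⟨⟨?_, h.2.1, (ihb h.2.2).1⟩, rfl⟩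
      rw [(ihb h.2.2).2]; exact h.1.s_right (by omega)
    · rw [src_comp_eq e, ev, SesquiStr.s_c_eq h.1 (by omega)]
      exact ihb h.2.2
    · rw [src_comp_gt e, ev, ev, SesquiStr.s_c_gt h.1 (by omega), (iha h.2.1).2]
      refine ⟨⟨?_, (iha h.2.1).1, h.2.2⟩, rfl⟩
      rw [(iha h.2.1).2]; exact h.1.s_left (by omega)
  | unit a ih => exact ⟨h.2, (SesquiStr.s_u h.1).symm⟩

theorem Ok.tgt (h : Ok S a) : Ok S a.tgt ∧ ev S a.tgt = (ev S a).t := by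
  induction a with
  | leaf c => exact ⟨trivial, rfl⟩
  | comp a b iha ihb =>
    have ha := h.2.1.dim
    have hb := h.2.2.dim
    rcases lt_trichotomy a.dim b.dim with e | e | e
    · rw [tgt_comp_lt e, ev, ev, SesquiStr.t_c_lt h.1 (by omega), (ihb h.2.2).2]
      refine ⟨⟨?_, h.2.1, (ihb h.2.2).1⟩, rfl⟩
      rw [(ihb h.2.2).2]; exact h.1.t_right (by omega)
    · rw [tgt_comp_eq e, ev, SesquiStr.t_c_eq h.1 (by omega)]
      exact iha h.2.1
    · rw [tgt_comp_gt e, ev, ev, SesquiStr.t_c_gt h.1 (by omega), (iha h.2.1).2]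
      refine ⟨⟨?_, (iha h.2.1).1, h.2.2⟩, rfl⟩
      rw [(iha h.2.1).2]; exact h.1.t_left (by omega)
  | unit a ih => exact ⟨h.2, (SesquiStr.t_u h.1).symm⟩

theorem Ok.iter_src (h : Ok S a) (p : ℕ) :
    Ok S (Tree.src^[p] a) ∧ ev S (Tree.src^[p] a) = GSet.Cell.s^[p] (ev S a) := by
  induction p generalizing a with
  | zero => exact ⟨h, rfl⟩
  | succ p ih =>
    simp only [Function.iterate_succ_apply]
    rw [← h.src.2]
    exact ih h.src.1

theorem Ok.iter_tgt (h : Ok S a) (p : ℕ) :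
    Ok S (Tree.tgt^[p] a) ∧ ev S (Tree.tgt^[p] a) = GSet.Cell.t^[p] (ev S a) := by
  induction p generalizing a with
  | zero => exact ⟨h, rfl⟩
  | succ p ih =>
    simp only [Function.iterate_succ_apply]
    rw [← h.tgt.2]
    exact ih h.tgt.1

theorem Ok.composable (ha : Ok S a) (hb : Ok S b) (h1 : 1 ≤ a.dim) (h2 : 1 ≤ b.dim)
    (h : ev S (sB a b) = ev S (tB a b)) : Composable (ev S a) (ev S b) := by
  rw [sB, tB, (ha.iter_src _).2, (hb.iter_tgt _).2] at h
  refine ⟨by rwa [ha.dim], by rwa [hb.dim], ?_⟩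
  rw [ha.dim, hb.dim]; exact h

/-- Soundness of the relations. Definedness and equality of values have to be proved together, just
as compatibility and equivalence are defined together: whether a composite of values is defined
depends on the equality of two values of boundary trees, which is the induction hypothesis for the
premise on `sB` and `tB`. -/
theorem Rel.ev_eq {a b : Tree C} (h : Rel a b) : Ok S a ∧ Ok S b ∧ ev S a = ev S b := by
  induction h with
  | leaf c => exact ⟨trivial, trivial, rfl⟩
  | symm _ ih => exact ⟨ih.2.1, ih.1, ih.2.2.symm⟩
  | trans _ _ ih1 ih2 => exact ⟨ih1.1, ih2.2.1, ih1.2.2.trans ih2.2.2⟩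
  | comp h1 h2 ha hb _ _ iha ihb ih ih' =>
    have e1 := ha.dim_eq
    have e2 := hb.dim_eq
    refine ⟨⟨iha.1.composable ihb.1 h1 h2 ih.2.2, iha.1, ihb.1⟩,
      ⟨iha.2.1.composable ihb.2.1 (by omega) (by omega) ih'.2.2, iha.2.1, ihb.2.1⟩, ?_⟩
    rw [ev, ev, iha.2.2, ihb.2.2]
  | unit h1 h ih =>
    have e := h.dim_eq
    refine ⟨⟨by rwa [ih.1.dim], ih.1⟩, ⟨by rw [ih.2.1.dim]; omega, ih.2.1⟩, ?_⟩
    rw [ev, ev, ih.2.2]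
  | assoc hh _ _ ihL ihR =>
    refine ⟨ihL.1, ihR.1, ?_⟩
    have L := ihL.1
    have R := ihR.1
    -- Composability of the first two values is read off the left-hand tree, that of the last two
    -- off the right-hand tree.
    refine SesquiStr.c_assoc L.2.1.1 R.2.2.1 ?_
    rwa [R.2.1.dim, L.2.1.2.2.dim, L.2.2.dim]
  | comp_comp_left h1 h2 _ _ ihL ihR =>
    refine ⟨ihL.1, ihR.1, ?_⟩
    have L := ihL.1
    have R := ihR.1
    exact SesquiStr.c_c_left L.2.2.1 R.2.1.1 (by rwa [L.2.1.dim, L.2.2.2.1.dim])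
      (by rwa [L.2.1.dim, L.2.2.2.2.dim])
  | comp_comp_right h1 h2 _ _ ihL ihR =>
    refine ⟨ihL.1, ihR.1, ?_⟩
    have L := ihL.1
    have R := ihR.1
    exact SesquiStr.c_c_right L.2.1.1 R.2.2.1 (by rwa [L.2.2.dim, L.2.1.2.1.dim])
      (by rwa [L.2.2.dim, L.2.1.2.2.dim])
  | @unit_comp_of_lt a b h1 _ _ ihL ihR =>
    refine ⟨ihL.1, ihR.1, ?_⟩
    have L := ihL.1
    have d1 := L.2.1.2.dim
    have d2 := L.2.2.dim
    have d3 := SesquiStr.dim_u (S := S) L.2.1.1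
    refine SesquiStr.u_c_lt L.2.1.1 (by omega) ?_
    -- The unit on `a` and the cell `b` meet in dimension `|a|`, so that `a` itself is a target of
    -- `b`.
    have := L.1.eq (m := a.dim) (by rw [ev]; omega)
    rwa [ev, ← bs_s (by omega), SesquiStr.s_u L.2.1.1, bs_of_le (by omega), ← d1] at this
  | unit_comp_of_le h1 _ _ ihL ihR =>
    refine ⟨ihL.1, ihR.1, ?_⟩
    have L := ihL.1
    have R := ihR.1
    exact SesquiStr.u_c_le L.2.1.1 R.2.1 (by rwa [L.2.1.2.dim, L.2.2.dim])
  | @comp_unit_of_lt a b h1 _ _ ihL ihR =>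
    refine ⟨ihL.1, ihR.1, ?_⟩
    have L := ihL.1
    have d1 := L.2.2.2.dim
    have d2 := L.2.1.dim
    have d3 := SesquiStr.dim_u (S := S) L.2.2.1
    refine SesquiStr.c_u_lt L.2.2.1 (by omega) ?_
    have := L.1.eq (m := b.dim) (by rw [ev]; omega)
    rwa [ev, ← bt_t (x := S.u _) (by omega), SesquiStr.t_u L.2.2.1, bt_of_le (x := ev S b) (by omega),
      ← d1] at this
  | comp_unit_of_le h1 _ _ ihL ihR =>
    refine ⟨ihL.1, ihR.1, ?_⟩
    have L := ihL.1
    have R := ihR.1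
    exact SesquiStr.c_u_le L.2.2.1 R.2.1 (by rwa [L.2.1.dim, L.2.2.2.dim])

variable (S) in
/-- The value of a class of trees. -/
noncomputable def evCell (x : (obj C).Cell) : C.Cell := ev S (out x)

theorem evCell_mk (a : Tree C) (h : Rel a a) : evCell S (mk a h) = ev S a :=
  (Rel.ev_eq (out_mk ⟨a, h, rfl⟩)).2.2

/-! ### Boundaries of classes of trees and operations on them -/

theorem exists_mk (x : (obj X).Cell) : ∃ a h, x = mk a h := by
  obtain ⟨k, x⟩ := x
  induction x using Quotient.inductionOn with
  | h a =>
    obtain ⟨a, h, rfl⟩ := a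
    exact ⟨a, h, rfl⟩

theorem mk_eq_iff {a b : Tree X} (ha : Rel a a) (hb : Rel b b) : mk a ha = mk b hb ↔ Rel a b := by
  refine ⟨fun h => ?_, fun h => mk_eq h⟩
  have h1 : Rel (out (mk a ha)) a := out_mk ⟨a, ha, rfl⟩
  have h2 : Rel (out (mk b hb)) b := out_mk ⟨b, hb, rfl⟩
  rw [h] at h1
  exact h1.symm.trans h2

/-- A compatible tree of dimension 0 can only be a leaf. This makes the formal boundary of trees
agree with the convention that `GSet.Cell.s` and `GSet.Cell.t` fix 0-cells. -/
theorem mk_dim_zero {a : Tree X} (h : Rel a a) (hd : a.dim = 0) : a.src = a ∧ a.tgt = a := by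
  cases a with
  | leaf c =>
    obtain ⟨k, x⟩ := c
    obtain rfl : k = 0 := hd
    exact ⟨rfl, rfl⟩
  | comp a b =>
    have := compat_comp_iff.1 h
    simp only [Tree.dim] at hd
    omega
  | unit a => simp [Tree.dim] at hd

theorem s_mk {a : Tree X} (h : Rel a a) : (mk a h).s = mk a.src h.bd.1 := by
  rcases Nat.eq_zero_or_pos a.dim with hd | hd
  · have e := (mk_dim_zero h hd).1
    have : mk a.src h.bd.1 = mk a h := by congr 1
    rw [this]
    have key : ∀ (k : ℕ) (hk : k = 0) (y : (obj X).cell k),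
        GSet.Cell.s ⟨k, y⟩ = (⟨k, y⟩ : (obj X).Cell) := by
      rintro k rfl y; rfl
    exact key _ hd _
  · obtain ⟨d, hd⟩ : ∃ d, a.dim = d + 1 := ⟨a.dim - 1, by omega⟩
    -- The source of a cell is computed only if its dimension is visibly a successor, so the
    -- dimension stored in `mk` is replaced by an equal one.
    have key : ∀ (k : ℕ) (hk : a.dim = k), mk a h = ⟨k, Quotient.mk _ ⟨a, h, hk⟩⟩ := by
      rintro k rfl; rfl
    have key' : ∀ (k : ℕ) (hk : a.src.dim = k),
        mk a.src h.bd.1 = ⟨k, Quotient.mk _ ⟨a.src, h.bd.1, hk⟩⟩ := by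
      rintro k rfl; rfl
    rw [key _ hd, key' d (by rw [dim_src]; omega)]
    rfl

theorem t_mk {a : Tree X} (h : Rel a a) : (mk a h).t = mk a.tgt h.bd.2.1 := by
  rcases Nat.eq_zero_or_pos a.dim with hd | hd
  · have e := (mk_dim_zero h hd).2
    have : mk a.tgt h.bd.2.1 = mk a h := by congr 1
    rw [this]
    have key : ∀ (k : ℕ) (hk : k = 0) (y : (obj X).cell k),
        GSet.Cell.t ⟨k, y⟩ = (⟨k, y⟩ : (obj X).Cell) := by
      rintro k rfl y; rfl
    exact key _ hd _
  · obtain ⟨d, hd⟩ : ∃ d, a.dim = d + 1 := ⟨a.dim - 1, by omega⟩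
    have key : ∀ (k : ℕ) (hk : a.dim = k), mk a h = ⟨k, Quotient.mk _ ⟨a, h, hk⟩⟩ := by
      rintro k rfl; rfl
    have key' : ∀ (k : ℕ) (hk : a.tgt.dim = k),
        mk a.tgt h.bd.2.1 = ⟨k, Quotient.mk _ ⟨a.tgt, h.bd.2.1, hk⟩⟩ := by
      rintro k rfl; rfl
    rw [key _ hd, key' d (by rw [dim_tgt]; omega)]
    rfl

theorem iter_s_mk (p : ℕ) {a : Tree X} (h : Rel a a) :
    GSet.Cell.s^[p] (mk a h) = mk (src^[p] a) (h.iter_src p) := by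
  induction p generalizing a with
  | zero => rfl
  | succ p ih => simp only [Function.iterate_succ_apply, s_mk, ih]

theorem iter_t_mk (p : ℕ) {a : Tree X} (h : Rel a a) :
    GSet.Cell.t^[p] (mk a h) = mk (tgt^[p] a) (h.iter_tgt p) := by
  induction p generalizing a with
  | zero => rfl
  | succ p ih => simp only [Function.iterate_succ_apply, t_mk, ih]

/-- Equality of classes is equivalence of trees, so the pullback condition for two classes is
exactly the condition at the root for the compatibility of the composite tree. -/
theorem composable_mk {a b : Tree X} {ha : Rel a a} {hb : Rel b b} :
    Composable (mk a ha) (mk b hb) ↔ Rel (comp a b) (comp a b) := by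
  rw [compat_comp_iff, Composable, iter_s_mk, iter_t_mk, mk_eq_iff]
  exact ⟨fun h => ⟨h.1, h.2.1, ha, hb, h.2.2⟩, fun h => ⟨h.1, h.2.1, h.2.2.2.2⟩⟩

theorem mk_out (x : (obj X).Cell) : mk (out x) (out_compat x) = x := by
  obtain ⟨a, h, rfl⟩ := exists_mk x
  exact mk_eq (out_mk ⟨a, h, rfl⟩)

theorem compat_out {x y : (obj X).Cell} (h : Composable x y) :
    Rel (comp (out x) (out y)) (comp (out x) (out y)) := by
  rw [← mk_out x, ← mk_out y] at h
  exact composable_mk.1 h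

theorem compat_unit_out {x : (obj X).Cell} (h : x.dim < n) :
    Rel (unit (out x)) (unit (out x)) :=
  .unit (by rw [dim_out]; exact h) (out_compat x)

theorem out_mk_rel (a : Tree X) (h : Rel a a) : Rel (out (mk a h)) a := out_mk ⟨a, h, rfl⟩

/-- Composition of classes of trees. -/
noncomputable def compCell (x y : (obj X).Cell) (h : Composable x y) : (obj X).Cell :=
  mk _ (compat_out h)

/-- Units of classes of trees. -/
noncomputable def unitOp (x : (obj X).Cell) (h : x.dim < n) : (obj X).Cell :=
  mk _ (compat_unit_out h)

/-- Independence of representatives: equivalence is closed under forming compatible composites. -/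
theorem compCell_mk {a b : Tree X} {ha : Rel a a} {hb : Rel b b}
    (h : Composable (mk a ha) (mk b hb)) :
    compCell (mk a ha) (mk b hb) h = mk (comp a b) (composable_mk.1 h) :=
  mk_eq (comp_congr (out_mk_rel a ha) (out_mk_rel b hb) (compat_out h) (composable_mk.1 h))

theorem unitOp_mk {a : Tree X} {ha : Rel a a} (h : (mk a ha).dim < n) :
    unitOp (mk a ha) h = mk (unit a) (.unit h ha) :=
  mk_eq (.unit (by rw [dim_out]; exact h) (out_mk_rel a ha))

/-- The operations on classes of trees. -/
noncomputable def str (X : GSet.{u} n) : SesquiStr (obj X) where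
  comp := compCell
  unit := unitOp
  dim_comp x y h := by
    obtain ⟨a, ha, rfl⟩ := exists_mk x
    obtain ⟨b, hb, rfl⟩ := exists_mk y
    rw [compCell_mk]; rfl
  dim_unit x h := by
    obtain ⟨a, ha, rfl⟩ := exists_mk x
    rw [unitOp_mk]; rfl
  s_comp_of_gt x y h h' hd := by
    obtain ⟨a, ha, rfl⟩ := exists_mk x
    obtain ⟨b, hb, rfl⟩ := exists_mk y
    simp only [compCell_mk, s_mk, src_comp_gt hd]
  t_comp_of_gt x y h h' hd := by
    obtain ⟨a, ha, rfl⟩ := exists_mk x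
    obtain ⟨b, hb, rfl⟩ := exists_mk y
    simp only [compCell_mk, t_mk, tgt_comp_gt hd]
  s_comp_of_lt x y h h' hd := by
    obtain ⟨a, ha, rfl⟩ := exists_mk x
    obtain ⟨b, hb, rfl⟩ := exists_mk y
    simp only [compCell_mk, s_mk, src_comp_lt hd]
  t_comp_of_lt x y h h' hd := by
    obtain ⟨a, ha, rfl⟩ := exists_mk x
    obtain ⟨b, hb, rfl⟩ := exists_mk y
    simp only [compCell_mk, t_mk, tgt_comp_lt hd]
  s_comp_of_eq x y h hd := by
    obtain ⟨a, ha, rfl⟩ := exists_mk x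
    obtain ⟨b, hb, rfl⟩ := exists_mk y
    simp only [compCell_mk, s_mk, src_comp_eq hd]
  t_comp_of_eq x y h hd := by
    obtain ⟨a, ha, rfl⟩ := exists_mk x
    obtain ⟨b, hb, rfl⟩ := exists_mk y
    simp only [compCell_mk, t_mk, tgt_comp_eq hd]
  s_unit x h := by
    obtain ⟨a, ha, rfl⟩ := exists_mk x
    rw [unitOp_mk, s_mk]; rfl
  t_unit x h := by
    obtain ⟨a, ha, rfl⟩ := exists_mk x
    rw [unitOp_mk, t_mk]; rfl
  -- On representatives, each of the laws 5–9 is one of the clauses defining `Rel`; the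
  -- compatibility of the two sides that the clause requires is extracted from the composability
  -- assumptions.
  assoc x y z hxy h hyz h' hd := by
    obtain ⟨a, ha, rfl⟩ := exists_mk x
    obtain ⟨b, hb, rfl⟩ := exists_mk y
    obtain ⟨c, hc, rfl⟩ := exists_mk z
    simp only [compCell_mk] at h h' ⊢
    exact mk_eq (.assoc hd (composable_mk.1 h) (composable_mk.1 h'))
  comp_comp_left x y z hyz h hxy hxz h' h1 h2 := by
    obtain ⟨a, ha, rfl⟩ := exists_mk x
    obtain ⟨b, hb, rfl⟩ := exists_mk y
    obtain ⟨c, hc, rfl⟩ := exists_mk z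
    simp only [compCell_mk] at h h' ⊢
    exact mk_eq (.comp_comp_left h1 h2 (composable_mk.1 h) (composable_mk.1 h'))
  comp_comp_right x y z hxy h hxz hyz h' h1 h2 := by
    obtain ⟨a, ha, rfl⟩ := exists_mk x
    obtain ⟨b, hb, rfl⟩ := exists_mk y
    obtain ⟨c, hc, rfl⟩ := exists_mk z
    simp only [compCell_mk] at h h' ⊢
    exact mk_eq (.comp_comp_right h1 h2 (composable_mk.1 h) (composable_mk.1 h'))
  unit_comp_of_lt x y hx h hd := by
    obtain ⟨a, ha, rfl⟩ := exists_mk x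
    obtain ⟨b, hb, rfl⟩ := exists_mk y
    simp only [unitOp_mk] at h ⊢
    simp only [compCell_mk]
    exact mk_eq (.unit_comp_of_lt hd (composable_mk.1 h) hb)
  unit_comp_of_le x y hx h hxy hu hd := by
    obtain ⟨a, ha, rfl⟩ := exists_mk x
    obtain ⟨b, hb, rfl⟩ := exists_mk y
    simp only [unitOp_mk, compCell_mk] at h hu ⊢
    exact mk_eq (.unit_comp_of_le hd (composable_mk.1 h) (.unit hu (composable_mk.1 hxy)))
  comp_unit_of_lt x y hy h hd := by
    obtain ⟨a, ha, rfl⟩ := exists_mk x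
    obtain ⟨b, hb, rfl⟩ := exists_mk y
    simp only [unitOp_mk] at h ⊢
    simp only [compCell_mk]
    exact mk_eq (.comp_unit_of_lt hd (composable_mk.1 h) ha)
  comp_unit_of_le x y hy h hxy hu hd := by
    obtain ⟨a, ha, rfl⟩ := exists_mk x
    obtain ⟨b, hb, rfl⟩ := exists_mk y
    simp only [unitOp_mk, compCell_mk] at h hu ⊢
    exact mk_eq (.comp_unit_of_le hd (composable_mk.1 h) (.unit hu (composable_mk.1 hxy)))

theorem onCell_hom_mk {f : X.Cell → Tree Y} (hf : Good f) (a : Tree X) (h : Rel a a) :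
    Hom.onCell hf.hom (mk a h) = mk (bind f a) (hf.graft h).1 := by
  have key : ∀ (k : ℕ) (hk : (bind f a).dim = k),
      (⟨k, Quotient.mk _ ⟨bind f a, (hf.graft h).1, hk⟩⟩ : (obj Y).Cell) =
        mk (bind f a) (hf.graft h).1 := by
    rintro k rfl; rfl
  exact key _ (hf.dim_bind a)

theorem Good.preserves {f : X.Cell → Tree Y} (hf : Good f) :
    (str X).Preserves (str Y) hf.hom := by
  refine ⟨fun x y h => ?_, fun x h => ?_⟩
  · obtain ⟨a, ha, rfl⟩ := exists_mk x
    obtain ⟨b, hb, rfl⟩ := exists_mk y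
    have e1 : (str X).comp _ _ h = Tree.mk _ _ := compCell_mk h
    rw [e1, onCell_hom_mk]
    symm
    change compCell _ _ (h.map hf.hom) = _
    simp only [onCell_hom_mk, compCell_mk]
    rfl
  · obtain ⟨a, ha, rfl⟩ := exists_mk x
    have e1 : (str X).unit _ h = Tree.mk _ _ := unitOp_mk h
    rw [e1, onCell_hom_mk]
    symm
    change unitOp (Hom.onCell hf.hom (Tree.mk a ha)) h = _
    simp only [onCell_hom_mk, unitOp_mk]
    rfl

/-- Structural induction on a representative; subtrees of compatible trees are compatible. -/
theorem str_ind (X : GSet.{u} n) (p : (obj X).Cell → Prop)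
    (h0 : ∀ x, p (Hom.onCell (pureHom X) x)) (h1 : ∀ x y h, p x → p y → p ((str X).comp x y h))
    (h2 : ∀ x h, p x → p ((str X).unit x h)) (x : (obj X).Cell) : p x := by
  obtain ⟨a, ha, rfl⟩ := exists_mk x
  induction a with
  | leaf c => exact h0 c
  | comp a b iha ihb =>
    have i := compat_comp_iff.1 ha
    have e : (str X).comp _ _ (composable_mk.2 ha) = mk _ _ :=
      compCell_mk (ha := i.2.2.1) (hb := i.2.2.2.1) (composable_mk.2 ha)
    have := h1 _ _ (composable_mk.2 ha) (iha i.2.2.1) (ihb i.2.2.2.1)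
    rwa [e] at this
  | unit a ih =>
    have i := compat_unit_iff.1 ha
    have e : (str X).unit (mk a i.2) i.1 = mk _ _ := unitOp_mk (ha := i.2) i.1
    have := h2 (mk a i.2) i.1 (ih i.2)
    rwa [e] at this

theorem dim_evCell (x : (obj C).Cell) : (evCell S x).dim = x.dim := by
  obtain ⟨a, ha, rfl⟩ := exists_mk x
  rw [evCell_mk, (Rel.ev_eq ha).1.dim]; rfl

variable (S) in
/-- The evaluation of classes of trees. -/
noncomputable def evHom : obj C ⟶ C :=
  GSet.homOfCell (evCell S) dim_evCell
    (fun x _ => by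
      obtain ⟨a, ha, rfl⟩ := exists_mk x
      rw [evCell_mk, s_mk, evCell_mk, (Rel.ev_eq ha).1.src.2])
    (fun x _ => by
      obtain ⟨a, ha, rfl⟩ := exists_mk x
      rw [evCell_mk, t_mk, evCell_mk, (Rel.ev_eq ha).1.tgt.2])

theorem onCell_evHom (x : (obj C).Cell) : Hom.onCell (evHom S) x = evCell S x :=
  GSet.onCell_homOfCell _ _ _ _ x

theorem evHom_preserves : (str C).Preserves S (evHom S) := by
  refine ⟨fun x y h => ?_, fun x h => ?_⟩
  · obtain ⟨a, ha, rfl⟩ := exists_mk x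
    obtain ⟨b, hb, rfl⟩ := exists_mk y
    have e1 : (str C).comp _ _ h = mk _ _ := compCell_mk h
    rw [e1, ← SesquiStr.c_eq, onCell_evHom, onCell_evHom, onCell_evHom, evCell_mk, evCell_mk,
      evCell_mk, ev]
  · obtain ⟨a, ha, rfl⟩ := exists_mk x
    have e1 : (str C).unit _ h = mk _ _ := unitOp_mk h
    refine Eq.trans ?_ (SesquiStr.u_eq (x := Hom.onCell (evHom S) (mk a ha)) h)
    rw [e1, onCell_evHom, onCell_evHom, evCell_mk, evCell_mk, ev]

/-- Classes of trees are free. -/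
noncomputable def free (n : ℕ) : FreeSesqui (monad.{u} n) where
  str X := str X
  pure X := pureHom X
  pure_eq _ := rfl
  map_preserves f := (good_leaf f).preserves
  mu_preserves _ := good_out.preserves
  ind := str_ind
  ev _ := evHom _
  ev_preserves _ := evHom_preserves
  pure_ev _ := GSet.hom_ext_onCell fun x =>
    (onCell_evHom _).trans (evCell_mk (leaf x) (.leaf x))

theorem circ_eq {x y : X.Cell} (h : Composable x y) : circ x y h =
    ((free n).str X).c (Hom.onCell ((free n).pure X) x) (Hom.onCell ((free n).pure X) y) := by
  rw [SesquiStr.c_eq (h.map _)]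
  exact (compCell_mk (ha := .leaf x) (hb := .leaf y) (h.map (pureHom X))).symm

theorem unitCell_eq {x : X.Cell} (h : x.dim < n) : unitCell x h =
    ((free n).str X).u (Hom.onCell ((free n).pure X) x) := by
  have h' : (Hom.onCell ((free n).pure X) x).dim < n := h
  rw [SesquiStr.u_eq h']
  exact (unitOp_mk (ha := .leaf x) h').symm

end Tree

end Sesqui

namespace Sesqui

open GSet GSet.Cell

/-! ### Operations on diagrams -/

section moves

variable {A : Type u}

/-- Shifting the positions of a list of labelled positions. -/
def sh (o : ℕ) (L : List (ℕ × A)) : List (ℕ × A) := L.map fun r => (o + r.1, r.2)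

@[simp] theorem sh_zero (L : List (ℕ × A)) : sh 0 L = L := by simp [sh]

@[simp] theorem sh_nil (o : ℕ) : sh o ([] : List (ℕ × A)) = [] := rfl

@[simp] theorem sh_append (o : ℕ) (L M : List (ℕ × A)) : sh o (L ++ M) = sh o L ++ sh o M := by
  simp [sh]

theorem sh_sh (o p : ℕ) (L : List (ℕ × A)) : sh o (sh p L) = sh (o + p) L := by
  simp [sh, Nat.add_assoc]

@[simp] theorem sh_length (o : ℕ) (L : List (ℕ × A)) : (sh o L).length = L.length := by
  simp [sh]

@[simp] theorem sh_snd (o : ℕ) (L : List (ℕ × A)) : (sh o L).map Prod.snd = L.map Prod.snd := by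
  simp [sh]

theorem relabel_self (L : List (ℕ × A)) : relabel L (L.map Prod.snd) = L :=
  pair_ext (relabel_fst _ _ (by simp)) (relabel_snd _ _ (by simp))

theorem relabel_sh (o : ℕ) (L : List (ℕ × A)) (ys : List A) :
    relabel (sh o L) ys = sh o (relabel L ys) := by
  simp only [relabel, sh, List.zipWith_map_left, List.map_zipWith]

theorem map_shiftMove_zero (L : List (ℕ × A × A)) : L.map (shiftMove 0) = L := by
  have : (shiftMove 0 : ℕ × A × A → ℕ × A × A) = id := by
    funext mv; simp [shiftMove]
  rw [this, List.map_id]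

theorem run_append_right {st : List A} {L : List (ℕ × A × A)} (b : List A) (h : Fits st L) :
    Fits (st ++ b) L ∧ run (st ++ b) L = run st L ++ b := by
  simpa [map_shiftMove_zero] using run_shift [] st b L h

theorem run_append_left {st : List A} {L : List (ℕ × A × A)} (a : List A) (h : Fits st L) :
    Fits (a ++ st) (L.map (shiftMove a.length)) ∧
      run (a ++ st) (L.map (shiftMove a.length)) = a ++ run st L := by
  simpa using run_shift a st [] L h

end moves

section

variable {n : ℕ} {X Y : GSet.{u} n}

@[simp] theorem moves_append {m : ℕ} (L M : List (ℕ × X.cell (m + 1))) :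
    moves X (L ++ M) = moves X L ++ moves X M := by simp [moves]

theorem moves_sh {m : ℕ} (o : ℕ) (L : List (ℕ × X.cell (m + 1))) :
    moves X (sh o L) = (moves X L).map (shiftMove o) := by
  simp [moves, sh, shiftMove]

end

namespace Lab

variable {n : ℕ} {X Y : GSet.{u} n}

/-- The lists of labelled dots of a labelled diagram of any dimension. -/
def lv (x : (obj X).Cell) (m : ℕ) : List (ℕ × X.cell m) := Lab.lvl x.2 m

/-- The labels of level `m`, after passing the dots of level `m + 1`. -/
def fin (x : (obj X).Cell) (m : ℕ) : List (X.cell m) :=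
  run ((lv x m).map Prod.snd) (moves X (lv x (m + 1)))

theorem lv_fits (x : (obj X).Cell) (m : ℕ) :
    Fits ((lv x m).map Prod.snd) (moves X (lv x (m + 1))) := Lab.fits x.2 m

theorem lv_top {x : (obj X).Cell} {m : ℕ} (h : x.dim < m) : lv x m = [] := Lab.lvl_top x.2 m h

theorem lv_zero (x : (obj X).Cell) : ∃ a, lv x 0 = [(0, a)] := Lab.lvl_zero x.2

theorem fin_length (x : (obj X).Cell) (m : ℕ) : (lv x m).length = (fin x m).length :=
  Lab.out_length x.2 m

theorem cell_ext {x y : (obj X).Cell} (hd : x.dim = y.dim) (h : ∀ m ≤ x.dim, lv x m = lv y m) :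
    x = y := by
  obtain ⟨k, P⟩ := x
  obtain ⟨l, Q⟩ := y
  obtain rfl : k = l := hd
  exact congrArg (Sigma.mk k) (Lab.ext_le h)

theorem lv_s {x : (obj X).Cell} {m : ℕ} (h : m < x.dim) : lv x.s m = lv x m := by
  obtain ⟨k, P⟩ := x
  obtain ⟨k, rfl⟩ : ∃ j, k = j + 1 := ⟨k - 1, by simp only [GSet.Cell.dim] at h; omega⟩
  exact Lab.src_lvl P (Nat.le_of_lt_succ h)

theorem lv_t {x : (obj X).Cell} {m : ℕ} (h : m + 1 < x.dim) : lv x.t m = lv x m := by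
  obtain ⟨k, P⟩ := x
  obtain ⟨k, rfl⟩ : ∃ j, k = j + 1 := ⟨k - 1, by simp only [GSet.Cell.dim] at h; omega⟩
  exact Lab.tgt_lvl P (Nat.lt_of_succ_lt_succ h)

theorem lv_t_self {x : (obj X).Cell} {m : ℕ} (h : x.dim = m + 1) :
    lv x.t m = relabel (lv x m) (fin x m) := by
  obtain ⟨k, P⟩ := x
  obtain rfl : k = m + 1 := h
  exact Lab.tgt_lvl_self P

theorem lv_bs {x : (obj X).Cell} {m p : ℕ} (h : m ≤ p) : lv (bs p x) m = lv x m := by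
  refine cell_induction (P := fun p x => m ≤ p → lv (bs p x) m = lv x m) p ?_ ?_ x h
  · intro x hx _; rw [bs_of_le hx]
  · intro x hx h1 _ h; rw [← bs_s hx, h1 h, lv_s (by omega)]

theorem lv_bt {x : (obj X).Cell} {m p : ℕ} (h : m < p) : lv (bt p x) m = lv x m := by
  refine cell_induction (P := fun p x => m < p → lv (bt p x) m = lv x m) p ?_ ?_ x h
  · intro x hx _; rw [bt_of_le hx]
  · intro x hx _ h1 h; rw [← bt_t hx, h1 h, lv_t (by omega)]

/-- If `x` has dimension above `p + 1`, passing to its target of dimension `p + 1` replaces the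
labels of level `p + 1` by parallel ones. These perform the same moves on level `p`, so the state
reached there is still the one computed from `x`. -/
theorem lv_bt_self {x : (obj X).Cell} {p : ℕ} (h : p < x.dim) :
    lv (bt p x) p = relabel (lv x p) (fin x p) := by
  rw [← bt_bt (q := p + 1) (by omega), ← t_eq_bt (by rw [dim_bt]; omega),
    lv_t_self (by rw [dim_bt]; omega), lv_bt (by omega), fin, fin, lv_bt (by omega)]
  congr 2
  rcases (show x.dim = p + 1 ∨ p + 1 < x.dim by omega) with e | e
  · rw [bt_of_le (by omega)]
  · rw [lv_bt_self e]
    exact moves_relabel X _ _ (Lab.out_inv x.2 (p + 1) X.src fun x => (X.src_tgt x).symm)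
      (Lab.out_inv x.2 (p + 1) X.tgt fun x => X.tgt_src x)
termination_by x.dim - p

theorem composable_lv {x y : (obj X).Cell} (h : Composable x y) {m p : ℕ}
    (hm : min x.dim y.dim = m + 1) (hp : p < m) : lv x p = lv y p := by
  have := congrArg (fun z => lv z p) (h.eq hm)
  simpa only [lv_bs hp.le, lv_bt hp] using this

theorem composable_lv_self {x y : (obj X).Cell} (h : Composable x y) {m : ℕ}
    (hm : min x.dim y.dim = m + 1) : lv x m = relabel (lv y m) (fin y m) := by
  have := congrArg (fun z => lv z m) (h.eq hm)
  simpa only [lv_bs le_rfl, lv_bt_self (x := y) (p := m) (by omega)] using this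

theorem composable_snd {x y : (obj X).Cell} (h : Composable x y) {m : ℕ}
    (hm : min x.dim y.dim = m + 1) : (lv x m).map Prod.snd = fin y m := by
  rw [composable_lv_self h hm, relabel_snd _ _ (fin_length _ _)]

theorem composable_fst {x y : (obj X).Cell} (h : Composable x y) {m : ℕ}
    (hm : min x.dim y.dim = m + 1) : (lv x m).map Prod.fst = (lv y m).map Prod.fst := by
  rw [composable_lv_self h hm, relabel_fst _ _ (fin_length _ _)]

/-- The composite of two families of lists of labelled dots. -/
def cmp (m : ℕ) (P Q : ∀ m : ℕ, List (ℕ × X.cell m)) (p : ℕ) : List (ℕ × X.cell p) :=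
  if p < m then Q p else Q p ++ sh (if p = m + 1 then (Q m).length else 0) (P p)

/-- Let `m + 1` be the smaller dimension. On level `m` the state reached after the dots of `y`
consists of the labels of `x`, by composability, so the dots of `x` can follow. On level `m + 1` the
dots above act on two disjoint blocks, those of `x` on the shifted one. Higher up at most one of the
two diagrams has dots. -/
theorem cmp_fits {x y : (obj X).Cell} (h : Composable x y) (p : ℕ) :
    Fits ((cmp (min x.dim y.dim) (lv x) (lv y) p).map Prod.snd)
      (moves X (cmp (min x.dim y.dim) (lv x) (lv y) (p + 1))) := by
  obtain ⟨m, hm⟩ := h.exists_dim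
  rw [hm]
  have hp : p < m ∨ p = m ∨ p = m + 1 ∨ m + 1 < p := by omega
  rcases hp with hp | rfl | rfl | hp
  · rw [cmp, cmp, if_pos (by omega), if_pos (by omega)]
    exact lv_fits y p
  · rw [cmp, cmp, if_pos (by omega), if_neg (by omega), if_neg (by omega), sh_zero, moves_append,
      fits_append]
    refine ⟨lv_fits y p, ?_⟩
    have := lv_fits x p
    rwa [composable_snd h hm] at this
  · rw [cmp, cmp, if_neg (by omega), if_neg (by omega), if_neg (by omega), sh_zero, if_pos rfl,
      moves_append, List.map_append, fits_append, moves_sh]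
    have h1 := run_append_right ((lv x (m + 1)).map Prod.snd) (lv_fits y (m + 1))
    refine ⟨h1.1, ?_⟩
    rw [h1.2]
    have h2 := (run_append_left (fin y (m + 1)) (lv_fits x (m + 1))).1
    rwa [← fin_length] at h2
  · rw [cmp, cmp, if_neg (show ¬p < m + 1 by omega), if_neg (show ¬p + 1 < m + 1 by omega),
      if_neg (show ¬p + 1 = m + 1 + 1 by omega), sh_zero]
    rcases (show x.dim < p ∨ y.dim < p by omega) with e | e
    · rw [lv_top e, lv_top (x := x) (m := p + 1) (by omega)]
      simpa using lv_fits y p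
    · rw [lv_top e, lv_top (x := y) (m := p + 1) (by omega)]
      simpa using lv_fits x p

/-- The composite of two labelled diagrams. -/
def compCell (x y : (obj X).Cell) (h : Composable x y) : (obj X).Cell :=
  ⟨max x.dim y.dim,
    { lvl := cmp (min x.dim y.dim) (lv x) (lv y)
      le := max_le (GSet.Cell.le_dim x) (GSet.Cell.le_dim y)
      lvl_zero := by
        have e : cmp (min x.dim y.dim) (lv x) (lv y) 0 = lv y 0 :=
          if_pos (lt_min h.1 h.2.1)
        rw [e]
        exact lv_zero y
      lvl_top := fun p hp => by
        rw [max_lt_iff] at hp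
        rw [cmp, if_neg (by omega), lv_top hp.1, lv_top hp.2, sh_nil]; rfl
      fits := cmp_fits h }⟩

/-- The diagram with no dots in the top dimension. -/
def unitCell (x : (obj X).Cell) (h : x.dim < n) : (obj X).Cell :=
  ⟨x.dim + 1,
    { lvl := lv x
      le := h
      lvl_zero := lv_zero x
      lvl_top := fun _ hp => lv_top (Nat.lt_of_succ_lt hp)
      fits := lv_fits x }⟩

section

variable {x y z : (obj X).Cell}

theorem dim_compCell (h : Composable x y) : (compCell x y h).dim = max x.dim y.dim := rfl

theorem dim_unitCell (h : x.dim < n) : (unitCell x h).dim = x.dim + 1 := rfl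

theorem lv_unitCell (h : x.dim < n) (p : ℕ) : lv (unitCell x h) p = lv x p := rfl

theorem lv_comp (h : Composable x y) (p : ℕ) :
    lv (compCell x y h) p = cmp (min x.dim y.dim) (lv x) (lv y) p := rfl

theorem lv_comp_lt (h : Composable x y) {p : ℕ} (hp : p < min x.dim y.dim) :
    lv (compCell x y h) p = lv y p := by
  rw [lv_comp, cmp, if_pos hp]

theorem lv_comp_right (h : Composable x y) {p : ℕ} (hp : x.dim < p) :
    lv (compCell x y h) p = lv y p := by
  rw [lv_comp, cmp, lv_top hp]
  split_ifs <;> simp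

theorem lv_comp_eq (h : Composable x y) {p : ℕ} (hp : p = min x.dim y.dim) :
    lv (compCell x y h) p = lv y p ++ lv x p := by
  rw [lv_comp, cmp, if_neg (by omega), if_neg (by omega), sh_zero]

/-- The only level on which positions change: the dots of `x` over level `|y|` are moved past those
of `y`. If `x` has no dots there, both sides are empty. -/
theorem lv_comp_succ (h : Composable x y) {p q : ℕ} (hq : y.dim = q) (hp : p = q + 1) :
    lv (compCell x y h) p = sh (lv y q).length (lv x p) := by
  subst hq
  by_cases hx : x.dim < p
  · rw [lv_comp_right h hx, lv_top hx, lv_top (by omega)]; rfl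
  · rw [lv_comp, cmp, if_neg (by omega), if_pos (by omega), show min x.dim y.dim = y.dim by omega,
      lv_top (x := y) (by omega)]
    rfl

theorem lv_comp_left (h : Composable x y) {p : ℕ} (hp : y.dim + 1 < p) :
    lv (compCell x y h) p = lv x p := by
  by_cases hx : x.dim < p
  · rw [lv_comp_right h hx, lv_top hx, lv_top (by omega)]
  · rw [lv_comp, cmp, if_neg (by omega), if_neg (by omega), sh_zero, lv_top (x := y) (by omega)]
    rfl

/-- The top level of the target of a whiskered diagram. On level `|y|` the moves of `x` act behind
the block of `y` and leave it alone; on higher levels there are only dots of `x`, possibly shifted.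
-/
theorem fin_comp_gt (h : Composable x y) {p : ℕ} (hp : x.dim = p + 1) (hd : y.dim < x.dim) :
    relabel (lv (compCell x y h) p) (fin (compCell x y h) p) =
      if p = y.dim then lv y p ++ relabel (lv x p) (fin x p) else
        sh (if p = y.dim + 1 then (lv y y.dim).length else 0) (relabel (lv x p) (fin x p)) := by
  split_ifs with h1 h2
  · rw [fin, lv_comp_eq h (by omega), lv_comp_succ h (q := p) (by omega) rfl, moves_sh,
      List.map_append]
    have h3 := (run_append_left ((lv y p).map Prod.snd) (lv_fits x p)).2
    rw [List.length_map] at h3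
    rw [h3, relabel_append _ _ _ _ (by simp), relabel_self]
    rfl
  · rw [fin, lv_comp_succ h (q := y.dim) rfl h2, lv_comp_left h (by omega), sh_snd, relabel_sh]
    rfl
  · rw [fin, lv_comp_left h (p := p) (by omega), lv_comp_left h (by omega), sh_zero]
    rfl

theorem fin_comp_lt (h : Composable x y) {p : ℕ} (hp : y.dim = p + 1) (hd : x.dim < y.dim) :
    relabel (lv (compCell x y h) p) (fin (compCell x y h) p) =
      relabel (lv y p) (fin y p) ++ if p = x.dim then lv x p else [] := by
  split_ifs with h1
  · rw [fin, lv_comp_eq h (by omega), lv_comp_right h (by omega), List.map_append,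
      (run_append_right _ (lv_fits y p)).2, ← fin,
      relabel_append _ _ _ _ (fin_length y p), relabel_self]
  · rw [fin, lv_comp_right h (p := p) (by omega), lv_comp_right h (by omega), List.append_nil]
    rfl

/-- The dots of `y` lead to the labels from which `x` starts, and the dots of `x` lead on to the
final state of `x`; the positions on the two levels agree by composability. -/
theorem fin_comp_eq (h : Composable x y) {p : ℕ} (hp : x.dim = p + 1) (hd : x.dim = y.dim) :
    relabel (lv (compCell x y h) p) (fin (compCell x y h) p) = relabel (lv x p) (fin x p) := by
  have hm : min x.dim y.dim = p + 1 := by omega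
  have e : fin (compCell x y h) p = fin x p := by
    rw [fin, lv_comp_lt h (by omega), lv_comp_eq h hm.symm, moves_append, run_append]
    have := composable_snd h hm
    rw [fin] at this
    rw [← this]; rfl
  rw [e, lv_comp_lt h (by omega)]
  apply pair_ext
  · rw [relabel_fst _ _ (fin_length _ _), relabel_fst, composable_fst h hm]
    rw [← fin_length, ← List.length_map (f := Prod.fst), ← composable_fst h hm, List.length_map]
  · rw [relabel_snd _ _ (fin_length _ _), relabel_snd]
    rw [← fin_length, ← List.length_map (f := Prod.fst), ← composable_fst h hm, List.length_map]

end

end Lab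

end Sesqui

/-! ### The laws 1–9 for labelled diagrams -/

namespace Sesqui

open GSet GSet.Cell

namespace Lab

variable {n : ℕ} {X Y : GSet.{u} n} {x y z : (obj X).Cell}

theorem s_compCell_gt (h : Composable x y) (h') (hd : y.dim < x.dim) :
    (compCell x y h).s = compCell x.s y h' := by
  have e := dim_s x
  have e' := dim_compCell h
  apply cell_ext
  · rw [dim_s, dim_compCell, dim_compCell]; omega
  · intro p hp
    rw [dim_s, dim_compCell] at hp
    rw [lv_s (by omega)]
    rcases lt_trichotomy p y.dim with hq | hq | hq
    · rw [lv_comp_lt h (by omega), lv_comp_lt h' (by omega)]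
    · rw [lv_comp_eq h (by omega), lv_comp_eq h' (by omega), lv_s (by omega)]
    · rcases (show p = y.dim + 1 ∨ y.dim + 1 < p by omega) with hq' | hq'
      · rw [lv_comp_succ h rfl hq', lv_comp_succ h' rfl hq', lv_s (by omega)]
      · rw [lv_comp_left h hq', lv_comp_left h' hq', lv_s (by omega)]

theorem s_compCell_lt (h : Composable x y) (h') (hd : x.dim < y.dim) :
    (compCell x y h).s = compCell x y.s h' := by
  have e := dim_s y
  have e' := dim_compCell h
  apply cell_ext
  · rw [dim_s, dim_compCell, dim_compCell]; omega
  · intro p hp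
    rw [dim_s, dim_compCell] at hp
    rw [lv_s (by omega)]
    rcases lt_trichotomy p x.dim with hq | hq | hq
    · rw [lv_comp_lt h (by omega), lv_comp_lt h' (by omega), lv_s (by omega)]
    · rw [lv_comp_eq h (by omega), lv_comp_eq h' (by omega), lv_s (by omega)]
    · rw [lv_comp_right h hq, lv_comp_right h' hq, lv_s (by omega)]

theorem s_compCell_eq (h : Composable x y) (hd : x.dim = y.dim) :
    (compCell x y h).s = y.s := by
  have e := dim_s y
  have e' := dim_compCell h
  apply cell_ext
  · rw [dim_s, dim_compCell, dim_s]; omega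
  · intro p hp
    have := h.1
    rw [dim_s, dim_compCell] at hp
    rw [lv_s (by omega), lv_comp_lt h (by omega), lv_s (by omega)]

theorem t_compCell_gt (h : Composable x y) (h') (hd : y.dim < x.dim) :
    (compCell x y h).t = compCell x.t y h' := by
  have e := dim_t x
  have e' := dim_compCell h
  apply cell_ext
  · rw [dim_t, dim_compCell, dim_compCell]; omega
  · intro p hp
    rw [dim_t, dim_compCell] at hp
    -- Targets differ from sources only on the highest level of the boundary, where the top dots
    -- have been passed.
    rcases (show p + 1 = x.dim ∨ p + 1 < x.dim by omega) with hpx | hpx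
    · rw [lv_t_self (by omega), fin_comp_gt h hpx.symm hd, ← lv_t_self hpx.symm]
      split_ifs with h1 h2
      · rw [lv_comp_eq h' (by omega)]
      · rw [lv_comp_succ h' rfl h2]
      · rw [lv_comp_left h' (by omega), sh_zero]
    · rw [lv_t (by omega)]
      rcases lt_trichotomy p y.dim with hq | hq | hq
      · rw [lv_comp_lt h (by omega), lv_comp_lt h' (by omega)]
      · rw [lv_comp_eq h (by omega), lv_comp_eq h' (by omega), lv_t (by omega)]
      · rcases (show p = y.dim + 1 ∨ y.dim + 1 < p by omega) with hq' | hq'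
        · rw [lv_comp_succ h rfl hq', lv_comp_succ h' rfl hq', lv_t (by omega)]
        · rw [lv_comp_left h hq', lv_comp_left h' hq', lv_t (by omega)]

theorem t_compCell_lt (h : Composable x y) (h') (hd : x.dim < y.dim) :
    (compCell x y h).t = compCell x y.t h' := by
  have e := dim_t y
  have e' := dim_compCell h
  apply cell_ext
  · rw [dim_t, dim_compCell, dim_compCell]; omega
  · intro p hp
    rw [dim_t, dim_compCell] at hp
    rcases (show p + 1 = y.dim ∨ p + 1 < y.dim by omega) with hpx | hpx
    · rw [lv_t_self (by omega), fin_comp_lt h hpx.symm hd, ← lv_t_self hpx.symm]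
      split_ifs with h1
      · rw [lv_comp_eq h' (by omega)]
      · rw [lv_comp_right h' (by omega), List.append_nil]
    · rw [lv_t (by omega)]
      rcases lt_trichotomy p x.dim with hq | hq | hq
      · rw [lv_comp_lt h (by omega), lv_comp_lt h' (by omega), lv_t (by omega)]
      · rw [lv_comp_eq h (by omega), lv_comp_eq h' (by omega), lv_t (by omega)]
      · rw [lv_comp_right h hq, lv_comp_right h' hq, lv_t (by omega)]

theorem t_compCell_eq (h : Composable x y) (hd : x.dim = y.dim) :
    (compCell x y h).t = x.t := by
  have e := dim_t y
  have e' := dim_compCell h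
  apply cell_ext
  · rw [dim_t, dim_compCell, dim_t]; omega
  · intro p hp
    have := h.1
    rw [dim_t, dim_compCell] at hp
    rcases (show p + 1 = x.dim ∨ p + 1 < x.dim by omega) with hpx | hpx
    · rw [lv_t_self (by omega), fin_comp_eq h hpx.symm hd, ← lv_t_self hpx.symm]
    · obtain ⟨m, hm⟩ := h.exists_dim
      rw [lv_t (by omega), lv_comp_lt h (by omega), lv_t (by omega),
        composable_lv h hm (by omega)]

theorem s_unitCell (h : x.dim < n) : (unitCell x h).s = x := by
  apply cell_ext
  · rw [dim_s, dim_unitCell]; rfl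
  · intro p hp
    rw [dim_s, dim_unitCell] at hp
    rw [lv_s (by rw [dim_unitCell]; omega), lv_unitCell]

theorem t_unitCell (h : x.dim < n) : (unitCell x h).t = x := by
  apply cell_ext
  · rw [dim_t, dim_unitCell]; rfl
  · intro p hp
    rw [dim_t, dim_unitCell] at hp
    rcases (show p = x.dim ∨ p < x.dim by omega) with rfl | hpx
    · rw [lv_t_self (dim_unitCell h), fin, lv_unitCell, lv_unitCell,
        lv_top (m := x.dim + 1) (by omega)]
      exact relabel_self _
    · rw [lv_t (by rw [dim_unitCell]; omega), lv_unitCell]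

/-- On the level of the smallest dimension both sides list the dots of `z`, `y`, `x` in this order.
As the two smallest dimensions agree, at most one of the three diagrams has dots above this level;
on the next level they are moved past all preceding dots, whose numbers add up. -/
theorem compCell_assoc (hxy : Composable x y) (h) (hyz : Composable y z) (h')
    (hd : (x.dim = y.dim ∧ x.dim ≤ z.dim) ∨ (x.dim = z.dim ∧ x.dim ≤ y.dim) ∨
      (y.dim = z.dim ∧ y.dim ≤ x.dim)) :
    compCell (compCell x y hxy) z h = compCell x (compCell y z hyz) h' := by
  have e1 := dim_compCell hxy
  have e2 := dim_compCell hyz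
  have hp1 := hxy.1
  apply cell_ext
  · simp only [dim_compCell]; omega
  · intro p hp
    obtain ⟨m, hm⟩ : ∃ m, m = min x.dim (min y.dim z.dim) := ⟨_, rfl⟩
    rcases lt_trichotomy p m with hq | hq | hq
    · rw [lv_comp_lt h (by omega), lv_comp_lt h' (by omega), lv_comp_lt hyz (by omega)]
    · rw [lv_comp_eq h (by omega), lv_comp_eq h' (by omega)]
      rcases hd with hd | hd | hd
      · rcases (show y.dim = z.dim ∨ y.dim < z.dim by omega) with hd' | hd'
        · rw [lv_comp_eq hxy (by omega), lv_comp_eq hyz (by omega), List.append_assoc]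
        · rw [lv_comp_eq hxy (by omega), lv_comp_eq hyz (by omega), List.append_assoc]
      · rcases (show x.dim = y.dim ∨ x.dim < y.dim by omega) with hd' | hd'
        · rw [lv_comp_eq hxy (by omega), lv_comp_eq hyz (by omega), List.append_assoc]
        · rw [lv_comp_eq hxy (by omega), lv_comp_eq hyz (by omega), List.append_assoc]
      · rw [lv_comp_eq hxy (by omega), lv_comp_eq hyz (by omega), List.append_assoc]
    · rcases hd with hd | hd | hd
      · rw [lv_comp_right h (by omega), lv_comp_right h' (by omega), lv_comp_right hyz (by omega)]
      · rw [lv_comp_right h' (by omega)]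
        rcases (show p = z.dim + 1 ∨ z.dim + 1 < p by omega) with hq' | hq'
        · rw [lv_comp_succ h rfl hq', lv_comp_succ hyz rfl hq', lv_comp_right hxy (by omega)]
        · rw [lv_comp_left h hq', lv_comp_left hyz hq', lv_comp_right hxy (by omega)]
      · rcases (show p = z.dim + 1 ∨ z.dim + 1 < p by omega) with hq' | hq'
        · rw [lv_comp_succ h rfl hq', lv_comp_succ hxy hd.1 hq', lv_comp_succ h' (q := z.dim)
            (by omega) hq', sh_sh, lv_comp_eq hyz (by omega), List.length_append]
        · rw [lv_comp_left h hq', lv_comp_left hxy (by omega), lv_comp_left h' (by omega)]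

/-- Below the smaller of `|y|` and `|z|`, a composite keeps only the dots of its second factor, so
on the right as well the dots of `x` occur once. Above `|x|`, whiskering on the left by `x` changes
nothing, because the dots of `x` are added at the end of their level. -/
theorem compCell_comp_left (hyz : Composable y z) (h) (hxy : Composable x y)
    (hxz : Composable x z) (h') (h1 : x.dim < y.dim) (h2 : x.dim < z.dim) :
    compCell x (compCell y z hyz) h = compCell (compCell x y hxy) (compCell x z hxz) h' := by
  have e1 := dim_compCell hxy
  have e2 := dim_compCell hyz
  have e3 := dim_compCell hxz
  apply cell_ext
  · simp only [dim_compCell]; omega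
  · intro p hp
    rcases lt_trichotomy p x.dim with hq | hq | hq
    · rw [lv_comp_lt h (by omega), lv_comp_lt h' (by omega), lv_comp_lt hyz (by omega),
        lv_comp_lt hxz (by omega)]
    · rw [lv_comp_eq h (by omega), lv_comp_lt h' (by omega), lv_comp_lt hyz (by omega),
        lv_comp_eq hxz (by omega)]
    · rw [lv_comp_right h hq]
      rw [lv_comp, lv_comp, cmp, cmp, lv_comp_right hxy hq, lv_comp_right hxz hq, e1, e3,
        max_eq_right h1.le, max_eq_right h2.le]
      split_ifs with hp1 hp2
      · rfl
      · have := hyz.1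
        have := hyz.2.1
        rw [lv_comp_right hxz (p := min y.dim z.dim) (by omega)]
      · rfl

/-- As for whiskering on the left, the dots of `z` survive only in the second factor. The new point
is the shift on level `|z| + 1`: it is the same for the dots of `x` and of `y`, and it does not
alter the number of dots of `y`, by which those of `x` may be shifted one level higher. -/
theorem compCell_comp_right (hxy : Composable x y) (h) (hxz : Composable x z)
    (hyz : Composable y z) (h') (h1 : z.dim < x.dim) (h2 : z.dim < y.dim) :
    compCell (compCell x y hxy) z h = compCell (compCell x z hxz) (compCell y z hyz) h' := by
  have e1 := dim_compCell hxy
  have e2 := dim_compCell hyz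
  have e3 := dim_compCell hxz
  apply cell_ext
  · simp only [dim_compCell]; omega
  · intro p hp
    rcases lt_trichotomy p z.dim with hq | hq | hq
    · rw [lv_comp_lt h (by omega), lv_comp_lt h' (by omega), lv_comp_lt hyz (by omega)]
    · rw [lv_comp_eq h (by omega), lv_comp_lt h' (by omega), lv_comp_lt hxy (by omega),
        lv_comp_eq hyz (by omega)]
    · rw [lv_comp h' p, cmp, e2, e3, max_eq_left h1.le, max_eq_left h2.le]
      rcases (show p = z.dim + 1 ∨ z.dim + 1 < p by omega) with hq' | hq'
      · rw [lv_comp_succ h rfl hq', lv_comp_succ hxz rfl hq', lv_comp_succ hyz rfl hq', lv_comp,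
          cmp]
        split_ifs with hp1 hp2
        · rfl
        · omega
        · rw [sh_append, sh_zero, sh_zero]
      · rw [lv_comp_left h hq', lv_comp_left hxz hq', lv_comp_left hyz hq', lv_comp, cmp]
        split_ifs with hp1 hp2
        · rfl
        · rcases (show min x.dim y.dim = z.dim + 1 ∨ z.dim + 1 < min x.dim y.dim by omega) with k | k
          · rw [k, lv_comp_succ hyz rfl rfl, sh_length]
          · rw [lv_comp_left hyz k]
        · rfl

theorem unitCell_comp_lt (hx : x.dim < n) (h : Composable (unitCell x hx) y)
    (hd : x.dim < y.dim) : compCell (unitCell x hx) y h = y := by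
  have e := dim_unitCell hx
  have hy := h.2.1
  apply cell_ext
  · rw [dim_compCell]; omega
  · intro p hp
    rw [lv_comp, cmp]
    split_ifs with h1 h2
    · rfl
    · rw [lv_unitCell, lv_top (x := x) (by omega), sh_nil, List.append_nil]
    · rw [lv_unitCell, lv_top (x := x) (by omega), sh_nil, List.append_nil]

theorem unitCell_comp_le (hx : x.dim < n) (h : Composable (unitCell x hx) y)
    (hxy : Composable x y) (hu) (hd : y.dim ≤ x.dim) :
    compCell (unitCell x hx) y h = unitCell (compCell x y hxy) hu := by
  have e := dim_unitCell hx
  have e' := dim_compCell hxy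
  have e'' := dim_compCell h
  apply cell_ext
  · simp only [dim_compCell, dim_unitCell]; omega
  · intro p hp
    rw [lv_unitCell, lv_comp, lv_comp, e]
    rw [show min (x.dim + 1) y.dim = min x.dim y.dim by omega]
    rfl

/-- The composite takes its levels up to `|y|` from `y`. The unit has no dots of top dimension, so
composability says that `x` has the same levels there. -/
theorem comp_unitCell_lt (hy : y.dim < n) (h : Composable x (unitCell y hy))
    (hd : y.dim < x.dim) : compCell x (unitCell y hy) h = x := by
  have e := dim_unitCell hy
  apply cell_ext
  · rw [dim_compCell]; omega
  · intro p hp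
    have hm : min x.dim (unitCell y hy).dim = y.dim + 1 := by omega
    rcases lt_trichotomy p y.dim with hq | hq | hq
    · rw [lv_comp_lt h (by omega), composable_lv h hm hq]
    · rw [lv_comp_lt h (by omega), hq, composable_lv_self h hm, fin, lv_unitCell,
        lv_unitCell, lv_top (x := y) (m := y.dim + 1) (by omega)]
      exact (relabel_self _).symm
    · rw [lv_comp, cmp, if_neg (by omega), lv_unitCell, lv_top (x := y) hq, hm, lv_unitCell,
        lv_top (x := y) (m := y.dim + 1) (by omega)]
      simp

theorem comp_unitCell_le (hy : y.dim < n) (h : Composable x (unitCell y hy))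
    (hxy : Composable x y) (hu) (hd : x.dim ≤ y.dim) :
    compCell x (unitCell y hy) h = unitCell (compCell x y hxy) hu := by
  have e := dim_unitCell hy
  have e' := dim_compCell hxy
  apply cell_ext
  · simp only [dim_compCell, dim_unitCell]; omega
  · intro p hp
    rw [lv_unitCell, lv_comp, lv_comp, e]
    rw [show min x.dim (y.dim + 1) = min x.dim y.dim by omega]
    rfl

/-- The operations on labelled diagrams. -/
def str (X : GSet.{u} n) : SesquiStr (obj X) where
  comp := compCell
  unit := unitCell
  dim_comp _ _ h := dim_compCell h
  dim_unit _ h := dim_unitCell h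
  s_comp_of_gt _ _ h h' hd := s_compCell_gt h h' hd
  t_comp_of_gt _ _ h h' hd := t_compCell_gt h h' hd
  s_comp_of_lt _ _ h h' hd := s_compCell_lt h h' hd
  t_comp_of_lt _ _ h h' hd := t_compCell_lt h h' hd
  s_comp_of_eq _ _ h hd := s_compCell_eq h hd
  t_comp_of_eq _ _ h hd := t_compCell_eq h hd
  s_unit _ h := s_unitCell h
  t_unit _ h := t_unitCell h
  assoc _ _ _ hxy h hyz h' hd := compCell_assoc hxy h hyz h' hd
  comp_comp_left _ _ _ hyz h hxy hxz h' h1 h2 := compCell_comp_left hyz h hxy hxz h' h1 h2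
  comp_comp_right _ _ _ hxy h hxz hyz h' h1 h2 := compCell_comp_right hxy h hxz hyz h' h1 h2
  unit_comp_of_lt _ _ hx h hd := unitCell_comp_lt hx h hd
  unit_comp_of_le _ _ hx h hxy hu hd := unitCell_comp_le hx h hxy hu hd
  comp_unit_of_lt _ _ hy h hd := comp_unitCell_lt hy h hd
  comp_unit_of_le _ _ hy h hxy hu hd := comp_unitCell_le hy h hxy hu hd

end Lab

end Sesqui

namespace Sesqui

open GSet GSet.Cell

/-! ### Diagrams are generated by cells -/

namespace Lab

variable {n : ℕ} {X Y : GSet.{u} n} {x y z : (obj X).Cell}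

theorem lv_map (f : X ⟶ Y) (x : (obj X).Cell) (m : ℕ) :
    lv (Hom.onCell ((functor n).map f) x) m = (lv x m).map (Prod.map id (f.app m)) := rfl

theorem map_preserves (f : X ⟶ Y) : (str X).Preserves (str Y) ((functor n).map f) := by
  refine ⟨fun x y h => ?_, fun x h => ?_⟩
  · refine cell_ext rfl fun p _ => ?_
    have h' := h.map ((functor n).map f)
    rw [lv_map]
    refine (?_ : _ = lv (compCell _ _ h') p)
    change List.map _ (lv (compCell x y h) p) = _
    rw [lv_comp, lv_comp, cmp, cmp]
    change _ = if p < min x.dim y.dim then _ else _ ++ sh (if p = min x.dim y.dim + 1 then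
      (lv (Hom.onCell ((functor n).map f) y) (min x.dim y.dim)).length else 0) _
    rw [lv_map, lv_map, lv_map, List.length_map]
    split_ifs
    · rfl
    · simp [sh, Function.comp_def]
    · simp
  · exact cell_ext rfl fun p _ => rfl

/-- The positions at which the dots of the composite of a diagram of diagrams start. -/
def start (x : (obj (obj X)).Cell) : ℕ → ℕ → ℕ
  | 0 => fun _ => 0
  | m + 1 => off ((lv x m).map Prod.snd)

theorem lv_join (x : (obj (obj X)).Cell) (m : ℕ) :
    lv (Hom.onCell (joinHom X) x) m = expand (start x m) (lv x m) := by
  cases m <;> rfl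

theorem expand_append (o : ℕ → ℕ) {m : ℕ} (L M : List (ℕ × Lab X m)) :
    expand o (L ++ M) = expand o L ++ expand o M := by simp [expand]

theorem expand_congr {o o' : ℕ → ℕ} {m : ℕ} {L : List (ℕ × Lab X m)}
    (h : ∀ r ∈ L, o r.1 = o' r.1) : expand o L = expand o' L :=
  flatMap_congr_mem _ _ _ fun r hr => by rw [h r hr]

theorem expand_sh {o o' : ℕ → ℕ} {m s s' : ℕ} {L : List (ℕ × Lab X m)}
    (h : ∀ r ∈ L, o (s + r.1) = s' + o' r.1) : expand o (sh s L) = sh s' (expand o' L) := by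
  have e : sh s' (expand o' L) = L.flatMap fun p => (p.2.lvl m).map fun r =>
      (s' + (o' p.1 + r.1), r.2) := by
    simp [sh, expand, List.map_flatMap, Function.comp_def]
  rw [e, expand, sh, List.flatMap_map]
  refine flatMap_congr_mem _ _ _ fun r hr => ?_
  simp only [h r hr, Nat.add_assoc]

theorem off_append_left {m : ℕ} (a b : List (Lab X m)) {q : ℕ} (h : q ≤ a.length) :
    off (a ++ b) q = off a q := by
  rw [off, off, List.map_append, List.take_append_of_le_length (by simpa using h)]

theorem off_append_right {m : ℕ} (a b : List (Lab X m)) (q : ℕ) :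
    off (a ++ b) (a.length + q) = (a.flatMap fun E => E.top m).length + off b q := by
  have e : a.length = (a.map fun E => (E.lvl m).length).length := by simp
  rw [off, off, List.map_append, e, List.take_length_add_append, List.sum_append]
  congr 1
  simp [List.length_flatMap, top]

theorem lv_fst_lt {x : (obj X).Cell} {m : ℕ} {r : ℕ × X.cell (m + 1)} (h : r ∈ lv x (m + 1)) :
    r.1 < (lv x m).length := by
  have h1 := fits_mem x.2 m (fun _ => ()) (fun _ => rfl) r h
  have := (List.getElem?_eq_some_iff.1 h1).1
  rw [top, List.length_map, List.length_map] at this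
  exact this

/-- Expanding the dots commutes with concatenating lists, so only the positions need an argument:
the start of the block over a position is determined by the sizes of the diagrams labelling the
preceding dots of the level below. -/
theorem join_preserves (X : GSet.{u} n) : (str (obj X)).Preserves (str X) (joinHom X) := by
  refine ⟨fun x y h => ?_, fun x h => ?_⟩
  · refine cell_ext rfl fun p _ => ?_
    have h' := h.map (joinHom X)
    rw [lv_join]
    refine (?_ : _ = lv (compCell _ _ h') p)
    change expand (start (compCell x y h) p) (lv (compCell x y h) p) = _
    obtain ⟨m, hm⟩ := h.exists_dim
    have hm' : min (Hom.onCell (joinHom X) x).dim (Hom.onCell (joinHom X) y).dim = m + 1 := hm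
    rw [lv_comp h', cmp, hm', lv_comp h, cmp, hm, lv_join, lv_join, lv_join]
    by_cases hp : p < m + 1
    · rw [if_pos hp, if_pos hp]
      cases p with
      | zero => rfl
      | succ q => rw [start, start, lv_comp_lt h (by omega)]
    · obtain ⟨q, rfl⟩ : ∃ q, p = q + 1 := ⟨p - 1, by omega⟩
      rw [if_neg hp, if_neg hp, expand_append, start]
      rcases (show q = m ∨ q = m + 1 ∨ m + 1 < q by omega) with rfl | rfl | hq
      · rw [lv_comp_lt h (by omega), if_neg (by omega), if_neg (by omega)]
        congr 1
        rw [sh_zero, sh_zero]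
        apply expand_congr
        intro r _
        rw [start, off, off, composable_snd h hm, fin]
        -- The dots of `x` refer to the labels reached after the dots of `y`. Passing a dot replaces
        -- a diagram by one of the same size, so offsets computed from the initial labels of `y` are
        -- also right for `x`.
        have hl : ∀ E : Lab X (q + 1), (E.src.lvl q).length = (E.tgt.lvl q).length := by
          intro E
          rw [← List.length_map (f := Prod.fst), ← List.length_map (f := Prod.fst)
            (as := E.tgt.lvl q), tgt_fst _ _ le_rfl, src_lvl _ le_rfl]
        have := out_inv y.2 q (fun E : Lab X q => (E.lvl q).length) hl
        exact congrArg (fun L => (L.take r.1).sum) this.symm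
      · rw [lv_comp_eq h (by omega), if_pos rfl, if_pos rfl, List.map_append]
        congr 1
        · apply expand_congr
          intro r hr
          rw [start, off_append_left _ _ (by simpa using (lv_fst_lt hr).le)]
        -- Moving a dot of `x` past all dots of `y` adds to its offset the total size of the
        -- diagrams labelling these, which is the length of the expanded level of `y`.
        · apply expand_sh
          intro r _
          have := off_append_right ((lv y (m + 1)).map Prod.snd) ((lv x (m + 1)).map Prod.snd) r.1
          rw [List.length_map] at this
          rw [this, start, ← expand_snd (start y (m + 1)), List.length_map]
          rfl
      · rw [if_neg (by omega), if_neg (by omega), sh_zero, sh_zero]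
        rcases (show x.dim < q ∨ y.dim < q by omega) with e | e
        · rw [lv_top (x := x) (m := q + 1) (by omega), lv_comp_right h e]
          rfl
        · rw [lv_top (x := y) (m := q + 1) (by omega)]
          have e1 : (lv (compCell x y h) q).map Prod.snd = (lv x q).map Prod.snd := by
            rcases (show q = y.dim + 1 ∨ y.dim + 1 < q by omega) with e' | e'
            · rw [lv_comp_succ h rfl e', sh_snd]
            · rw [lv_comp_left h e']
          rw [e1]
          rfl
  · exact cell_ext rfl fun p _ => by cases p <;> rfl

/-- The diagram obtained by adding a list of dots in a new top dimension. -/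
def addTop (w : (obj X).Cell) {d : ℕ} (hd : w.dim = d) (hn : d + 1 ≤ n)
    (L : List (ℕ × X.cell (d + 1))) (hL : Fits ((lv w d).map Prod.snd) (moves X L)) :
    (obj X).Cell :=
  ⟨d + 1,
    { lvl := Function.update (lv w) (d + 1) L
      le := hn
      lvl_zero := by
        rw [Function.update_of_ne (by omega)]
        exact lv_zero w
      lvl_top := fun m hm => by
        rw [Function.update_of_ne (by omega)]
        exact lv_top (by omega)
      fits := fun m => by
        rcases (show m = d + 1 ∨ m = d ∨ (m ≠ d + 1 ∧ m + 1 ≠ d + 1) by omega) with rfl | rfl | h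
        · rw [Function.update_of_ne (show d + 1 + 1 ≠ d + 1 by omega), lv_top (x := w) (by omega)]
          trivial
        · rw [Function.update_self, Function.update_of_ne (by omega)]
          exact hL
        · rw [Function.update_of_ne h.1, Function.update_of_ne h.2]
          exact lv_fits w m }⟩

section

variable {w : (obj X).Cell} {d : ℕ} {hd : w.dim = d} {hn : d + 1 ≤ n}
  {L : List (ℕ × X.cell (d + 1))} {hL : Fits ((lv w d).map Prod.snd) (moves X L)}

theorem dim_addTop : (addTop w hd hn L hL).dim = d + 1 := rfl

theorem lv_addTop_self : lv (addTop w hd hn L hL) (d + 1) = L :=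
  show Function.update (lv w) (d + 1) L (d + 1) = L from Function.update_self _ _ _

theorem lv_addTop {p : ℕ} (h : p ≤ d) : lv (addTop w hd hn L hL) p = lv w p :=
  show Function.update (lv w) (d + 1) L p = _ from Function.update_of_ne (by omega) _ _

theorem s_addTop : (addTop w hd hn L hL).s = w :=
  cell_ext (by rw [dim_s, dim_addTop, hd]; rfl) fun p hp => by
    rw [dim_s, dim_addTop] at hp
    rw [lv_s (by rw [dim_addTop]; omega), lv_addTop (by omega)]

theorem fin_addTop : fin (addTop w hd hn L hL) d = run ((lv w d).map Prod.snd) (moves X L) := by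
  rw [fin, lv_addTop_self, lv_addTop le_rfl]

theorem lv_t_addTop : lv (addTop w hd hn L hL).t d =
    relabel (lv w d) (run ((lv w d).map Prod.snd) (moves X L)) := by
  rw [lv_t_self dim_addTop, fin_addTop, lv_addTop le_rfl]

theorem snd_t_addTop : (lv (addTop w hd hn L hL).t d).map Prod.snd =
    run ((lv w d).map Prod.snd) (moves X L) := by
  rw [lv_t_addTop, relabel_snd]
  simp [run_length]

end

theorem composable_of_s_eq_t (h1 : 1 ≤ x.dim) (h : x.dim = y.dim) (hst : x.s = y.t) :
    Composable x y := by
  obtain ⟨d, hd⟩ : ∃ d, x.dim = d + 1 := ⟨x.dim - 1, by omega⟩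
  refine .of_eq (m := d) (by omega) ?_
  rw [← s_eq_bs hd, ← t_eq_bt (by omega), hst]

/-- The cells obtained from the image of the unit by applying operations. -/
inductive Gen : (obj X).Cell → Prop
  | pure (x : X.Cell) : Gen (Hom.onCell (pureHom X) x)
  | comp {x y : (obj X).Cell} (h : Composable x y) : Gen x → Gen y → Gen (compCell x y h)
  | unit {x : (obj X).Cell} (h : x.dim < n) : Gen x → Gen (unitCell x h)

/-- With one dot on every level all positions are 0, and fitting forces each label to be the source
of the next one. -/
theorem exists_pure {k : ℕ} (hk : z.dim = k) (h : ∀ p ≤ k, (lv z p).length = 1) :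
    ∃ a : X.cell k, z = Hom.onCell (pureHom X) ⟨k, a⟩ ∧ lv z k = [(0, a)] := by
  induction k generalizing z with
  | zero =>
    obtain ⟨a, ha⟩ := lv_zero z
    refine ⟨a, cell_ext hk fun p hp => ?_, ha⟩
    obtain rfl : p = 0 := by omega
    rw [ha]; exact (down_self a).symm
  | succ k ih =>
    obtain ⟨a, ha, ha'⟩ := ih (z := z.s) (by rw [dim_s]; omega) fun p hp => by
      rw [lv_s (by omega)]; exact h p (by omega)
    obtain ⟨⟨q, b⟩, hb⟩ := List.length_eq_one_iff.1 (h (k + 1) le_rfl)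
    have hf := lv_fits z k
    rw [lv_s (by omega)] at ha'
    rw [ha', hb] at hf
    have hf' : ([a] : List (X.cell k))[q]? = some (X.src b) := hf.1
    obtain rfl : q = 0 := by
      have := (List.getElem?_eq_some_iff.1 hf').1
      simpa using this
    have hab : a = X.src b := by simpa using hf'
    subst hab
    refine ⟨b, cell_ext hk fun p hp => ?_, hb⟩
    rcases (show p = k + 1 ∨ p < k + 1 by omega) with rfl | hp
    · rw [hb]; exact (down_self b).symm
    · rw [← lv_s (by omega), ha]
      exact (down_succ b (by omega)).symm

/-- Induction on `d`. Suppose that `z` has one dot on each level above `d + 1`. Cutting level `d +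
1` before and after the dot which carries the next one writes `z` as `E3 ∘ V ∘ E1`, with `E1` and
`E3` of dimension `d + 1`, hence generated, and with `V` having one dot on each level above `d`. For
`d = 0` nothing remains but a generator. -/
theorem gen_narrow {d : ℕ} (H : ∀ y : (obj X).Cell, y.dim ≤ d → Gen y) {k : ℕ} (hk : z.dim = k)
    (hdk : d < k) (h : ∀ p, d < p → p ≤ k → (lv z p).length = 1) : Gen z := by
  induction d generalizing z with
  | zero =>
    obtain ⟨a, ha, -⟩ := exists_pure hk fun p hp => by
      rcases Nat.eq_zero_or_pos p with rfl | hp'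
      · obtain ⟨a, ha⟩ := lv_zero z
        rw [ha]; rfl
      · exact h p hp' hp
    rw [ha]; exact .pure _
  | succ d ih =>
    have hkn : k ≤ n := hk ▸ GSet.Cell.le_dim z
    have hw : (bs d z).dim = d := by rw [dim_bs]; omega
    have hwl : ∀ p ≤ d, lv (bs d z) p = lv z p := fun p hp => lv_bs hp
    -- The only dot of dimension `d + 2`. It lies over position `q` of level `d + 1`, whose label
    -- `a` will turn out to be the source of `b`.
    obtain ⟨⟨q, b⟩, hb⟩ := List.length_eq_one_iff.1 (h (d + 2) (by omega) (by omega))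
    have hq : q < (lv z (d + 1)).length := lv_fst_lt (r := (q, b)) (by rw [hb]; simp)
    obtain ⟨L1, r, a, L2, hL, hL1⟩ : ∃ L1 r a L2, lv z (d + 1) = L1 ++ (r, a) :: L2 ∧
        L1.length = q :=
      ⟨(lv z (d + 1)).take q, ((lv z (d + 1))[q]).1, ((lv z (d + 1))[q]).2,
        (lv z (d + 1)).drop (q + 1), by simp, by simp [hq.le]⟩
    have hf := lv_fits z d
    rw [hL, moves_append, fits_append, ← hwl d le_rfl] at hf
    -- The diagrams `E1`, `E2`, `E3` perform the dots `L1`, the dot `a`, and the dots `L2`; each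
    -- starts at the target of the preceding one, and `E2` will be the lower part of `V`.
    let E1 := addTop (bs d z) hw (by omega) L1 hf.1
    have hf2 : Fits ((lv E1.t d).map Prod.snd) (moves X [(r, a)]) := by
      rw [snd_t_addTop]; exact ⟨hf.2.1, trivial⟩
    have h1t : E1.t.dim = d := by rw [dim_t, dim_addTop]; rfl
    let E2 := addTop E1.t h1t (by omega) [(r, a)] hf2
    have hf3 : Fits ((lv E2.t d).map Prod.snd) (moves X L2) := by
      rw [snd_t_addTop, snd_t_addTop]; exact hf.2.2
    have h2t : E2.t.dim = d := by rw [dim_t, dim_addTop]; rfl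
    let E3 := addTop E2.t h2t (by omega) L2 hf3
    have hfz := lv_fits z (d + 1)
    rw [hL, hb] at hfz
    have hab : a = X.src b := by
      have : ((L1 ++ (r, a) :: L2).map Prod.snd)[q]? = some (X.src b) := hfz.1
      rw [← hL1] at this
      simpa using this
    -- This is `z` without the dots `L1` and `L2`. Its dots of dimension at most `d` carry the
    -- labels reached after `L1`, and `b` now lies over position 0.
    let V : (obj X).Cell := ⟨k,
      { lvl := fun p => if h : p = d + 2 then h ▸ [(0, b)] else
          if p ≤ d + 1 then lv E2 p else lv z p
        le := hkn
        lvl_zero := by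
          rw [dif_neg (by omega), if_pos (by omega)]
          exact lv_zero E2
        lvl_top := fun m hm => by
          rw [dif_neg (by omega), if_neg (by omega)]
          exact lv_top (by omega)
        fits := fun m => by
          rcases (show m ≤ d ∨ m = d + 1 ∨ m = d + 2 ∨ d + 2 < m by omega) with hm | rfl | rfl | hm
          · rw [dif_neg (by omega), if_pos (by omega), dif_neg (by omega), if_pos (by omega)]
            exact lv_fits E2 m
          · rw [dif_neg (by omega), if_pos (by omega), dif_pos rfl, lv_addTop_self]
            exact ⟨congrArg some hab, trivial⟩
          · rw [dif_pos rfl, dif_neg (by omega), if_neg (by omega)]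
            have := lv_fits z (d + 2)
            rwa [hb] at this
          · rw [dif_neg (by omega), if_neg (by omega), dif_neg (by omega), if_neg (by omega)]
            exact lv_fits z m }⟩
    have hVd : V.dim = k := rfl
    have hVlow : ∀ p ≤ d + 1, lv V p = lv E2 p := fun p hp =>
      (dif_neg (by omega)).trans (if_pos hp)
    have hVmid : lv V (d + 2) = [(0, b)] := dif_pos rfl
    have hVhigh : ∀ p, d + 2 < p → lv V p = lv z p := fun p hp =>
      (dif_neg (by omega)).trans (if_neg (by omega))
    have hbs : bs (d + 1) V = E2 := by
      apply cell_ext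
      · rw [dim_bs, hVd, dim_addTop]; omega
      · intro p hp
        rw [dim_bs] at hp
        rw [lv_bs (by omega), hVlow p (by omega)]
    have hbsd : bs d V = E1.t := by
      rw [← bs_bs (show d ≤ d + 1 by omega), hbs, ← s_eq_bs dim_addTop, s_addTop]
    have hbtd : bt d V = E2.t := by
      rw [← bt_bs (show d < d + 1 by omega), hbs, ← t_eq_bt dim_addTop]
    have c1 : Composable V E1 := .of_eq (m := d) (by rw [hVd, dim_addTop]; omega) (by
      rw [hbsd, ← t_eq_bt dim_addTop])
    have c2 : Composable E3 V := .of_eq (m := d) (by rw [hVd, dim_addTop]; omega) (by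
      rw [hbtd, ← s_eq_bs dim_addTop, s_addTop])
    have c3 : Composable E3 (compCell V E1 c1) := by
      have := SesquiStr.composable_c_right (S := str X) c2 c1
        (.inr (.inl ⟨rfl, by rw [hVd, dim_addTop]; omega⟩))
      rwa [SesquiStr.c_eq c1] at this
    have hz : z = compCell E3 (compCell V E1 c1) c3 := by
      have e1 : (compCell V E1 c1).dim = k := by rw [dim_compCell, hVd, dim_addTop]; omega
      apply cell_ext
      · rw [dim_compCell, e1, dim_addTop]; omega
      · intro p hp
        rcases (show p ≤ d ∨ p = d + 1 ∨ p = d + 2 ∨ d + 2 < p by omega) with hp | rfl | rfl | hp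
        · rw [lv_comp_lt c3 (by rw [e1, dim_addTop]; omega),
            lv_comp_lt c1 (by rw [hVd, dim_addTop]; omega), lv_addTop hp, hwl p hp]
        · rw [lv_comp_eq c3 (by rw [e1, dim_addTop]; omega),
            lv_comp_eq c1 (by rw [hVd, dim_addTop]; omega), lv_addTop_self, hVlow _ le_rfl,
            lv_addTop_self, lv_addTop_self, hL]
          simp
        · rw [lv_comp_right c3 (by rw [dim_addTop]; omega), lv_comp_succ c1 dim_addTop rfl,
            lv_addTop_self, hVmid, hb]
          simp [sh, hL1]
        · rw [lv_comp_right c3 (by rw [dim_addTop]; omega), lv_comp_left c1 (by rw [dim_addTop]; omega),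
            hVhigh p hp]
    rw [hz]
    refine .comp _ (H _ le_rfl) (.comp _ (ih (fun y hy => H y (by omega)) hVd (by omega) ?_)
      (H _ le_rfl))
    intro p hp hpk
    rcases (show p = d + 1 ∨ p = d + 2 ∨ d + 2 < p by omega) with rfl | rfl | hp'
    · rw [hVlow _ le_rfl, lv_addTop_self]; rfl
    · rw [hVmid]; rfl
    · rw [hVhigh p hp']; exact h p (by omega) hpk

/-- Induction on the dimension and on the list of top dots. Without top dots `z` is the unit on its
source; otherwise the first top dot is split off as a diagram with a single top dot, to which
`gen_narrow` applies. -/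
theorem gen_all (z : (obj X).Cell) : Gen z := by
  induction hk : z.dim using Nat.strong_induction_on generalizing z with
  | _ k IH =>
    cases k with
    | zero =>
      obtain ⟨a, ha, -⟩ := exists_pure hk fun p hp => by
        obtain rfl : p = 0 := by omega
        obtain ⟨a, ha⟩ := lv_zero z
        rw [ha]; rfl
      rw [ha]; exact .pure _
    | succ d =>
      have hkn : d + 1 ≤ n := hk ▸ GSet.Cell.le_dim z
      obtain ⟨L, hL⟩ : ∃ L, lv z (d + 1) = L := ⟨_, rfl⟩
      induction L generalizing z with
      | nil =>
        have hd : z.s.dim = d := by rw [dim_s]; omega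
        have : z = unitCell z.s (by omega) := by
          apply cell_ext
          · rw [dim_unitCell]; omega
          · intro p hp
            rw [lv_unitCell]
            rcases (show p = d + 1 ∨ p < d + 1 by omega) with rfl | hp
            · rw [hL, lv_top (by omega)]
            · rw [lv_s (by omega)]
        rw [this]
        exact .unit _ (IH d (by omega) _ hd)
      | cons r L ihL =>
        have hw : z.s.dim = d := by rw [dim_s]; omega
        have hf := lv_fits z d
        rw [hL, ← lv_s (by omega)] at hf
        have hf1 : Fits ((lv z.s d).map Prod.snd) (moves X [r]) := ⟨hf.1, trivial⟩
        let E1 := addTop z.s hw hkn [r] hf1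
        have h1t : E1.t.dim = d := by rw [dim_t, dim_addTop]; rfl
        have hf2 : Fits ((lv E1.t d).map Prod.snd) (moves X L) := by
          rw [snd_t_addTop]; exact hf.2
        let E2 := addTop E1.t h1t hkn L hf2
        have c : Composable E2 E1 := composable_of_s_eq_t (by rw [dim_addTop]; omega) rfl s_addTop
        have hz : z = compCell E2 E1 c := by
          apply cell_ext
          · rw [dim_compCell, dim_addTop, dim_addTop, hk]; omega
          · intro p hp
            rcases (show p = d + 1 ∨ p < d + 1 by omega) with rfl | hp
            · rw [lv_comp_eq c (by rw [dim_addTop, dim_addTop]; omega), lv_addTop_self, lv_addTop_self, hL]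
              rfl
            · rw [lv_comp_lt c (by rw [dim_addTop, dim_addTop]; omega), lv_addTop (by omega),
                lv_s (by omega)]
        rw [hz]
        refine .comp _ (ihL _ dim_addTop lv_addTop_self) ?_
        refine gen_narrow (d := d) (fun y hy => IH y.dim (by omega) y rfl) dim_addTop (by omega) ?_
        intro p hp hp'
        obtain rfl : p = d + 1 := by omega
        rw [lv_addTop_self]; rfl

end Lab

end Sesqui

namespace Sesqui

open GSet GSet.Cell

/-! ### The evaluation of diagrams -/

/-- A cell of given dimension as a cell. -/
def GSet.Cell.of {n : ℕ} {C : GSet.{u} n} {d : ℕ} (y : C.cell d) : C.Cell := ⟨d, y⟩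

/-- Lists of labelled dots of dimensions `0, …, d`. -/
inductive Dots {n : ℕ} (C : GSet.{u} n) : ℕ → Type u
  | base (x : C.cell 0) : Dots C 0
  | snoc {d : ℕ} (P : Dots C d) (L : List (ℕ × C.cell (d + 1))) : Dots C (d + 1)

namespace Dots

variable {n : ℕ} {C : GSet.{u} n} {d : ℕ}

/-- The labels of the dots of the highest dimension. -/
def top : ∀ {d : ℕ}, Dots C d → List (C.cell d)
  | _, base x => [x]
  | _, snoc _ L => L.map Prod.snd

/-- Changing the labels of the dots of the highest dimension. -/
def setTop : ∀ {d : ℕ}, Dots C d → List (C.cell d) → Dots C d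
  | _, base x, ys => base (ys.headD x)
  | _, snoc P L, ys => snoc P (relabel L ys)

/-- The diagram reached after passing a list of dots of the next dimension. -/
def adv (P : Dots C d) (L : List (ℕ × C.cell (d + 1))) : Dots C d :=
  P.setTop (run P.top (moves C L))

/-- Every dot is attached to the dots of lower dimension. -/
def Valid : ∀ {d : ℕ}, Dots C d → Prop
  | _, base _ => True
  | _, snoc P L => P.Valid ∧ Fits P.top (moves C L)

theorem top_setTop (P : Dots C d) {ys : List (C.cell d)} (h : P.top.length = ys.length) :
    (P.setTop ys).top = ys := by
  cases P with
  | base x =>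
    obtain ⟨y, rfl⟩ := List.length_eq_one_iff.1 h.symm
    rfl
  | snoc P L => exact relabel_snd _ _ (by simpa [top] using h)

theorem setTop_setTop (P : Dots C d) {ys zs : List (C.cell d)} (h : P.top.length = ys.length)
    (h' : P.top.length = zs.length) : (P.setTop ys).setTop zs = P.setTop zs := by
  cases P with
  | base x =>
    obtain ⟨y, rfl⟩ := List.length_eq_one_iff.1 h.symm
    obtain ⟨z, rfl⟩ := List.length_eq_one_iff.1 h'.symm
    rfl
  | snoc P L =>
    have h1 : L.length = ys.length := by simpa [top] using h
    have h2 : L.length = zs.length := by simpa [top] using h'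
    have h3 : (relabel L ys).length = L.length := by simp [relabel, h1]
    refine congrArg (snoc P) (pair_ext ?_ ?_)
    · rw [relabel_fst _ _ (h3.trans h2), relabel_fst _ _ h1, relabel_fst _ _ h2]
    · rw [relabel_snd _ _ (h3.trans h2), relabel_snd _ _ h2]

theorem setTop_top (P : Dots C d) : P.setTop P.top = P := by
  cases P with
  | base x => rfl
  | snoc P L => exact congrArg (snoc P) (relabel_self L)

theorem top_adv (P : Dots C d) (L : List (ℕ × C.cell (d + 1))) :
    (P.adv L).top = run P.top (moves C L) :=
  top_setTop _ (run_length _ _).symm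

@[simp] theorem adv_nil (P : Dots C d) : P.adv [] = P := setTop_top P

theorem adv_adv (P : Dots C d) (L M : List (ℕ × C.cell (d + 1))) :
    (P.adv L).adv M = P.adv (L ++ M) := by
  rw [adv, top_adv, adv, adv, setTop_setTop _ (run_length _ _).symm (by simp [run_length]),
    moves_append, run_append]

/-- Cells with the same boundary. -/
def Par : ∀ {d : ℕ}, C.cell d → C.cell d → Prop
  | 0, _, _ => True
  | _ + 1, x, y => C.src x = C.src y ∧ C.tgt x = C.tgt y

theorem par_src_tgt (x : C.cell (d + 1)) : Par (C.src x) (C.tgt x) := by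
  cases d with
  | zero => trivial
  | succ d => exact ⟨(C.src_tgt x).symm, C.tgt_src x⟩

/-- Passing the dots of `M` replaces the labels of `L` by parallel cells, so `L` performs the same
moves on the level below. This is why validity persists under `adv`. -/
theorem moves_run (L : List (ℕ × C.cell (d + 1))) (M : List (ℕ × C.cell (d + 1 + 1)))
    (h : Fits (L.map Prod.snd) (moves C M)) :
    moves C (relabel L (run (L.map Prod.snd) (moves C M))) = moves C L := by
  apply moves_relabel
  · refine run_map_inv _ _ _ h fun mv hm => ?_
    obtain ⟨r, -, rfl⟩ := List.mem_map.1 hm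
    exact (C.src_tgt r.2).symm
  · refine run_map_inv _ _ _ h fun mv hm => ?_
    obtain ⟨r, -, rfl⟩ := List.mem_map.1 hm
    exact C.tgt_src r.2

theorem Valid.adv {P : Dots C d} (hP : P.Valid) {L : List (ℕ × C.cell (d + 1))}
    (h : Fits P.top (moves C L)) : (P.adv L).Valid := by
  cases P with
  | base x => trivial
  | snoc P K =>
    refine ⟨hP.1, ?_⟩
    have := moves_run K L h
    rw [top, this]
    exact hP.2

theorem relabel_set {A : Type u} (L0 : List (ℕ × A)) (r : ℕ × A) (L1 : List (ℕ × A)) (y : A) :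
    relabel (L0 ++ r :: L1) (((L0 ++ r :: L1).map Prod.snd).set L0.length y) =
      L0 ++ (r.1, y) :: L1 := by
  apply pair_ext
  · rw [relabel_fst _ _ (by simp)]; simp
  · rw [relabel_snd _ _ (by simp)]; simp

theorem exists_split {P : Dots C d} {L : List (ℕ × C.cell (d + 1))} {q : ℕ} {y : C.cell (d + 1)}
    (h : (P.snoc L).top[q]? = some y) : ∃ L0 r L1, L = L0 ++ (r, y) :: L1 ∧ q = L0.length := by
  obtain ⟨hq, rfl⟩ := List.getElem?_eq_some_iff.1 h
  have hq' : q < L.length := by simpa [top] using hq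
  exact ⟨L.take q, L[q].1, L.drop (q + 1), by simp [top], by simp [hq'.le]⟩

section

variable (S : SesquiStr C)

/-- The composite of the dots of the next dimension, given the evaluation of diagrams `e` and the
evaluation `w` of whiskered cells. -/
noncomputable def evWith (e : Dots C d → C.Cell) (w : Dots C d → ℕ → C.Cell → C.Cell) :
    Dots C d → List (ℕ × C.cell (d + 1)) → C.Cell
  | P, [] => S.u (e P)
  | P, r :: L => S.c (evWith e w (P.adv [r]) L) (w P r.1 (of r.2))

/-- The evaluation of diagrams, and the evaluation of diagrams in which the label of a given dot
of the highest dimension is replaced by a cell. -/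
noncomputable def evPair :
    ∀ d : ℕ, (Dots C d → C.Cell) × (Dots C d → ℕ → C.Cell → C.Cell)
  | 0 => (fun | base x => of x, fun _ _ x => x)
  | d + 1 =>
    (fun | snoc P L => evWith S (evPair d).1 (evPair d).2 P L,
      fun | snoc P L => fun q x =>
        match L[q]? with
        | none => x
        | some r =>
          S.c (evWith S (evPair d).1 (evPair d).2 (P.adv (L.take (q + 1))) (L.drop (q + 1)))
            (S.c ((evPair d).2 (P.adv (L.take q)) r.1 x)
              (evWith S (evPair d).1 (evPair d).2 P (L.take q))))

/-- The composite of all cells of a diagram. -/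
noncomputable def ev (P : Dots C d) : C.Cell := (evPair S d).1 P

/-- The composite of all cells of a diagram, where the label of a dot of the highest dimension is
replaced by a cell. -/
noncomputable def whisk (P : Dots C d) (q : ℕ) (x : C.Cell) : C.Cell := (evPair S d).2 P q x

/-- The composite of a diagram and a list of dots of the next dimension. -/
noncomputable def evL (P : Dots C d) (L : List (ℕ × C.cell (d + 1))) : C.Cell :=
  evWith S (ev S) (whisk S) P L

theorem ev_snoc (P : Dots C d) (L : List (ℕ × C.cell (d + 1))) :
    ev S (P.snoc L) = evL S P L := rfl

theorem evL_nil (P : Dots C d) : evL S P [] = S.u (ev S P) := rfl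

theorem evL_cons (P : Dots C d) (r : ℕ × C.cell (d + 1)) (L : List (ℕ × C.cell (d + 1))) :
    evL S P (r :: L) = S.c (evL S (P.adv [r]) L) (whisk S P r.1 (of r.2)) := rfl

theorem whisk_snoc (P : Dots C d) (L0 : List (ℕ × C.cell (d + 1))) (r : ℕ × C.cell (d + 1))
    (L1 : List (ℕ × C.cell (d + 1))) (x : C.Cell) :
    whisk S (P.snoc (L0 ++ r :: L1)) L0.length x =
      S.c (evL S (P.adv (L0 ++ [r])) L1) (S.c (whisk S (P.adv L0) r.1 x) (evL S P L0)) := by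
  have e : (L0 ++ r :: L1)[L0.length]? = some r := by simp
  have e1 : (L0 ++ r :: L1).take (L0.length + 1) = L0 ++ [r] := by simp [List.take_append]
  have e2 : (L0 ++ r :: L1).drop (L0.length + 1) = L1 := by simp [List.drop_append]
  have e3 : (L0 ++ r :: L1).take L0.length = L0 := by simp
  simp only [whisk, evPair, e, e1, e2, e3]
  rfl

/-- The label at position `q` is replaced anyway; it enters the value only through the move it
performs, that is, through its boundary. -/
theorem whisk_setTop (P : Dots C d) {q : ℕ} {y y' : C.cell d} (h : P.top[q]? = some y)
    (hp : Par y y') (x : C.Cell) : whisk S (P.setTop (P.top.set q y')) q x = whisk S P q x := by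
  cases P with
  | base a => rfl
  | snoc P L =>
    obtain ⟨L0, r, L1, rfl, rfl⟩ := exists_split h
    have e : moves C (L0 ++ [(r, y')]) = moves C (L0 ++ [(r, y)]) := by
      simp [moves, hp.1, hp.2]
    rw [setTop, top, relabel_set, whisk_snoc, whisk_snoc]
    simp only [adv, e]

/-- A cell which can replace the cell `y` in a diagram. -/
def Fills (x : C.Cell) (y : C.cell d) : Prop :=
  d ≤ x.dim ∧ ∀ p < d, bs p x = bs p (of y) ∧ bt p x = bt p (of y)

theorem dim_of (y : C.cell d) : (of y : C.Cell).dim = d := rfl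

theorem s_of (y : C.cell (d + 1)) : (of y : C.Cell).s = of (C.src y) := rfl

theorem t_of (y : C.cell (d + 1)) : (of y : C.Cell).t = of (C.tgt y) := rfl

theorem bs_of (y : C.cell (d + 1)) : bs d (of y : C.Cell) = of (C.src y) := by
  rw [← s_eq_bs (dim_of y), s_of]

theorem bt_of (y : C.cell (d + 1)) : bt d (of y : C.Cell) = of (C.tgt y) := by
  rw [← t_eq_bt (dim_of y), t_of]

theorem fills_self (y : C.cell d) : Fills (of y) y := ⟨le_rfl, fun _ _ => ⟨rfl, rfl⟩⟩

theorem Fills.bs {x : C.Cell} {y : C.cell (d + 1)} (h : Fills x y) : bs d x = of (C.src y) := by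
  rw [(h.2 d d.lt_succ_self).1, bs_of]

theorem Fills.bt {x : C.Cell} {y : C.cell (d + 1)} (h : Fills x y) : bt d x = of (C.tgt y) := by
  rw [(h.2 d d.lt_succ_self).2, bt_of]

/-- In the diagram one dimension lower, a cell filling the dot `y` takes the place of the source of
`y`. This drives the recursion for `whisk`. -/
theorem Fills.src {x : C.Cell} {y : C.cell (d + 1)} (h : Fills x y) : Fills x (C.src y) := by
  refine ⟨(Nat.le_succ d).trans h.1, fun p hp => ?_⟩
  rw [← h.bs, bs_bs hp.le, bt_bs hp]
  exact ⟨rfl, rfl⟩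

theorem Fills.s {x : C.Cell} {y : C.cell d} (h : Fills x y) (hd : d < x.dim) : Fills x.s y := by
  refine ⟨by rw [dim_s]; omega, fun p hp => ?_⟩
  rw [bs_s (by omega), bt_s (by omega)]
  exact h.2 p hp

theorem Fills.t {x : C.Cell} {y : C.cell d} (h : Fills x y) (hd : d < x.dim) : Fills x.t y := by
  refine ⟨by rw [dim_t]; omega, fun p hp => ?_⟩
  rw [bs_t (by omega), bt_t (by omega)]
  exact h.2 p hp

/-- Properties of the evaluation of a diagram. -/
structure Evaluates (P : Dots C d) : Prop where
  dim : (ev S P).dim = d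
  dim_whisk : ∀ q y x, P.top[q]? = some y → Fills x y → (whisk S P q x).dim = x.dim
  s_whisk : ∀ q y x, P.top[q]? = some y → Fills x y → d < x.dim →
    (whisk S P q x).s = whisk S P q x.s
  t_whisk : ∀ q y x, P.top[q]? = some y → Fills x y → d < x.dim →
    (whisk S P q x).t = whisk S P q x.t
  whisk_of : ∀ q y, P.top[q]? = some y → whisk S P q (of y) = ev S P

/-- Properties of the evaluation of a list of dots. -/
structure EvaluatesL (P : Dots C d) (L : List (ℕ × C.cell (d + 1))) : Prop where
  dim : (evL S P L).dim = d + 1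
  s : (evL S P L).s = ev S P
  t : (evL S P L).t = ev S (P.adv L)

variable {S}

theorem Evaluates.bs_whisk {P : Dots C d} (h : Evaluates S P) {q : ℕ} {y : C.cell d} {x : C.Cell}
    (hy : P.top[q]? = some y) (hx : Fills x y) {p : ℕ} (hp : d ≤ p) :
    GSet.Cell.bs p (whisk S P q x) = whisk S P q (GSet.Cell.bs p x) := by
  refine cell_induction (P := fun p x => d ≤ p → Fills x y →
    GSet.Cell.bs p (whisk S P q x) = whisk S P q (GSet.Cell.bs p x)) p ?_ ?_ x hp hx
  · intro x h1 _ h2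
    rw [bs_of_le (by rwa [h.dim_whisk _ _ _ hy h2]), bs_of_le h1]
  · intro x h1 h2 _ h3 h4
    rw [← bs_s (by rwa [h.dim_whisk _ _ _ hy h4]), h.s_whisk _ _ _ hy h4 (by omega),
      h2 h3 (h4.s (by omega)), bs_s h1]

theorem Evaluates.bt_whisk {P : Dots C d} (h : Evaluates S P) {q : ℕ} {y : C.cell d} {x : C.Cell}
    (hy : P.top[q]? = some y) (hx : Fills x y) {p : ℕ} (hp : d ≤ p) :
    GSet.Cell.bt p (whisk S P q x) = whisk S P q (GSet.Cell.bt p x) := by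
  refine cell_induction (P := fun p x => d ≤ p → Fills x y →
    GSet.Cell.bt p (whisk S P q x) = whisk S P q (GSet.Cell.bt p x)) p ?_ ?_ x hp hx
  · intro x h1 _ h2
    rw [bt_of_le (by rwa [h.dim_whisk _ _ _ hy h2]), bt_of_le h1]
  · intro x h1 _ h2 h3 h4
    rw [← bt_t (by rwa [h.dim_whisk _ _ _ hy h4]), h.t_whisk _ _ _ hy h4 (by omega),
      h2 h3 (h4.t (by omega)), bt_t h1]

theorem top_adv_singleton (P : Dots C d) (r : ℕ × C.cell (d + 1)) :
    (P.adv [r]).top = P.top.set r.1 (C.tgt r.2) := top_adv P [r]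

theorem whisk_adv {P : Dots C d} {r : ℕ × C.cell (d + 1)}
    (h : P.top[r.1]? = some (C.src r.2)) (x : C.Cell) :
    whisk S (P.adv [r]) r.1 x = whisk S P r.1 x :=
  whisk_setTop S P h (par_src_tgt r.2) x

/-- The boundary of a whiskered cell of higher dimension. -/
theorem Evaluates.bs_whisk_src {P : Dots C d} (h : Evaluates S P) {q : ℕ} {y : C.cell (d + 1)}
    {x : C.Cell} (hy : P.top[q]? = some (C.src y)) (hx : Fills x y) :
    GSet.Cell.bs d (whisk S P q x) = ev S P := by
  rw [h.bs_whisk hy hx.src le_rfl, hx.bs, h.whisk_of _ _ hy]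

/-- The target of the whiskered cell is the target of `y` whiskered in `P`. Since `whisk` does not
see the label at `q`, `P` may be replaced by the diagram after the dot, whose label at `q` is that
target. -/
theorem Evaluates.bt_whisk_tgt {P : Dots C d} {q : ℕ} {y : C.cell (d + 1)}
    (h : Evaluates S P) (h' : Evaluates S (P.adv [(q, y)]))
    {x : C.Cell} (hy : P.top[q]? = some (C.src y)) (hx : Fills x y) :
    GSet.Cell.bt d (whisk S P q x) = ev S (P.adv [(q, y)]) := by
  rw [h.bt_whisk hy hx.src le_rfl, hx.bt, ← whisk_adv (r := (q, y)) hy, h'.whisk_of]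
  rw [top_adv_singleton]
  have := (List.getElem?_eq_some_iff.1 hy).1
  simp [this]

/-- Each dot, whiskered in the diagram reached so far, is a cell from the value of this diagram to
the value of the next one, so consecutive dots compose. The hypothesis concerns all valid diagrams
because `P` advances along the list. -/
theorem evaluatesL (H : ∀ P : Dots C d, P.Valid → Evaluates S P) (hn : d + 1 ≤ n) {P : Dots C d}
    (hP : P.Valid) {L : List (ℕ × C.cell (d + 1))} (hL : Fits P.top (moves C L)) :
    EvaluatesL S P L := by
  induction L generalizing P with
  | nil =>
    have h := (H P hP).dim
    refine ⟨?_, ?_, ?_⟩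
    · rw [evL_nil, SesquiStr.dim_u (by omega), h]
    · rw [evL_nil, SesquiStr.s_u (by omega)]
    · rw [evL_nil, SesquiStr.t_u (by omega), adv_nil]
  | cons r L ih =>
    have hr : Fits P.top (moves C [r]) := ⟨hL.1, trivial⟩
    have hP' := hP.adv hr
    have h1 := ih hP' (by rw [top_adv]; exact hL.2)
    have hd : (whisk S P r.1 (of r.2)).dim = d + 1 :=
      (H P hP).dim_whisk _ _ _ hL.1 (fills_self r.2).src
    have hs : (whisk S P r.1 (of r.2)).s = ev S P := by
      rw [s_eq_bs hd]; exact (H P hP).bs_whisk_src hL.1 (fills_self r.2)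
    have ht : (whisk S P r.1 (of r.2)).t = ev S (P.adv [r]) := by
      rw [t_eq_bt hd]; exact (H P hP).bt_whisk_tgt (H _ hP') hL.1 (fills_self r.2)
    have hc : Composable (evL S (P.adv [r]) L) (whisk S P r.1 (of r.2)) :=
      .of_eq (m := d) (by rw [h1.dim, hd]; omega) (by
        rw [← s_eq_bs h1.dim, ← t_eq_bt hd, h1.s, ht])
    refine ⟨?_, ?_, ?_⟩
    · rw [evL_cons, SesquiStr.dim_c hc, h1.dim, hd]; omega
    · rw [evL_cons, SesquiStr.s_c_eq hc (by rw [h1.dim, hd]), hs]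
    · rw [evL_cons, SesquiStr.t_c_eq hc (by rw [h1.dim, hd]), h1.t, adv_adv]; rfl

theorem EvaluatesL.composable {P : Dots C d} {L M : List (ℕ × C.cell (d + 1))}
    (h1 : EvaluatesL S (P.adv L) M) (h2 : EvaluatesL S P L) :
    Composable (evL S (P.adv L) M) (evL S P L) :=
  .of_eq (m := d) (by rw [h1.dim, h2.dim]; omega) (by
    rw [← s_eq_bs h1.dim, ← t_eq_bt h2.dim, h1.s, h2.t])

theorem composable_evL_whisk (H : ∀ P : Dots C d, P.Valid → Evaluates S P) (hn : d + 1 ≤ n)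
    {P : Dots C d} (hP : P.Valid) {r : ℕ} {y : C.cell (d + 1)} {x : C.Cell}
    {L : List (ℕ × C.cell (d + 1))} (hL : Fits P.top (moves C ((r, y) :: L))) (hx : Fills x y) :
    Composable (evL S (P.adv [(r, y)]) L) (whisk S P r x) := by
  have hr : Fits P.top (moves C [(r, y)]) := ⟨hL.1, trivial⟩
  have h1 := evaluatesL H hn (hP.adv hr) (L := L) (by rw [top_adv]; exact hL.2)
  refine .of_eq (m := d) ?_ ?_
  · rw [h1.dim, (H P hP).dim_whisk _ _ _ hL.1 hx.src]
    exact min_eq_left hx.1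
  · rw [← s_eq_bs h1.dim, h1.s, (H P hP).bt_whisk_tgt (H _ (hP.adv hr)) hL.1 hx]

theorem composable_whisk_evL (H : ∀ P : Dots C d, P.Valid → Evaluates S P) (hn : d + 1 ≤ n)
    {P : Dots C d} (hP : P.Valid) {r : ℕ} {y : C.cell (d + 1)} {x : C.Cell}
    {L : List (ℕ × C.cell (d + 1))} (hL : Fits P.top (moves C L))
    (hy : (P.adv L).top[r]? = some (C.src y)) (hx : Fills x y) :
    Composable (whisk S (P.adv L) r x) (evL S P L) := by
  have h1 := evaluatesL H hn hP hL
  have h2 := H _ (hP.adv hL)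
  refine .of_eq (m := d) ?_ ?_
  · rw [h1.dim, h2.dim_whisk _ _ _ hy hx.src]
    exact min_eq_right hx.1
  · rw [← t_eq_bt h1.dim, h1.t, h2.bs_whisk_src hy hx]

theorem evL_append (H : ∀ P : Dots C d, P.Valid → Evaluates S P) (hn : d + 1 ≤ n) {P : Dots C d}
    (hP : P.Valid) {L M : List (ℕ × C.cell (d + 1))} (hL : Fits P.top (moves C (L ++ M))) :
    evL S P (L ++ M) = S.c (evL S (P.adv L) M) (evL S P L) := by
  induction L generalizing P with
  | nil =>
    have h := (H P hP).dim
    have h1 := evaluatesL H hn hP (L := M) hL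
    -- The empty list contributes a unit on the source of the value of `M`, which is absorbed by law
    -- 9.
    rw [List.nil_append, adv_nil, evL_nil, SesquiStr.c_u_lt (by omega) (by rw [h1.dim]; omega)]
    rw [h, ← s_eq_bs h1.dim, h1.s]
  | cons r L ih =>
    have hr : Fits P.top (moves C [r]) := ⟨hL.1, trivial⟩
    have hf : Fits (P.adv [r]).top (moves C (L ++ M)) := by rw [top_adv]; exact hL.2
    have hf' := hf
    rw [moves_append, fits_append, ← top_adv] at hf'
    have h1 := evaluatesL H hn (hP.adv hr) hf'.1
    have h2 := evaluatesL H hn ((hP.adv hr).adv hf'.1) hf'.2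
    have hw := composable_evL_whisk H hn hP (L := L) ⟨hL.1, by rw [← top_adv_singleton]; exact hf'.1⟩
      (fills_self r.2)
    have hd : (whisk S P r.1 (of r.2)).dim = d + 1 :=
      (H P hP).dim_whisk _ _ _ hL.1 (fills_self r.2).src
    rw [List.cons_append, evL_cons, ih (hP.adv hr) hf, evL_cons,
      SesquiStr.c_assoc (h2.composable h1) hw (by rw [h1.dim, h2.dim, hd]; omega), adv_adv]
    rfl

/-- The composites which occur in a whiskered cell are defined. -/
structure WhiskSpec (S : SesquiStr C) (P : Dots C d) (L0 : List (ℕ × C.cell (d + 1))) (r : ℕ)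
    (y : C.cell (d + 1)) (L1 : List (ℕ × C.cell (d + 1))) (x : C.Cell) : Prop where
  before : EvaluatesL S P L0
  after : EvaluatesL S (P.adv (L0 ++ [(r, y)])) L1
  dim : (whisk S (P.adv L0) r x).dim = x.dim
  le_dim : d + 1 ≤ x.dim
  comp_before : Composable (whisk S (P.adv L0) r x) (evL S P L0)
  comp_after : Composable (evL S (P.adv (L0 ++ [(r, y)])) L1)
    (S.c (whisk S (P.adv L0) r x) (evL S P L0))
  comp_after' : Composable (evL S (P.adv (L0 ++ [(r, y)])) L1) (whisk S (P.adv L0) r x)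

theorem whiskSpec (H : ∀ P : Dots C d, P.Valid → Evaluates S P) (hn : d + 1 ≤ n) {P : Dots C d}
    (hP : P.Valid) {L0 L1 : List (ℕ × C.cell (d + 1))} {r : ℕ} {y : C.cell (d + 1)} {x : C.Cell}
    (hL : Fits P.top (moves C (L0 ++ (r, y) :: L1))) (hx : Fills x y) :
    WhiskSpec S P L0 r y L1 x := by
  rw [moves_append, fits_append, ← top_adv] at hL
  have hr : Fits (P.adv L0).top (moves C [(r, y)]) := ⟨hL.2.1, trivial⟩
  have h0 := evaluatesL H hn hP hL.1
  have h1 := evaluatesL H hn ((hP.adv hL.1).adv hr) (L := L1) (by rw [top_adv]; exact hL.2.2)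
  have k1 := composable_evL_whisk H hn (hP.adv hL.1) hL.2 hx
  have k0 := composable_whisk_evL H hn hP hL.1 hL.2.1 hx
  have hd := (H _ (hP.adv hL.1)).dim_whisk _ _ _ hL.2.1 hx.src
  have hle := hx.1
  rw [adv_adv] at h1 k1
  refine ⟨h0, h1, hd, hle, k0, ?_, k1⟩
  exact SesquiStr.composable_c_right k1 k0 (by rw [h0.dim, h1.dim, hd]; omega)

/-- The parts before and after the filled dot have values of dimension `d + 1`. For a cell of higher
dimension, boundaries therefore pass through both compositions by laws 1 and 2, down to the
whiskering in dimension `d`. -/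
theorem evaluates_snoc (H : ∀ P : Dots C d, P.Valid → Evaluates S P) (hn : d + 1 ≤ n)
    {P : Dots C (d + 1)} (hP : P.Valid) : Evaluates S P := by
  obtain _ | ⟨P, L⟩ := P
  obtain ⟨hP, hL⟩ := hP
  have hdim : (evL S P L).dim = d + 1 := (evaluatesL H hn hP hL).dim
  refine ⟨hdim, ?_, ?_, ?_, ?_⟩
  · intro q y x hy hx
    obtain ⟨L0, r, L1, rfl, rfl⟩ := exists_split hy
    have k := whiskSpec H hn hP hL hx
    have := k.le_dim
    rw [whisk_snoc, SesquiStr.dim_c k.comp_after, SesquiStr.dim_c k.comp_before, k.before.dim,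
      k.after.dim, k.dim]
    omega
  · intro q y x hy hx hd
    obtain ⟨L0, r, L1, rfl, rfl⟩ := exists_split hy
    have k := whiskSpec H hn hP hL hx
    have hL' := hL
    rw [moves_append, fits_append, ← top_adv] at hL'
    have e := SesquiStr.dim_c (S := S) k.comp_before
    rw [k.before.dim, k.dim] at e
    rw [whisk_snoc, whisk_snoc, SesquiStr.s_c_lt k.comp_after (by rw [k.after.dim]; omega),
      SesquiStr.s_c_gt k.comp_before (by rw [k.before.dim, k.dim]; omega),
      (H _ (hP.adv hL'.1)).s_whisk _ _ _ hL'.2.1 hx.src (by omega)]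
  · intro q y x hy hx hd
    obtain ⟨L0, r, L1, rfl, rfl⟩ := exists_split hy
    have k := whiskSpec H hn hP hL hx
    have hL' := hL
    rw [moves_append, fits_append, ← top_adv] at hL'
    have e := SesquiStr.dim_c (S := S) k.comp_before
    rw [k.before.dim, k.dim] at e
    rw [whisk_snoc, whisk_snoc, SesquiStr.t_c_lt k.comp_after (by rw [k.after.dim]; omega),
      SesquiStr.t_c_gt k.comp_before (by rw [k.before.dim, k.dim]; omega),
      (H _ (hP.adv hL'.1)).t_whisk _ _ _ hL'.2.1 hx.src (by omega)]
  · intro q y hy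
    obtain ⟨L0, r, L1, rfl, rfl⟩ := exists_split hy
    have hL' := hL
    rw [moves_append, fits_append, ← top_adv] at hL'
    -- Refilling a dot with its own label regroups the composite of the whole list; all three
    -- factors now have dimension `d + 1`, so law 5 applies.
    rw [whisk_snoc, ev_snoc, evL_append H hn hP hL, evL_cons, adv_adv]
    have k := whiskSpec H hn hP hL (fills_self y)
    rw [SesquiStr.c_assoc k.comp_after' k.comp_before
      (by rw [k.after.dim, k.before.dim, k.dim, dim_of]; omega)]

theorem evaluates (S : SesquiStr C) {P : Dots C d} (hP : P.Valid) (hn : d ≤ n) :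
    Evaluates S P := by
  induction d with
  | zero =>
    obtain ⟨x⟩ := P
    refine ⟨rfl, fun _ _ _ _ _ => rfl, fun _ _ _ _ _ _ => rfl, fun _ _ _ _ _ _ => rfl, ?_⟩
    intro q y hy
    obtain rfl : q = 0 := by
      have := (List.getElem?_eq_some_iff.1 hy).1
      simpa [top] using this
    obtain rfl : x = y := by simpa [top] using hy
    rfl
  | succ d ih => exact evaluates_snoc (fun P hP => ih hP (by omega)) hn hP

end

end Dots

end Sesqui

/-! ### Lower boundaries of evaluated diagrams, and evaluation of composites -/

namespace Sesqui

open GSet GSet.Cell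

namespace Dots

variable {n : ℕ} {C : GSet.{u} n} {d m : ℕ} {S : SesquiStr C}

theorem bs_ev_snoc {P : Dots C d} {L : List (ℕ × C.cell (d + 1))} (hP : (P.snoc L).Valid)
    (hn : d + 1 ≤ n) : bs d (ev S (P.snoc L)) = ev S P := by
  have h := evaluatesL (fun P hP => evaluates S hP (by omega)) hn hP.1 hP.2
  rw [ev_snoc, ← s_eq_bs h.dim, h.s]

theorem bt_ev_snoc {P : Dots C d} {L : List (ℕ × C.cell (d + 1))} (hP : (P.snoc L).Valid)
    (hn : d + 1 ≤ n) : bt d (ev S (P.snoc L)) = ev S (P.adv L) := by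
  have h := evaluatesL (fun P hP => evaluates S hP (by omega)) hn hP.1 hP.2
  rw [ev_snoc, ← t_eq_bt h.dim, h.t]

theorem bs_whisk_snoc {P : Dots C d} {L : List (ℕ × C.cell (d + 1))} (hP : (P.snoc L).Valid)
    (hn : d + 1 ≤ n) {q : ℕ} {y : C.cell (d + 1)} {x : C.Cell} (hy : (P.snoc L).top[q]? = some y)
    (hx : Fills x y) : bs d (whisk S (P.snoc L) q x) = ev S P := by
  obtain ⟨L0, r, L1, rfl, rfl⟩ := exists_split hy
  have k := whiskSpec (S := S) (fun P hP => evaluates S hP (by omega)) hn hP.1 hP.2 hx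
  have h1 := k.le_dim
  have e := SesquiStr.dim_c (S := S) k.comp_before
  rw [k.before.dim, k.dim] at e
  rw [whisk_snoc, SesquiStr.bs_c_lt k.comp_after (by rw [k.after.dim]; omega),
    SesquiStr.bs_c_lt k.comp_before (by rw [k.before.dim, k.dim]; omega),
    ← s_eq_bs k.before.dim, k.before.s]

theorem bt_whisk_snoc {P : Dots C d} {L : List (ℕ × C.cell (d + 1))} (hP : (P.snoc L).Valid)
    (hn : d + 1 ≤ n) {q : ℕ} {y : C.cell (d + 1)} {x : C.Cell} (hy : (P.snoc L).top[q]? = some y)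
    (hx : Fills x y) : bt d (whisk S (P.snoc L) q x) = ev S (P.adv L) := by
  obtain ⟨L0, r, L1, rfl, rfl⟩ := exists_split hy
  have k := whiskSpec (S := S) (fun P hP => evaluates S hP (by omega)) hn hP.1 hP.2 hx
  have h1 := k.le_dim
  have e := SesquiStr.dim_c (S := S) k.comp_before
  rw [k.before.dim, k.dim] at e
  rw [whisk_snoc, SesquiStr.bt_c_lt k.comp_after (by rw [k.after.dim]; omega),
    ← t_eq_bt k.after.dim, k.after.t, adv_adv]
  simp

theorem exists_snoc (P : Dots C (d + 1)) : ∃ T L, P = snoc T L := by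
  cases P with
  | snoc T L => exact ⟨T, L, rfl⟩

theorem boundary_ev_snoc {P : Dots C d} {L : List (ℕ × C.cell (d + 1))} (hP : (P.snoc L).Valid)
    (hn : d + 1 ≤ n) {p : ℕ} (hp : p < d) : bs p (ev S (P.snoc L)) = bs p (ev S P) ∧
      bt p (ev S (P.snoc L)) = bt p (ev S P) := by
  rw [← bs_bs (q := d) hp.le, ← bt_bs (q := d) hp, bs_ev_snoc hP hn]
  exact ⟨rfl, rfl⟩

theorem boundary_whisk_snoc {P : Dots C d} {L : List (ℕ × C.cell (d + 1))}
    (hP : (P.snoc L).Valid) (hn : d + 1 ≤ n) {q : ℕ} {y : C.cell (d + 1)} {x : C.Cell}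
    (hy : (P.snoc L).top[q]? = some y) (hx : Fills x y) {p : ℕ} (hp : p < d) :
    bs p (whisk S (P.snoc L) q x) = bs p (ev S P) ∧
      bt p (whisk S (P.snoc L) q x) = bt p (ev S P) := by
  rw [← bs_bs (q := d) hp.le, ← bt_bs (q := d) hp, bs_whisk_snoc hP hn hy hx]
  exact ⟨rfl, rfl⟩

/-- The part of a diagram up to dimension `m + 1`. -/
def low : ∀ j : ℕ, Dots C (m + 1 + j) → Dots C (m + 1)
  | 0, P => P
  | j + 1, snoc P _ => low j P

/-- The boundaries of dimension `m` of the cells obtained from `P`. -/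
theorem boundary_ev {j : ℕ} {P : Dots C (m + 1 + j)} (hP : P.Valid) (hn : m + 1 + j ≤ n)
    {T : Dots C m} {L : List (ℕ × C.cell (m + 1))} (h : low j P = T.snoc L) :
    bs m (ev S P) = ev S T ∧ bt m (ev S P) = ev S (T.adv L) := by
  induction j with
  | zero =>
    obtain rfl : P = T.snoc L := h
    exact ⟨bs_ev_snoc hP hn, bt_ev_snoc hP hn⟩
  | succ j ih =>
    obtain ⟨P, K, rfl⟩ := exists_snoc (d := m + 1 + j) P
    have := ih hP.1 (by omega) h
    have e := boundary_ev_snoc (S := S) hP hn (p := m) (by omega)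
    rwa [← e.1, ← e.2] at this

/-- If `j` is positive, the boundary of dimension `m` does not see the filling cell and is that of
the value of the diagram one dimension lower. -/
theorem boundary_whisk {j : ℕ} {P : Dots C (m + 1 + j)} (hP : P.Valid) (hn : m + 1 + j ≤ n)
    {T : Dots C m} {L : List (ℕ × C.cell (m + 1))} (h : low j P = T.snoc L) {q : ℕ}
    {y : C.cell (m + 1 + j)} {x : C.Cell} (hy : P.top[q]? = some y) (hx : Fills x y) :
    bs m (whisk S P q x) = ev S T ∧ bt m (whisk S P q x) = ev S (T.adv L) := by
  cases j with
  | zero =>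
    obtain rfl : P = T.snoc L := h
    exact ⟨bs_whisk_snoc hP hn hy hx, bt_whisk_snoc hP hn hy hx⟩
  | succ j =>
    obtain ⟨P, K, rfl⟩ := exists_snoc (d := m + 1 + j) P
    have := boundary_ev (S := S) hP.1 (by omega) (T := T) (L := L) h
    have e := boundary_whisk_snoc (S := S) hP hn hy hx (p := m) (by omega)
    rwa [← e.1, ← e.2] at this

theorem boundary_evL {j : ℕ} {P : Dots C (m + 1 + j)} (hP : P.Valid) (hn : m + 1 + j + 1 ≤ n)
    {T : Dots C m} {L : List (ℕ × C.cell (m + 1))} (h : low j P = T.snoc L)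
    {K : List (ℕ × C.cell (m + 1 + j + 1))} (hK : Fits P.top (moves C K)) :
    bs m (evL S P K) = ev S T ∧ bt m (evL S P K) = ev S (T.adv L) :=
  boundary_ev (j := j + 1) (P := P.snoc K) ⟨hP, hK⟩ hn h

/-- Advancing affects only the highest level. If this is level `m + 1`, its labels become parallel
ones, and the diagram of dimension `m` reached after them is the same. The condition under which
dots can be added at the end of level `m + 1` is thus stable. -/
theorem low_adv {j : ℕ} {P : Dots C (m + 1 + j)} {T : Dots C m} {L : List (ℕ × C.cell (m + 1))}
    (h : low j P = T.snoc L) {K : List (ℕ × C.cell (m + 1 + j + 1))}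
    (hK : Fits P.top (moves C K)) :
    ∃ L', low j (P.adv K) = T.snoc L' ∧ moves C L' = moves C L := by
  cases j with
  | zero =>
    obtain rfl : P = T.snoc L := h
    exact ⟨_, rfl, moves_run L K hK⟩
  | succ j =>
    obtain ⟨P, K, rfl⟩ := exists_snoc (d := m + 1 + j) P
    exact ⟨L, h, rfl⟩

theorem exists_low_adv {j : ℕ} {P : Dots C (m + 1 + j)} {T' : Dots C m}
    (h : ∃ T L, low j P = snoc T L ∧ T.adv L = T') {K : List (ℕ × C.cell (m + 1 + j + 1))}
    (hK : Fits P.top (moves C K)) : ∃ T L, low j (P.adv K) = snoc T L ∧ T.adv L = T' := by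
  obtain ⟨T, L, h1, h2⟩ := h
  obtain ⟨L', h3, h4⟩ := low_adv h1 hK
  exact ⟨T, L', h3, by rw [← h2, adv, adv, h4]⟩

/-! Whiskering on the left. -/

/-- Adding dots of dimension `m + 1` at the end. -/
def addLast (M : List (ℕ × C.cell (m + 1))) : ∀ j : ℕ, Dots C (m + 1 + j) → Dots C (m + 1 + j)
  | 0, snoc T L => snoc T (L ++ M)
  | j + 1, snoc P L => snoc (addLast M j P) L

/-- The moves of `K` take place at the positions of the original dots, in front of those of `M`. -/
theorem adv_addLast (M : List (ℕ × C.cell (m + 1))) {j : ℕ} {P : Dots C (m + 1 + j)}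
    {K : List (ℕ × C.cell (m + 1 + j + 1))} (hK : Fits P.top (moves C K)) :
    (addLast M j P).adv K = addLast M j (P.adv K) := by
  cases j with
  | zero =>
    obtain ⟨T, L, rfl⟩ := exists_snoc (d := m) P
    refine congrArg (snoc T) ?_
    rw [top] at hK
    rw [addLast, top, List.map_append, (run_append_right _ hK).2,
      Lab.relabel_append _ _ _ _ (by rw [run_length]; simp), relabel_self]
    rfl
  | succ j =>
    obtain ⟨P, L, rfl⟩ := exists_snoc (d := m + 1 + j) P
    rfl

section

variable {T' : Dots C m} {M : List (ℕ × C.cell (m + 1))} (hT' : T'.Valid)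
  (hM : Fits T'.top (moves C M)) (hm : m + 1 ≤ n)

include hT' hM hm

theorem composable_evL_left {x : C.Cell} (hx : m + 1 ≤ x.dim) (h : bt m x = ev S T') :
    Composable (evL S T' M) x := by
  have h1 := evaluatesL (S := S) (fun P hP => evaluates S hP (by omega)) hm hT' hM
  refine .of_eq (m := m) (by rw [h1.dim]; omega) ?_
  rw [← s_eq_bs h1.dim, h1.s, h]

/-- The hypothesis `H` is the claim one dimension lower. The value of `M` has dimension `m + 1`,
less than that of the factors for `K`, so it is distributed over them by law 6; for the empty list
it is moved inside a unit by law 9. -/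
theorem evL_addLast {j : ℕ} (hn : m + 1 + j + 1 ≤ n)
    (H : ∀ {P : Dots C (m + 1 + j)}, P.Valid →
      (∃ T L, low j P = snoc T L ∧ T.adv L = T') →
      ev S (addLast M j P) = S.c (evL S T' M) (ev S P) ∧
      ∀ q y x, P.top[q]? = some y → Fills x y →
        whisk S (addLast M j P) q x = S.c (evL S T' M) (whisk S P q x))
    {P : Dots C (m + 1 + j)} (hP : P.Valid) (hl : ∃ T L, low j P = snoc T L ∧ T.adv L = T')
    {K : List (ℕ × C.cell (m + 1 + j + 1))} (hK : Fits P.top (moves C K)) :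
    evL S (addLast M j P) K = S.c (evL S T' M) (evL S P K) := by
  have hA := (evaluatesL (S := S) (fun P hP => evaluates S hP (by omega)) hm hT' hM).dim
  induction K generalizing P with
  | nil =>
    have e := (evaluates S hP (by omega)).dim
    rw [evL_nil, evL_nil, (H hP hl).1]
    obtain ⟨T, L, h1, rfl⟩ := hl
    rw [SesquiStr.c_u_le (by omega)
      (composable_evL_left hT' hM hm (by omega) (boundary_ev hP (by omega) h1).2) (by omega)]
  | cons r K ih =>
    have hr : Fits P.top (moves C [r]) := ⟨hK.1, trivial⟩
    have hK' : Fits (P.adv [r]).top (moves C K) := by rw [top_adv]; exact hK.2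
    have hl' := exists_low_adv hl hr
    have e1 := (evaluatesL (S := S) (fun P hP => evaluates S hP (by omega)) hn (hP.adv hr) hK').dim
    have e2 : (whisk S P r.1 (of r.2)).dim = m + 1 + j + 1 :=
      (evaluates S hP (by omega)).dim_whisk _ _ _ hK.1 (fills_self r.2).src
    have k := composable_evL_whisk (S := S) (fun P hP => evaluates S hP (by omega)) hn hP hK
      (fills_self r.2)
    rw [evL_cons, adv_addLast M hr, ih (hP.adv hr) hl' hK',
      (H hP hl).2 _ _ _ hK.1 (fills_self r.2).src, evL_cons]
    refine (SesquiStr.c_c_left k ?_ (by rw [hA, e1]; omega) (by rw [hA, e2]; omega)).symm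
    obtain ⟨T, L, h1, rfl⟩ := hl'
    exact composable_evL_left hT' hM hm (by rw [e1]; omega) (boundary_evL (hP.adv hr) hn h1 hK').2

/-- Values and whiskerings have to be treated together, since the value in one dimension is built
from whiskerings in the preceding one. On level `m + 1` itself the claim is associativity; in the
induction step law 6 is applied to each of the two compositions in a whiskering. -/
theorem ev_addLast {j : ℕ} (hn : m + 1 + j ≤ n) {P : Dots C (m + 1 + j)} (hP : P.Valid)
    (hl : ∃ T L, low j P = snoc T L ∧ T.adv L = T') :
    ev S (addLast M j P) = S.c (evL S T' M) (ev S P) ∧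
      ∀ q y x, P.top[q]? = some y → Fills x y →
        whisk S (addLast M j P) q x = S.c (evL S T' M) (whisk S P q x) := by
  have hA := (evaluatesL (S := S) (fun P hP => evaluates S hP (by omega)) hm hT' hM).dim
  induction j with
  | zero =>
    obtain ⟨T, L, rfl, rfl⟩ := hl
    obtain ⟨hT, hL⟩ := hP
    have H : ∀ P : Dots C m, P.Valid → Evaluates S P := fun P hP => evaluates S hP (by omega)
    have hLM : Fits T.top (moves C (L ++ M)) := by
      rw [moves_append, fits_append, ← top_adv]; exact ⟨hL, hM⟩
    refine ⟨evL_append H hm hT hLM, ?_⟩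
    intro q y x hy hx
    obtain ⟨L0, r, L1, rfl, rfl⟩ := exists_split hy
    have k := whiskSpec (S := S) H hm hT hL hx
    have e : L0 ++ (r, y) :: L1 = L0 ++ [(r, y)] ++ L1 := by simp
    have f := hLM
    rw [e, List.append_assoc, moves_append, fits_append, ← top_adv] at f
    have hP' := hT.adv f.1
    have f' := f.2
    rw [moves_append, fits_append, ← top_adv, adv_adv, ← e] at f'
    rw [addLast, show L0 ++ (r, y) :: L1 ++ M = L0 ++ (r, y) :: (L1 ++ M) by simp, whisk_snoc,
      whisk_snoc, evL_append H hm hP' f.2, adv_adv, ← e]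
    -- Law 5 applies although the filling cell may have high dimension, because the values of `M`
    -- and of `L1` both have dimension `m + 1`.
    refine SesquiStr.c_assoc ?_ k.comp_after ?_
    · refine composable_evL_left hT' hM hm k.after.dim.ge ?_
      rw [← t_eq_bt k.after.dim, k.after.t, adv_adv, e]
    · rw [hA, k.after.dim]
      have := k.le_dim
      rw [SesquiStr.dim_c k.comp_before, k.dim, k.before.dim]
      omega
  | succ j ih =>
    obtain ⟨P, K, rfl⟩ := exists_snoc (d := m + 1 + j) P
    have hn' : m + 1 + j ≤ n := Nat.le_of_succ_le hn
    have H := fun {P : Dots C (m + 1 + j)} hP hl => ih hn' (P := P) hP hl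
    have HE : ∀ P : Dots C (m + 1 + j), P.Valid → Evaluates S P := fun P hP => evaluates S hP hn'
    refine ⟨evL_addLast hT' hM hm hn H hP.1 hl hP.2, ?_⟩
    intro q y x hy hx
    obtain ⟨L0, r, L1, rfl, rfl⟩ := exists_split hy
    have k := whiskSpec (S := S) HE hn hP.1 hP.2 hx
    obtain ⟨hP1, hP2⟩ := hP
    replace hl : ∃ T L, low j P = snoc T L ∧ T.adv L = T' := hl
    have f0 := hP2
    rw [moves_append, fits_append, ← top_adv] at f0
    have f1 := hP2
    rw [show L0 ++ (r, y) :: L1 = L0 ++ [(r, y)] ++ L1 by simp, moves_append, fits_append,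
      ← top_adv] at f1
    have l0 := exists_low_adv hl f0.1
    have l1 := exists_low_adv hl f1.1
    have hle : m + 1 + j + 1 ≤ x.dim := hx.1
    have dA : (evL S (P.adv (L0 ++ [(r, y)])) L1).dim = m + 1 + j + 1 := k.after.dim
    have dB : (evL S P L0).dim = m + 1 + j + 1 := k.before.dim
    rw [addLast, whisk_snoc, whisk_snoc, adv_addLast M f0.1, adv_addLast M f1.1,
      evL_addLast hT' hM hm hn H (hP1.adv f1.1) l1 f1.2,
      evL_addLast hT' hM hm hn H hP1 hl f0.1,
      (H (hP1.adv f0.1) l0).2 _ _ _ f0.2.1 hx.src, SesquiStr.c_c_left k.comp_after,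
      SesquiStr.c_c_left k.comp_before]
    · obtain ⟨T, L, h1, rfl⟩ := l0
      exact composable_evL_left hT' hM hm (by rw [k.dim]; omega)
        (boundary_whisk (hP1.adv f0.1) hn' h1 f0.2.1 hx.src).2
    · rw [hA, k.dim]; omega
    · rw [hA, dB]; omega
    · obtain ⟨T, L, h1, rfl⟩ := l1
      exact composable_evL_left hT' hM hm (by rw [dA]; omega)
        (boundary_evL (hP1.adv f1.1) hn h1 f1.2).2
    · rw [hA, dA]; omega
    · rw [hA, SesquiStr.dim_c k.comp_before, dB]; omega

end

/-! Whiskering on the right. -/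

/-- The shift of the positions of the dots which results from adding `k` dots of dimension
`m + 1`. -/
def shift (k : ℕ) : ℕ → ℕ
  | 0 => k
  | _ + 1 => 0

/-- Adding dots of dimension `m + 1` at the beginning. -/
def addFirst (T : Dots C m) (M : List (ℕ × C.cell (m + 1))) :
    ∀ j : ℕ, Dots C (m + 1 + j) → Dots C (m + 1 + j)
  | 0, snoc _ L => snoc T (M ++ L)
  | j + 1, snoc P L => snoc (addFirst T M j P) (sh (shift M.length j) L)

/-- The dots of `M` occupy the first positions of level `m + 1`, so dots attached to this level are
shifted, and they act behind the block of `M`. Positions on higher levels are unaffected. -/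
theorem adv_addFirst (T : Dots C m) (M : List (ℕ × C.cell (m + 1))) {j : ℕ}
    {P : Dots C (m + 1 + j)} {K : List (ℕ × C.cell (m + 1 + j + 1))}
    (hK : Fits P.top (moves C K)) :
    (addFirst T M j P).adv (sh (shift M.length j) K) = addFirst T M j (P.adv K) := by
  cases j with
  | zero =>
    obtain ⟨T', L, rfl⟩ := exists_snoc (d := m) P
    refine congrArg (snoc T) ?_
    rw [top] at hK
    have := (run_append_left (M.map Prod.snd) hK).2
    rw [List.length_map] at this
    rw [addFirst, top, List.map_append, shift, moves_sh, this,
      Lab.relabel_append _ _ _ _ (by simp), relabel_self]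
    rfl
  | succ j =>
    obtain ⟨P, L, rfl⟩ := exists_snoc (d := m + 1 + j) P
    refine congrArg (snoc (addFirst T M j P)) ?_
    rw [addFirst, top, sh_snd, shift, sh_zero, relabel_sh]
    rfl

section

variable {T : Dots C m} {M : List (ℕ × C.cell (m + 1))} (hT : T.Valid)
  (hM : Fits T.top (moves C M)) (hm : m + 1 ≤ n)

include hT hM hm

theorem composable_evL_right {x : C.Cell} (hx : m + 1 ≤ x.dim) (h : bs m x = ev S (T.adv M)) :
    Composable x (evL S T M) := by
  have h1 := evaluatesL (S := S) (fun P hP => evaluates S hP (by omega)) hm hT hM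
  refine .of_eq (m := m) (by rw [h1.dim]; omega) ?_
  rw [← t_eq_bt h1.dim, h1.t, h]

/-- Mirror image of `evL_addLast`: law 7 distributes the value of `M` over the factors, and law 8
moves it inside a unit. -/
theorem evL_addFirst {j : ℕ} (hn : m + 1 + j + 1 ≤ n)
    (H : ∀ {P : Dots C (m + 1 + j)}, P.Valid → (∃ L, low j P = snoc (T.adv M) L) →
      ev S (addFirst T M j P) = S.c (ev S P) (evL S T M) ∧
      ∀ q y x, P.top[q]? = some y → Fills x y →
        whisk S (addFirst T M j P) (shift M.length j + q) x = S.c (whisk S P q x) (evL S T M))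
    {P : Dots C (m + 1 + j)} (hP : P.Valid) (hl : ∃ L, low j P = snoc (T.adv M) L)
    {K : List (ℕ × C.cell (m + 1 + j + 1))} (hK : Fits P.top (moves C K)) :
    evL S (addFirst T M j P) (sh (shift M.length j) K) = S.c (evL S P K) (evL S T M) := by
  have hA := (evaluatesL (S := S) (fun P hP => evaluates S hP (by omega)) hm hT hM).dim
  induction K generalizing P with
  | nil =>
    have e := (evaluates S hP (by omega)).dim
    rw [sh_nil, evL_nil, evL_nil, (H hP hl).1]
    obtain ⟨L, h1⟩ := hl
    rw [SesquiStr.u_c_le (by omega)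
      (composable_evL_right hT hM hm (by omega) (boundary_ev hP (by omega) h1).1) (by omega)]
  | cons r K ih =>
    have hr : Fits P.top (moves C [r]) := ⟨hK.1, trivial⟩
    have hK' : Fits (P.adv [r]).top (moves C K) := by rw [top_adv]; exact hK.2
    have hl' : ∃ L, low j (P.adv [r]) = snoc (T.adv M) L := by
      obtain ⟨L, h1⟩ := hl
      obtain ⟨L', h3, -⟩ := low_adv h1 hr
      exact ⟨L', h3⟩
    have e1 := (evaluatesL (S := S) (fun P hP => evaluates S hP (by omega)) hn (hP.adv hr) hK').dim
    have e2 : (whisk S P r.1 (of r.2)).dim = m + 1 + j + 1 :=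
      (evaluates S hP (by omega)).dim_whisk _ _ _ hK.1 (fills_self r.2).src
    have k := composable_evL_whisk (S := S) (fun P hP => evaluates S hP (by omega)) hn hP hK
      (fills_self r.2)
    have ea : (addFirst T M j P).adv [(shift M.length j + r.1, r.2)] =
        addFirst T M j (P.adv [r]) := adv_addFirst T M hr
    rw [show sh (shift M.length j) (r :: K) =
        (shift M.length j + r.1, r.2) :: sh (shift M.length j) K from rfl, evL_cons, ea,
      ih (hP.adv hr) hl' hK', (H hP hl).2 _ _ _ hK.1 (fills_self r.2).src, evL_cons]
    refine (SesquiStr.c_c_right k ?_ (by rw [hA, e1]; omega) (by rw [hA, e2]; omega)).symm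
    obtain ⟨L, h1⟩ := hl
    exact composable_evL_right hT hM hm (by rw [e2]; omega)
      (boundary_whisk hP (by omega) h1 hK.1 (fills_self r.2).src).1

/-- As for `ev_addLast`, with two differences: the given diagram has to start where `M` ends, that
is, at `T.adv M`; and a dot of level `m + 1` is found at a position shifted by the length of `M`. -/
theorem ev_addFirst {j : ℕ} (hn : m + 1 + j ≤ n) {P : Dots C (m + 1 + j)} (hP : P.Valid)
    (hl : ∃ L, low j P = snoc (T.adv M) L) :
    ev S (addFirst T M j P) = S.c (ev S P) (evL S T M) ∧
      ∀ q y x, P.top[q]? = some y → Fills x y →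
        whisk S (addFirst T M j P) (shift M.length j + q) x =
          S.c (whisk S P q x) (evL S T M) := by
  have hA := (evaluatesL (S := S) (fun P hP => evaluates S hP (by omega)) hm hT hM).dim
  induction j with
  | zero =>
    obtain ⟨L, rfl⟩ := hl
    obtain ⟨hT', hL⟩ := hP
    have H : ∀ P : Dots C m, P.Valid → Evaluates S P := fun P hP => evaluates S hP (by omega)
    have hML : Fits T.top (moves C (M ++ L)) := by
      rw [moves_append, fits_append, ← top_adv]; exact ⟨hM, hL⟩
    refine ⟨evL_append H hm hT hML, ?_⟩
    intro q y x hy hx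
    obtain ⟨L0, r, L1, rfl, rfl⟩ := exists_split hy
    have k := whiskSpec (S := S) H hm hT' hL hx
    have f := hML
    rw [← List.append_assoc, moves_append, fits_append] at f
    rw [addFirst, show M ++ (L0 ++ (r, y) :: L1) = (M ++ L0) ++ (r, y) :: L1 by simp, shift,
      ← List.length_append, whisk_snoc, whisk_snoc, evL_append H hm hT f.1, List.append_assoc,
      ← adv_adv T M L0, ← adv_adv T M (L0 ++ [(r, y)])]
    have hle := k.le_dim
    have c0 : Composable (evL S (T.adv M) L0) (evL S T M) :=
      composable_evL_right hT hM hm k.before.dim.ge (by rw [← s_eq_bs k.before.dim, k.before.s])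
    have hd := SesquiStr.dim_c (S := S) k.comp_before
    have c1 : Composable (S.c (whisk S ((T.adv M).adv L0) r x) (evL S (T.adv M) L0))
        (evL S T M) :=
      SesquiStr.composable_c_left k.comp_before c0
        (by rw [hA, k.before.dim, k.dim]; omega)
    -- The value of `M` joins the part before the filled dot, so it has to be moved past two
    -- brackets; at either of them two factors have dimension `m + 1`.
    rw [SesquiStr.c_assoc k.comp_after c1 (by rw [hA, k.after.dim, hd, k.before.dim]; omega),
      SesquiStr.c_assoc k.comp_before c0 (by rw [hA, k.before.dim, k.dim]; omega)]
  | succ j ih =>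
    obtain ⟨P, K, rfl⟩ := exists_snoc (d := m + 1 + j) P
    have hn' : m + 1 + j ≤ n := Nat.le_of_succ_le hn
    have H := fun {P : Dots C (m + 1 + j)} hP hl => ih hn' (P := P) hP hl
    have HE : ∀ P : Dots C (m + 1 + j), P.Valid → Evaluates S P := fun P hP => evaluates S hP hn'
    refine ⟨evL_addFirst hT hM hm hn H hP.1 hl hP.2, ?_⟩
    intro q y x hy hx
    obtain ⟨L0, r, L1, rfl, rfl⟩ := exists_split hy
    have k := whiskSpec (S := S) HE hn hP.1 hP.2 hx
    obtain ⟨hP1, hP2⟩ := hP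
    replace hl : ∃ L, low j P = snoc (T.adv M) L := hl
    have f0 := hP2
    rw [moves_append, fits_append, ← top_adv] at f0
    have f1 := hP2
    rw [show L0 ++ (r, y) :: L1 = L0 ++ [(r, y)] ++ L1 by simp, moves_append, fits_append,
      ← top_adv] at f1
    have l0 : ∃ L, low j (P.adv L0) = snoc (T.adv M) L := by
      obtain ⟨L, h1⟩ := hl
      obtain ⟨L', h3, -⟩ := low_adv h1 f0.1
      exact ⟨L', h3⟩
    have l1 : ∃ L, low j (P.adv (L0 ++ [(r, y)])) = snoc (T.adv M) L := by
      obtain ⟨L, h1⟩ := hl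
      obtain ⟨L', h3, -⟩ := low_adv h1 f1.1
      exact ⟨L', h3⟩
    have hle : m + 1 + j + 1 ≤ x.dim := hx.1
    have dA : (evL S (P.adv (L0 ++ [(r, y)])) L1).dim = m + 1 + j + 1 := k.after.dim
    have dB : (evL S P L0).dim = m + 1 + j + 1 := k.before.dim
    have cB : Composable (evL S P L0) (evL S T M) := by
      obtain ⟨L, h1⟩ := hl
      exact composable_evL_right hT hM hm (by rw [dB]; omega) (boundary_evL hP1 hn h1 f0.1).1
    have hc := SesquiStr.dim_c (S := S) k.comp_before
    rw [dB, k.dim] at hc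
    have a1 := adv_addFirst T M f1.1
    rw [sh_append] at a1
    rw [addFirst, whisk_snoc, show shift M.length (j + 1) + L0.length = L0.length from
      Nat.zero_add _]
    have e := whisk_snoc S (addFirst T M j P) (sh (shift M.length j) L0)
      (shift M.length j + r, y) (sh (shift M.length j) L1) x
    rw [sh_length] at e
    rw [sh_append]
    refine e.trans ?_
    rw [adv_addFirst T M f0.1]
    change S.c (evL S ((addFirst T M j P).adv (sh _ L0 ++ sh _ [(r, y)])) _) _ = _
    rw [a1, evL_addFirst hT hM hm hn H (hP1.adv f1.1) l1 f1.2,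
      evL_addFirst hT hM hm hn H hP1 hl f0.1,
      (H (hP1.adv f0.1) l0).2 _ _ _ f0.2.1 hx.src, SesquiStr.c_c_right k.comp_after,
      SesquiStr.c_c_right k.comp_before cB]
    · rw [hA, k.dim]; omega
    · rw [hA, dB]; omega
    · exact SesquiStr.composable_whisker_right' k.comp_before cB (by rw [hA, k.dim]; omega)
        (by rw [hA, dB]; omega)
    · rw [hA, dA]; omega
    · rw [hA, hc]; omega

end

end Dots

end Sesqui

/-! ### Evaluation of labelled diagrams, and their freeness -/

namespace Sesqui

open GSet GSet.Cell

namespace Lab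

open Dots

variable {n : ℕ} {C : GSet.{u} n} {x y z : (obj C).Cell} {d m : ℕ}

theorem lv_zero_ne_nil (z : (obj C).Cell) : lv z 0 ≠ [] := by
  obtain ⟨a, ha⟩ := lv_zero z
  rw [ha]
  exact List.cons_ne_nil _ _

/-- The dots of dimension at most `d` of a labelled diagram. -/
def dots (z : (obj C).Cell) : ∀ d : ℕ, Dots C d
  | 0 => base ((lv z 0).head (lv_zero_ne_nil z)).2
  | d + 1 => snoc (dots z d) (lv z (d + 1))

theorem dots_congr (h : ∀ p ≤ d, lv y p = lv z p) : dots y d = dots z d := by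
  induction d with
  | zero => simp only [dots, h 0 le_rfl]
  | succ d ih => rw [dots, dots, ih fun p hp => h p (by omega), h _ le_rfl]

theorem top_dots (z : (obj C).Cell) (d : ℕ) : (dots z d).top = (lv z d).map Prod.snd := by
  cases d with
  | zero =>
    obtain ⟨a, ha⟩ := lv_zero z
    simp only [dots, ha]
    rfl
  | succ d => rfl

theorem valid_dots (z : (obj C).Cell) (d : ℕ) : (dots z d).Valid := by
  induction d with
  | zero => trivial
  | succ d ih => exact ⟨ih, by rw [top_dots]; exact lv_fits z d⟩

/-- The hypotheses say that the levels of `y` up to `d` are those of the target of `z` in dimension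
`d`. They hold for the target of a diagram as well as for the first factor of a composable pair. -/
theorem adv_dots (h : ∀ p < d, lv y p = lv z p) (h' : lv y d = relabel (lv z d) (fin z d)) :
    (dots z d).adv (lv z (d + 1)) = dots y d := by
  rw [adv, top_dots, ← fin]
  cases d with
  | zero =>
    obtain ⟨a, ha⟩ := lv_zero z
    have hl := fin_length z 0
    rw [ha] at h' hl
    obtain ⟨b, hb⟩ := List.length_eq_one_iff.1 hl.symm
    rw [hb] at h' ⊢
    simp only [dots, h']
    rfl
  | succ d =>
    rw [dots, dots, setTop, h', dots_congr fun p hp => (h p (by omega))]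

theorem adv_dots_comp (h : Composable x y) (hm : min x.dim y.dim = m + 1) :
    (dots y m).adv (lv y (m + 1)) = dots x m :=
  adv_dots (fun _ hp => composable_lv h hm hp) (composable_lv_self h hm)

theorem low_dots (z : (obj C).Cell) (j : ℕ) :
    low j (dots z (m + 1 + j)) = snoc (dots z m) (lv z (m + 1)) := by
  induction j with
  | zero => rfl
  | succ j ih => exact ih

theorem dots_addLast {M : List (ℕ × C.cell (m + 1))} (h1 : ∀ p ≤ m, lv z p = lv y p)
    (h2 : lv z (m + 1) = lv y (m + 1) ++ M) (h3 : ∀ p, m + 1 < p → lv z p = lv y p) (j : ℕ) :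
    dots z (m + 1 + j) = addLast M j (dots y (m + 1 + j)) := by
  induction j with
  | zero =>
    change snoc _ _ = snoc _ _
    rw [dots_congr h1, h2]
  | succ j ih =>
    exact congrArg₂ snoc ih (h3 (m + 1 + j + 1) (by omega))

theorem dots_addFirst (h1 : ∀ p ≤ m, lv z p = lv y p)
    (h2 : lv z (m + 1) = lv y (m + 1) ++ lv x (m + 1))
    (h3 : lv z (m + 1 + 1) = sh (lv y (m + 1)).length (lv x (m + 1 + 1)))
    (h4 : ∀ p, m + 1 + 1 < p → lv z p = lv x p) (j : ℕ) :
    dots z (m + 1 + j) = addFirst (dots y m) (lv y (m + 1)) j (dots x (m + 1 + j)) := by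
  induction j with
  | zero =>
    change snoc _ _ = snoc _ _
    rw [dots_congr h1, h2]
  | succ j ih =>
    refine congrArg₂ snoc ih ?_
    cases j with
    | zero => exact h3
    | succ j =>
      rw [shift, sh_zero]
      exact h4 (m + 1 + (j + 1) + 1) (by omega)

/-- The composite of all cells of a labelled diagram. -/
noncomputable def evCell (S : SesquiStr C) (z : (obj C).Cell) : C.Cell := ev S (dots z z.dim)

theorem evCell_eq (S : SesquiStr C) (h : z.dim = d) : evCell S z = ev S (dots z d) := by
  subst h; rfl

theorem dim_evCell (S : SesquiStr C) (z : (obj C).Cell) : (evCell S z).dim = z.dim :=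
  (evaluates S (valid_dots z _) (GSet.Cell.le_dim z)).dim

theorem s_evCell (S : SesquiStr C) (hz : 1 ≤ z.dim) : evCell S z.s = (evCell S z).s := by
  obtain ⟨d, hd⟩ : ∃ d, z.dim = d + 1 := ⟨z.dim - 1, by omega⟩
  have hn : d + 1 ≤ n := hd ▸ GSet.Cell.le_dim z
  have e := evCell_eq S hd
  rw [s_eq_bs ((dim_evCell S z).trans hd), e, dots, bs_ev_snoc (valid_dots z (d + 1)) hn,
    evCell_eq S (d := d) (by rw [dim_s]; omega), dots_congr fun p hp => lv_s (by omega)]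

theorem t_evCell (S : SesquiStr C) (hz : 1 ≤ z.dim) : evCell S z.t = (evCell S z).t := by
  obtain ⟨d, hd⟩ : ∃ d, z.dim = d + 1 := ⟨z.dim - 1, by omega⟩
  have hn : d + 1 ≤ n := hd ▸ GSet.Cell.le_dim z
  have e := evCell_eq S hd
  rw [t_eq_bt ((dim_evCell S z).trans hd), e, dots, bt_ev_snoc (valid_dots z (d + 1)) hn,
    evCell_eq S (d := d) (by rw [dim_t]; omega),
    adv_dots (fun p hp => lv_t (by omega)) (lv_t_self hd)]

theorem evCell_unit (S : SesquiStr C) (h : z.dim < n) :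
    evCell S (unitCell z h) = S.u (evCell S z) := by
  rw [evCell_eq S (dim_unitCell h), dots, ev_snoc,
    show lv (unitCell z h) (z.dim + 1) = [] from lv_top (x := z) z.dim.lt_succ_self, evL_nil]
  exact congrArg (fun P => S.u (ev S P)) (dots_congr fun p _ => rfl)

/-- The factor of smaller dimension `m + 1` only adds its dots to level `m + 1` of the other one: at
the end if it is `x`, at the beginning if it is `y`. Composability says that `x` starts on level `m`
where `y` ends. -/
theorem evCell_comp (S : SesquiStr C) (h : Composable x y) :
    evCell S (compCell x y h) = S.c (evCell S x) (evCell S y) := by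
  obtain ⟨m, hm⟩ := h.exists_dim
  have hxn := GSet.Cell.le_dim x
  have hyn := GSet.Cell.le_dim y
  have ha := adv_dots_comp h hm
  -- For equal dimensions either case applies, with `j = 0`.
  rcases le_total x.dim y.dim with hxy | hxy
  · have hx : x.dim = m + 1 := by omega
    obtain ⟨j, hj⟩ : ∃ j, y.dim = m + 1 + j := ⟨y.dim - (m + 1), by omega⟩
    have hd : (compCell x y h).dim = m + 1 + j := by rw [dim_compCell]; omega
    rw [evCell_eq S hd, evCell_eq S hx, evCell_eq S hj,
      dots_addLast (y := y) (M := lv x (m + 1)) (fun p hp => lv_comp_lt h (by omega))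
        (lv_comp_eq h hm.symm) (fun p hp => lv_comp_right h (by omega)),
      (ev_addLast (valid_dots x m) (valid_dots x (m + 1)).2 (by omega) (by omega)
        (valid_dots y _) ⟨_, _, low_dots y j, ha⟩).1]
    rfl
  · have hy : y.dim = m + 1 := by omega
    obtain ⟨j, hj⟩ : ∃ j, x.dim = m + 1 + j := ⟨x.dim - (m + 1), by omega⟩
    have hd : (compCell x y h).dim = m + 1 + j := by rw [dim_compCell]; omega
    rw [evCell_eq S hd, evCell_eq S hj, evCell_eq S hy,
      dots_addFirst (x := x) (y := y) (fun p hp => lv_comp_lt h (by omega))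
        (lv_comp_eq h hm.symm) (lv_comp_succ h hy rfl) (fun p hp => lv_comp_left h (by omega)),
      (ev_addFirst (valid_dots y m) (valid_dots y (m + 1)).2 (by omega) (by omega)
        (valid_dots x _) ⟨_, by rw [low_dots, ha]⟩).1]
    rfl

theorem dots_pure (a : C.cell (d + 1)) :
    dots (Hom.onCell (pureHom C) (of a)) (d + 1) =
      snoc (dots (Hom.onCell (pureHom C) (of (C.src a))) d) [(0, a)] := by
  have h1 : lv (Hom.onCell (pureHom C) (of a)) (d + 1) = [(0, a)] := down_self a
  rw [dots, h1]
  exact congrArg (fun P => snoc P [(0, a)]) (dots_congr fun p hp => down_succ a hp)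

theorem top_dots_pure (a : C.cell d) :
    (dots (Hom.onCell (pureHom C) (of a)) d).top = [a] := by
  have h1 : lv (Hom.onCell (pureHom C) (of a)) d = [(0, a)] := down_self a
  rw [top_dots, h1]; rfl

/-- On each level there are no dots before or after the given one, so the whiskering composes only
with units on the source and target of `a`, which laws 8 and 9 absorb. -/
theorem whisk_pure (S : SesquiStr C) (a : C.cell d) {x : C.Cell} (hx : Fills x a) :
    whisk S (dots (Hom.onCell (pureHom C) (of a)) d) 0 x = x := by
  induction d generalizing x with
  | zero => rfl
  | succ d ih =>
    obtain ⟨P, hP⟩ : ∃ P, dots (Hom.onCell (pureHom C) (of (C.src a))) d = P := ⟨_, rfl⟩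
    have ht := top_dots_pure (C.src a)
    have hv : P.Valid := by rw [← hP]; exact valid_dots _ _
    have ih' := @ih (C.src a)
    rw [hP] at ih' ht
    have hn : d + 1 ≤ n := C.dim_le a
    have h0 : P.top[0]? = some (C.src a) := by rw [ht]; rfl
    -- The values of the two boundary diagrams, on which these units are formed, are whiskerings of
    -- their own labels and hence known by induction.
    have ev0 : ev S P = of (C.src a) := by
      rw [← (evaluates S hv (by omega)).whisk_of _ _ h0, ih' (fills_self _)]
    have ev1 : ev S (P.adv [(0, a)]) = of (C.tgt a) := by
      have hv' : (P.adv [(0, a)]).Valid := hv.adv ⟨h0, trivial⟩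
      rw [← (evaluates S hv' (by omega)).whisk_of 0 (C.tgt a) (by
          rw [top_adv_singleton, ht]; rfl),
        show whisk S (P.adv [(0, a)]) 0 (of (C.tgt a)) = _ from whisk_adv (r := (0, a)) h0 _, ih']
      rw [← t_of]
      exact (fills_self a).src.t (Nat.lt_succ_self d)
    have e := whisk_snoc S P [] (0, a) [] x
    rw [adv_nil] at e
    have hle := hx.1
    have hs : (of (C.src a) : C.Cell).dim = d := rfl
    have ht' : (of (C.tgt a) : C.Cell).dim = d := rfl
    rw [dots_pure, hP]
    refine e.trans ?_
    rw [ih' hx.src, evL_nil, evL_nil, ev0, List.nil_append, ev1,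
      SesquiStr.c_u_lt (by omega) (by omega) (by rw [hs, hx.bs]),
      SesquiStr.u_c_lt (by omega) (by omega) (by rw [ht', hx.bt])]

theorem evCell_pure (S : SesquiStr C) (x : C.Cell) :
    evCell S (Hom.onCell (pureHom C) x) = x := by
  obtain ⟨k, a⟩ := x
  have h := whisk_pure S a (fills_self a)
  rw [(evaluates S (valid_dots _ _) (C.dim_le a)).whisk_of 0 a (by rw [top_dots_pure]; rfl)] at h
  exact h

/-- The composite of all cells of a labelled diagram, as a map of globular sets. -/
noncomputable def evHom (S : SesquiStr C) : obj C ⟶ C :=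
  homOfCell (evCell S) (dim_evCell S) (fun _ h => s_evCell S h) fun _ h => t_evCell S h

theorem onCell_evHom (S : SesquiStr C) (z : (obj C).Cell) :
    Hom.onCell (evHom S) z = evCell S z := onCell_homOfCell _ _ _ _ z

theorem evHom_preserves (S : SesquiStr C) : (str C).Preserves S (evHom S) := by
  rw [SesquiStr.preserves_iff]
  refine ⟨fun x y h => ?_, fun x h => ?_⟩
  · rw [SesquiStr.c_eq h]
    simp only [onCell_evHom]
    exact evCell_comp S h
  · rw [SesquiStr.u_eq h]
    simp only [onCell_evHom]
    exact evCell_unit S h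

variable (n) in
/-- Labelled diagrams form free structures. -/
noncomputable def free : FreeSesqui (monad.{u} n) where
  str := str
  pure := pureHom
  pure_eq _ := rfl
  map_preserves := map_preserves
  mu_preserves := join_preserves
  ind X p h1 h2 h3 z := by
    induction gen_all z with
    | pure x => exact h1 x
    | comp h _ _ hx hy => exact h2 _ _ h hx hy
    | unit h _ hx => exact h3 _ h hx
  ev := evHom
  ev_preserves := evHom_preserves
  pure_ev S := GSet.hom_ext_onCell fun x => (onCell_evHom S _).trans (evCell_pure S x)

end Lab

end Sesqui

namespace Sesqui

open GSet GSet.Cell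

/-! ### Transport of algebra structures -/

section

variable {n : ℕ} {T T' : Monad (GSet.{u} n)} {C D : GSet.{u} n}

/-- The algebra structure obtained by restriction along a morphism of monads. -/
def AlgStr.comap (e : T ⟶ T') (A : AlgStr T' C) : AlgStr T C where
  a := e.app C ≫ A.a
  unit := by rw [← Category.assoc, e.app_η, A.unit]
  assoc := by
    have h : T.map A.a ≫ e.app C = e.app (T'.obj C) ≫ T'.map A.a := e.naturality A.a
    rw [← Category.assoc, e.app_μ, Category.assoc, A.assoc, Category.assoc,
      ← Category.assoc (e.app (T'.obj C)), ← h, Functor.map_comp]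
    simp only [Category.assoc]

theorem AlgStr.ext_a {A B : AlgStr T C} (h : A.a = B.a) : A = B := by
  cases A
  cases B
  cases h
  rfl

theorem hom_inv_app (e : T ≅ T') (X : GSet.{u} n) : e.hom.app X ≫ e.inv.app X = 𝟙 _ :=
  congrArg (fun f : T ⟶ T => f.app X) e.hom_inv_id

/-- Isomorphic monads have the same algebra structures. -/
def AlgStr.comapEquiv (e : T ≅ T') (C : GSet.{u} n) : AlgStr T' C ≃ AlgStr T C where
  toFun := AlgStr.comap e.hom
  invFun := AlgStr.comap e.inv
  left_inv A := AlgStr.ext_a <| by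
    have h := hom_inv_app e.symm C
    change e.inv.app C ≫ e.hom.app C ≫ A.a = A.a
    rw [← Category.assoc]
    exact (congrArg (· ≫ A.a) h).trans (Category.id_comp _)
  right_inv A := AlgStr.ext_a <| by
    have h := hom_inv_app e C
    change e.hom.app C ≫ e.inv.app C ≫ A.a = A.a
    rw [← Category.assoc]
    exact (congrArg (· ≫ A.a) h).trans (Category.id_comp _)

theorem AlgStr.exists_hom_iff (A : AlgStr T C) (B : AlgStr T D) (f : C ⟶ D) :
    (∃ g : A.algebra ⟶ B.algebra, g.f = f) ↔ T.map f ≫ B.a = A.a ≫ f := by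
  constructor
  · rintro ⟨g, rfl⟩
    exact g.h
  · exact fun h => ⟨⟨f, h⟩, rfl⟩

/-- By naturality the two conditions differ by precomposition with a component of `e`, which is
invertible. -/
theorem AlgStr.exists_hom_comap_iff (e : T ≅ T') (A : AlgStr T' C) (B : AlgStr T' D) (f : C ⟶ D) :
    (∃ g : (A.comap e.hom).algebra ⟶ (B.comap e.hom).algebra, g.f = f) ↔
      ∃ g : A.algebra ⟶ B.algebra, g.f = f := by
  rw [AlgStr.exists_hom_iff, AlgStr.exists_hom_iff]
  have h : T.map f ≫ e.hom.app D = e.hom.app C ≫ T'.map f := e.hom.naturality f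
  change T.map f ≫ e.hom.app D ≫ B.a = (e.hom.app C ≫ A.a) ≫ f ↔ _
  rw [← Category.assoc, h, Category.assoc, Category.assoc]
  refine ⟨fun k => ?_, fun k => by rw [k]⟩
  have h' := hom_inv_app e.symm C
  have k' := congrArg (fun g => e.inv.app C ≫ g) k
  simp only [← Category.assoc] at k'
  change e.inv.app C ≫ e.hom.app C = 𝟙 _ at h'
  rw [h'] at k'
  simpa using k'

/-- A monad is isomorphic to the monad transported along an isomorphism of functors. -/
def transportIso {F : GSet.{u} n ⥤ GSet.{u} n} (T : Monad (GSet.{u} n)) (i : T.toFunctor ≅ F) :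
    T ≅ T.transport i :=
  MonadIso.mk i (fun _ => rfl) fun X => by
    have h : F.map (i.inv.app X) ≫ i.inv.app (T.obj X) =
      i.inv.app (F.obj X) ≫ T.map (i.inv.app X) := i.inv.naturality (i.inv.app X)
    simp [Monad.transport, ← Functor.map_comp_assoc]

end

/-! ### The generators as labelled diagrams -/

namespace Lab

variable {n : ℕ} {X : GSet.{u} n} {x y : X.Cell}

theorem fst_pure (x : X.Cell) (m : ℕ) : (lv (Hom.onCell (pureHom X) x) m).map Prod.fst =
    if m ≤ x.dim then [0] else [] := by
  obtain ⟨k, a⟩ := x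
  change (down X k a m).map Prod.fst = if m ≤ k then [0] else []
  split_ifs with h
  · induction k with
    | zero =>
      obtain rfl : m = 0 := by omega
      rw [down_self]; rfl
    | succ k ih =>
      rcases (show m = k + 1 ∨ m ≤ k by omega) with rfl | h
      · rw [down_self]; rfl
      · rw [down_succ a h, ih _ h]
  · rw [down_top a (by omega)]; rfl

theorem lv_pure (x : X.Cell) : lv (Hom.onCell (pureHom X) x) x.dim = [(0, x.2)] := down_self x.2

/-- The labelled diagram with given lists of labelled dots. -/
noncomputable def toLabelled (z : (obj X).Cell) : Labelled X z.1 :=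
  (Labelled.equivLab X z.1).symm z.2

theorem lvl_toLabelled (z : (obj X).Cell) (m : ℕ) : (toLabelled z).lvl m = lv z m :=
  congrFun (congrArg Lab.lvl ((Labelled.equivLab X z.1).apply_symm_apply z.2)) m

theorem hasLabel_of_get {k : ℕ} {z : Labelled X k} {p q : ℕ} {c : X.Cell}
    (h : (z.lvl c.dim)[p]? = some (q, c.2)) : z.HasLabel p c := by
  obtain ⟨hp, e⟩ := List.getElem?_eq_some_iff.1 h
  rw [Labelled.lvl_get] at e
  exact ⟨_, rfl, congrArg Prod.snd e⟩

/-- Composing two diagrams with one dot per level puts two dots, both over position 0, on the level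
of the smaller dimension. The dot on the next level is shifted to the second of these exactly if it
comes from `x`, that is, if `y` has smaller dimension. -/
theorem isCircDiagram_of_lvl (hx : 1 ≤ x.dim) (hy : 1 ≤ y.dim) {z : Labelled X (max x.dim y.dim)}
    (hz : ∀ m, z.lvl m = cmp (min x.dim y.dim) (lv (Hom.onCell (pureHom X) x))
      (lv (Hom.onCell (pureHom X) y)) m) : IsCircDiagram x y ⟨_, z⟩ := by
  have hx' := lv_pure x
  have hy' := lv_pure y
  have h0 : z.diag = Diagram.circ x.dim y.dim hx hy := by
    apply Diagram.ext
    funext m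
    have hf : ∀ (o : ℕ) (L : List (ℕ × X.cell m)),
        (sh o L).map Prod.fst = (L.map Prod.fst).map (o + ·) := fun o L => by simp [sh]
    have hlen : (lv (Hom.onCell (pureHom X) y) (min x.dim y.dim)).length = 1 := by
      rw [← List.length_map (f := Prod.fst), fst_pure, if_pos (min_le_right _ _)]; rfl
    rw [← Labelled.lvl_fst, hz, cmp, apply_ite (List.map Prod.fst), List.map_append, hf, fst_pure,
      fst_pure, hlen]
    change _ = if max x.dim y.dim < m then [] else if m = min x.dim y.dim then [0, 0]
      else if m = min x.dim y.dim + 1 ∧ y.dim < x.dim then [1] else [0]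
    split_ifs <;> first | omega | simp
  have h1 : z.HasLabel 0 y := by
    apply hasLabel_of_get (q := 0)
    rw [hz, cmp, if_neg (show ¬y.dim < min x.dim y.dim by omega), hy']
    rfl
  have h2 : z.HasLabel (if x.dim ≤ y.dim then 1 else 0) x := by
    split_ifs with h
    · apply hasLabel_of_get (q := 0)
      have hlen : (lv (Hom.onCell (pureHom X) y) x.dim).length = 1 := by
        rw [← List.length_map (f := Prod.fst), fst_pure, if_pos h]; rfl
      obtain ⟨r, hr⟩ := List.length_eq_one_iff.1 hlen
      rw [hz, cmp, if_neg (show ¬x.dim < min x.dim y.dim by omega),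
        if_neg (show ¬x.dim = min x.dim y.dim + 1 by omega), sh_zero, hr, hx']
      rfl
    · have hnil : lv (Hom.onCell (pureHom X) y) x.dim = [] :=
        lv_top (show y.dim < x.dim by omega)
      -- Only the label of the dot matters; `q` is the position it lies over, as computed by `cmp`.
      refine hasLabel_of_get (q := (if x.dim = min x.dim y.dim + 1 then
        (lv (Hom.onCell (pureHom X) y) (min x.dim y.dim)).length else 0) + 0) ?_
      rw [hz, cmp, if_neg (show ¬x.dim < min x.dim y.dim by omega), hnil, hx']
      rfl
  -- The labelling has the required type only after its diagram has been replaced by the equal one.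
  obtain ⟨le, D, f⟩ := z
  change D = _ at h0
  subst h0
  exact ⟨hx, hy, le, f, rfl, h2, h1⟩

theorem isUnitDiagram_of_lvl {z : Labelled X (x.dim + 1)}
    (hz : ∀ m, z.lvl m = lv (Hom.onCell (pureHom X) x) m) : IsUnitDiagram x ⟨_, z⟩ := by
  have h0 : z.diag = Diagram.unit (x.dim + 1) (Nat.le_add_left 1 _) := by
    apply Diagram.ext
    funext m
    rw [← Labelled.lvl_fst, hz, fst_pure]
    change _ = if x.dim + 1 ≤ m then [] else [0]
    split_ifs <;> first | omega | rfl
  have h1 : z.HasLabel 0 x := by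
    apply hasLabel_of_get (q := 0)
    rw [hz, lv_pure]
    rfl
  obtain ⟨le, D, f⟩ := z
  change D = _ at h0
  subst h0
  exact ⟨le, f, rfl, h1⟩

theorem isCircDiagram (h : Composable x y) :
    IsCircDiagram x y (Hom.onCell ((Labelled.isoLab n).hom.app X)
      (((free n).str X).c (Hom.onCell ((free n).pure X) x) (Hom.onCell ((free n).pure X) y))) := by
  rw [SesquiStr.c_eq (h.map _)]
  exact isCircDiagram_of_lvl h.1 h.2.1
    (lvl_toLabelled (compCell (Hom.onCell (pureHom X) x) (Hom.onCell (pureHom X) y) (h.map _)))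

theorem isUnitDiagram (h : x.dim < n) :
    IsUnitDiagram x (Hom.onCell ((Labelled.isoLab n).hom.app X)
      (((free n).str X).u (Hom.onCell ((free n).pure X) x))) := by
  rw [SesquiStr.u_eq (x := Hom.onCell ((free n).pure X) x) h]
  exact isUnitDiagram_of_lvl (lvl_toLabelled (unitCell (Hom.onCell (pureHom X) x) h))

variable (n) in
/-- The monad of labelled simple string diagrams is that of their lists of labelled dots. -/
noncomputable def isoSesqui : monad.{u} n ≅ sesquiMonad.{u} n :=
  transportIso (monad.{u} n) (Labelled.isoLab n)

end Lab

end Sesqui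

/-! ### The isomorphism of monads and the description of the algebras -/

theorem theorem1 (n : ℕ) :
    (∃ φ : Tree.monad.{u} n ≅ sesquiMonad.{u} n,
      (∀ (X : GSet.{u} n) (x y : X.Cell) (h : Composable x y),
        IsCircDiagram x y (interpret φ.hom X (Tree.circ x y h))) ∧
      ∀ (X : GSet.{u} n) (x : X.Cell) (h : x.dim < n),
        IsUnitDiagram x (interpret φ.hom X (Tree.unitCell x h))) ∧
    ∃ Φ : ∀ C : GSet.{u} n, AlgStr (sesquiMonad.{u} n) C ≃ SesquiStr C,
      (∀ (C : GSet.{u} n) (S : AlgStr (sesquiMonad n) C),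
        (∀ (x y : C.Cell) (h : Composable x y),
          ∃ z, IsCircDiagram x y z ∧ (Φ C S).comp x y h = S.eval z) ∧
        ∀ (x : C.Cell) (h : x.dim < n), ∃ z, IsUnitDiagram x z ∧ (Φ C S).unit x h = S.eval z) ∧
      ∀ (C D : GSet.{u} n) (S : AlgStr (sesquiMonad n) C) (S' : AlgStr (sesquiMonad n) D)
        (f : C ⟶ D),
        (∃ g : S.algebra ⟶ S'.algebra, g.f = f) ↔ (Φ C S).Preserves (Φ D S') f := by
  -- Everything passes through the monad of lists of dots: it is compared with trees by freeness and
  -- with string diagrams by transport. The correspondence for algebras restricts along the latter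
  -- isomorphism and then reads off the operations.
  refine ⟨⟨(Tree.free n).iso (Lab.free n) ≪≫ Lab.isoSesqui n, fun X x y h => ?_, fun X x h => ?_⟩,
    fun C => (AlgStr.comapEquiv (Lab.isoSesqui n) C).trans ((Lab.free n).equiv C),
    fun C S => ⟨fun x y h => ⟨_, Lab.isCircDiagram h, ?_⟩, fun x h => ⟨_, Lab.isUnitDiagram h, ?_⟩⟩,
    fun C D S S' f => ?_⟩
  · rw [Tree.circ_eq h]
    have e := (Tree.free n).iso_comp (Lab.free n) h
    have := Lab.isCircDiagram h
    rw [← e] at this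
    exact this
  · rw [Tree.unitCell_eq h]
    have e := (Tree.free n).iso_unit (Lab.free n) h
    have := Lab.isUnitDiagram h
    rw [← e] at this
    exact this
  -- The restricted algebra map is the isomorphism followed by the given one, so its operations are
  -- by definition the values at the generating diagrams.
  · rfl
  · rfl
  · exact (AlgStr.exists_hom_comap_iff (Lab.isoSesqui n) S S' f).symm.trans
      ((Lab.free n).exists_hom_iff _ _ f)
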